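/- **Setting.** A charged scatterer configuration is an infinite, locally finite set of points $x_n\in\mathbb R^3$ in which each point carries a charge $Q_{j_n}$ from a finite set $I=\{Q_1,\dots,Q_L\}\subset\mathbb R$. Let $\mu$ be a probability measure on $I$, let $\bar q:=\sum_j\mu(Q_j)Q_j$, and let $P=\nu\otimes\mu$ be the law of the Poisson process of intensity one in $\mathbb R^3$ with independent charges of law $\mu$: for pairwise disjoint bounded Borel sets $B_a$, the numbers of scatterers of charge $Q_j$ in $B_a$ are independent Poisson variables with parameters $\mu(Q_j)|B_a|$. The measurable space is generated by the numbers of scatterers of given charge in bounded open sets. Let $s>1/2$ and let $\Phi\in\mathcal C_s$: $\Phi\in C^2(\mathbb R^3\setminus\{0\};\mathbb R)$ is radial and there are $A\neq0$, $r>\max(s,2)$, $C$ with $|\Phi(x)-A|x|^{-s}|+|x|\,|\nabla(\Phi(x)-A|x|^{-s})|\le C|x|^{-r}$ for $|x|\ge1$. For bounded sets $D_R\subset\mathbb R^3$ put $$F^{(R)}(x)=-\sum_{x_n\in D_R}Q_{j_n}\nabla\Phi(x-x_n),\qquad F^{(R),0}(x)=F^{(R)}(x)+\int_{D_R}\nabla\Phi(x-y)\,dy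 ,$$ with $D_R=RU$ unless stated otherwise. Here $U$ always denotes a bounded open set with $0\in U$ and $\partial U\in C^1$, and $n$, $dS$ are the outer unit normal and the surface measure on $\partial U$. Gradients are evaluated at the displayed argument: $\nabla\Phi(x-y)=(\nabla\Phi)(x-y)$. A random field is a family of measurable maps $F(x)$, $x\in\mathbb R^3$, on the space of configurations, finite almost surely. *Convergence in law* of $F^{(R)}$ to $F$ means that $P(F^{(R)}(x)\in S)\to P(F(x)\in S)$ as $R\to\infty$ for all $x$ and all Borel sets $S$, and that all $J$-point characteristic functions $\mathbb E[\exp(i\sum_{k=1}^J\eta_k\cdot F^{(R)}(y_k))]$ converge to those of $F$. $F$ is *translation invariant* if $P(\bigcap_k\{F(x_k+a)\in S_k\})=P(\bigcap_k\{F(x_k)\in S_k\})$ for all sequences of points $x_k$ and of Borel sets $S_k$ and all $a\in\mathbb R^3$. A *cutoff* is a radial $\xi\in C^\infty(\mathbb R^3)$ with $\xi(y)=1$ for $|y|\ge1$ and $\xi(y)=0$ for $|y|\le\frac12$. Call $\xi$ *admissible* if it is any cutoff, when $|\nabla\Phi|$ is not integrable at the origin, or if $\xi\equiv1$, when it is.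 For $M:\mathbb R^3\to\mathbb R^3$, say that $F$ *has characteristic functional with mean $M$* if, for every admissible $\xi$, all $J$ and all $\eta_k,y_k\in\mathbb R^3$, the integrals below converge absolutely and $$\mathbb E\Big[e^{i\sum_k\eta_k\cdot F(y_k)}\Big]=\exp\Big(i\sum_{k}\eta_k\cdot M(y_k)\Big)\exp\Big(\sum_{j}\mu(Q_j)\int_{\mathbb R^3}\Big[e^{-iQ_j\sum_k\eta_k\cdot\nabla\Phi(y_k-y)}-1+iQ_j\sum_k\eta_k\cdot\nabla\Phi(y_k-y)\,\xi(y_k-y)\Big]dy\Big),$$ and if moreover $F(x)$ is integrable with $\mathbb E[F(x)]=M(x)$ for all $x$ whenever $|\nabla\Phi|$ is integrable at the origin. Say that $M$ *is the limit mean force of* $(D_R)$ if $$M(x)=-A\,\bar q\,\lim_{R\to\infty}\int_{D_R}\nabla\Big(\frac1{|\cdot|^s}\Big)(x-y)\,\xi(x-y)\,dy\qquad\text{for all }x$$ for every cutoff $\xi$, and, if $s<2$, also for $\xi\equiv1$. **Theorem.** Let $\Phi\in\mathcal C_s$ with $s>1/2$. * **(a.1), (a.2)** If $s>2$, or if $\bar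 q=0$ (neutrality), there is a translation invariant random field $F$, having characteristic functional with mean $M=0$ and not depending on $U$, such that for every $U$ the fields $F^{(R)}$ with $D_R=RU$ converge in law to $F$ and $0$ is the limit mean force of $(RU)$. * **(a.3)** If $I=\{1\}$ and $\int_{|y|<1}|\nabla\Phi(y)|\,dy<\infty$, there is a translation invariant random field $F$, having characteristic functional with mean $M=0$ and not depending on $U$, such that for every $U$ the fields $F^{(R),0}$ with $D_R=RU$ converge in law to $F$. * **(b)** Let $1<s\le2$. Call $U$ *balanced* if $\int_{U\setminus\{|y|<\delta\}}\nabla(|y|^{-s})\,dy=0$ for some $\delta>0$ with $\{|y|<\delta\}\subset U$. There is a translation invariant random field $F$, having characteristic functional with mean $M=0$ and not depending on $U$, such that for every balanced $U$ the fields $F^{(R)}$ with $D_R=RU$ converge in law to $F$ and $0$ is the limit mean force of $(RU)$. However, let $\bar q\ne0$ and let $U$ be balanced, and replace $RU$ by $D_R=RU-R^{s-1}e$, $e\in\mathbb R^3$. Then for all sufficiently small $|e|$ the fields $F^{(R)}$ converge in law to a random field having characteristic functional with mean $M_e$, where $M_e$ is the limit mean force of $(RU-R^{s-1}e)$, and there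 are arbitrarily small $e$ with $M_e\not\equiv0$. * **(c)** Let $s=1$ and $\int_U\nabla(|y|^{-1})\,dy=0$. Then the fields $F^{(R)}$ with $D_R=RU$ converge in law to a random field $F_U$ having characteristic functional with mean $$M_U(x)=A\sum_{j=1}^L\mu(Q_j)Q_j\int_{\partial U}\frac{(x\cdot y)\,n(y)}{|y|^3}\,dS(y),$$ and $M_U$ is the limit mean force of $(RU)$. If $\bar q\neq0$, then $F_U$ is not translation invariant, and it depends on $U$: there are two such domains $U_1,U_2$ and a point $x$ for which the laws of $F_{U_1}(x)$ and $F_{U_2}(x)$ differ. -/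

import Mathlib

open MeasureTheory Filter Topology Set
open scoped Pointwise

namespace Holtsmark

/-- Euclidean three-space. -/
abbrev E : Type := EuclideanSpace ℝ (Fin 3)

noncomputable section

/-! ### Charged scatterer configurations and the Poisson distribution -/

/-- A charged scatterer configuration: an infinite, locally finite set of scatterers in `ℝ³`,
each carrying one charge from the finite set `I`. The configuration is recorded as the set of
pairs (position, charge); `injOn` says that every position carries exactly one charge. -/
structure ChargedConfiguration (I : Finset ℝ) where
  carrier : Set (E × I)
  injOn : Set.InjOn Prod.fst carrier
  infinite : carrier.Infinite
  locallyFinite : ∀ K : Set E, IsCompact K → {p ∈ carrier | p.1 ∈ K}.Finite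

/-- The number of scatterers of charge `q` in the region `B`. -/
def ChargedConfiguration.count {I : Finset ℝ} (ω : ChargedConfiguration I) (B : Set E)
    (q : I) : ℕ :=
  {p ∈ ω.carrier | p.1 ∈ B ∧ p.2 = q}.ncard

/-- The σ-algebra generated by the events "`U` contains exactly `m` scatterers of charge `q`",
for `U` bounded and open. -/
instance (I : Finset ℝ) : MeasurableSpace (ChargedConfiguration I) :=
  MeasurableSpace.generateFrom
    {S | ∃ (U : Set E) (m : ℕ) (q : I), IsOpen U ∧ Bornology.IsBounded U ∧
      S = {ω : ChargedConfiguration I | ω.count U q = m}}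

/-- `P` is the scatterer distribution `ν ⊗ μ`: scatterers form a Poisson process of intensity one
in `ℝ³`, with independent charges of law `μ`. Equivalently, the numbers of scatterers of charge `q`
in `B a`, for finitely many pairwise disjoint bounded Borel sets `B a` and all `q ∈ I`, are
independent Poisson variables of parameters `μ {q} |B a|`. -/
def IsScattererDistribution {I : Finset ℝ} (μ : Measure I)
    (P : Measure (ChargedConfiguration I)) : Prop :=
  ∀ (k : ℕ) (B : Fin k → Set E), (∀ a, MeasurableSet (B a)) →
    (∀ a, Bornology.IsBounded (B a)) → Pairwise (fun a b => Disjoint (B a) (B b)) →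
    ∀ n : Fin k → I → ℕ,
      P {ω | ∀ a q, ω.count (B a) q = n a q} =
        ENNReal.ofReal (∏ a, ∏ q : I,
          Real.exp (-(μ.real {q} * volume.real (B a))) *
            (μ.real {q} * volume.real (B a)) ^ n a q / (n a q).factorial)

/-- The average charge `∑_j μ(Q_j) Q_j`. -/
def meanCharge {I : Finset ℝ} (μ : Measure I) : ℝ := ∑ q : I, μ.real {q} * (q : ℝ)

/-! ### Potentials and cutoffs -/

/-- The potential `1 / |x| ^ s`. -/
def powerPotential (s : ℝ) (x : E) : ℝ := 1 / ‖x‖ ^ s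

/-- `Φ` belongs to the class `𝒞_s`, with leading coefficient `A`. The value `Φ 0` is irrelevant. -/
structure IsInClass (s A : ℝ) (Φ : E → ℝ) : Prop where
  contDiffOn : ContDiffOn ℝ 2 Φ {0}ᶜ
  radial : ∀ x y : E, ‖x‖ = ‖y‖ → Φ x = Φ y
  ne_zero : A ≠ 0
  decay : ∃ C r : ℝ, max s 2 < r ∧ ∀ x : E, 1 ≤ ‖x‖ →
    |Φ x - A * powerPotential s x| +
      ‖x‖ * ‖gradient (fun y => Φ y - A * powerPotential s y) x‖ ≤ C / ‖x‖ ^ r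

/-- `|∇Φ|` is integrable at the origin. -/
def GradIntegrableAtOrigin (Φ : E → ℝ) : Prop :=
  IntegrableOn (gradient Φ) (Metric.ball 0 1)

/-- A smooth radial function equal to `0` for `|y| ≤ 1/2` and to `1` for `|y| ≥ 1`. -/
structure IsCutoff (ξ : E → ℝ) : Prop where
  contDiff : ContDiff ℝ ((⊤ : ℕ∞) : WithTop ℕ∞) ξ
  radial : ∀ x y : E, ‖x‖ = ‖y‖ → ξ x = ξ y
  eq_one : ∀ y : E, 1 ≤ ‖y‖ → ξ y = 1
  eq_zero : ∀ y : E, ‖y‖ ≤ 1 / 2 → ξ y = 0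

/-- The functions `ξ` allowed in the characteristic functional: an arbitrary cutoff if `|∇Φ|` is
not integrable at the origin, and `ξ ≡ 1` otherwise. -/
def IsAdmissible (Φ ξ : E → ℝ) : Prop :=
  (¬ GradIntegrableAtOrigin Φ ∧ IsCutoff ξ) ∨ (GradIntegrableAtOrigin Φ ∧ ξ = fun _ => 1)

/-! ### Domains with `C¹` boundary -/

/-- A local defining function `g` of `U` near the boundary point `p`. -/
def IsLocalDefiningFunction (U : Set E) (p : E) (g : E → ℝ) : Prop :=
  gradient g p ≠ 0 ∧
    ∃ V : Set E, IsOpen V ∧ p ∈ V ∧ ContDiffOn ℝ 1 g V ∧ U ∩ V = {x ∈ V | g x < 0}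

/-- A bounded open set containing the origin, with boundary of class `C¹`. -/
structure IsC1Domain (U : Set E) : Prop where
  isOpen : IsOpen U
  isBounded : Bornology.IsBounded U
  zero_mem : (0 : E) ∈ U
  boundary : ∀ p ∈ frontier U, ∃ g : E → ℝ, IsLocalDefiningFunction U p g

/-- `v` is the outer unit normal to `∂U` at `p`. -/
def IsOuterNormal (U : Set E) (p v : E) : Prop :=
  ∃ g : E → ℝ, IsLocalDefiningFunction U p g ∧ v = ‖gradient g p‖⁻¹ • gradient g p

/-- The outer unit normal to `∂U` at `p`. -/
def outerNormal (U : Set E) (p : E) : E := Classical.epsilon (IsOuterNormal U p)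

/-- The dilated domains `RU`. -/
def dilates (U : Set E) (R : ℝ) : Set E := R • U

/-- The displaced domains `RU - R ^ (s - 1) e`. -/
def shiftedDilates (U : Set E) (s : ℝ) (e : E) (R : ℝ) : Set E :=
  (fun y => y - R ^ (s - 1) • e) '' (R • U)

/-! ### Force fields -/

/-- The field `-∑_{x_n ∈ D R} Q_n ∇Φ(x - x_n)` of the scatterers in the finite cloud `D R`. -/
def truncatedField {I : Finset ℝ} (Φ : E → ℝ) (D : ℝ → Set E) (R : ℝ) (x : E)
    (ω : ChargedConfiguration I) : E :=
  -∑ᶠ (p : E × I) (_ : p ∈ {p ∈ ω.carrier | p.1 ∈ D R}), (p.2 : ℝ) • gradient Φ (x - p.1)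

/-- The field of the scatterers in `D R` together with a uniform background of charge density
`-1`. -/
def backgroundField {I : Finset ℝ} (Φ : E → ℝ) (D : ℝ → Set E) (R : ℝ) (x : E)
    (ω : ChargedConfiguration I) : E :=
  truncatedField Φ D R x ω + ∫ y in D R, gradient Φ (x - y)

/-- Invariance under translations of a random field. -/
def TranslationInvariant {Ω : Type*} [MeasurableSpace Ω] (P : Measure Ω) (F : E → Ω → E) : Prop :=
  ∀ (x : ℕ → E) (S : ℕ → Set E), (∀ k, MeasurableSet (S k)) → ∀ a : E,
    P (⋂ k, F (x k + a) ⁻¹' S k) = P (⋂ k, F (x k) ⁻¹' S k)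

/-- The `J`-point characteristic function of a random field. -/
def charFun {Ω : Type*} [MeasurableSpace Ω] (P : Measure Ω) (F : E → Ω → E) {J : ℕ}
    (η y : Fin J → E) : ℂ :=
  ∫ ω, Complex.exp (Complex.I * ((∑ k, inner ℝ (η k) (F (y k) ω) : ℝ) : ℂ)) ∂P

/-- The random fields `G R` converge in law to the random field `F` as `R → ∞`: for every point
`x` the law of `G R x` converges, on every Borel set, to that of `F x`; moreover all the
finite-dimensional distributions converge, which is expressed through the `J`-point characteristic
functions. The field `F` is finite everywhere, so the value `∞` is not needed. -/
structure ConvergesInLaw {Ω : Type*} [MeasurableSpace Ω] (P : Measure Ω) (G : ℝ → E → Ω → E)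
    (F : E → Ω → E) : Prop where
  measurable_approx : ∀ R : ℝ, 0 < R → ∀ x, Measurable (G R x)
  measurable : ∀ x, Measurable (F x)
  tendsto : ∀ (x : E) (S : Set E), MeasurableSet S →
    Tendsto (fun R => P (G R x ⁻¹' S)) atTop (𝓝 (P (F x ⁻¹' S)))
  tendsto_charFun : ∀ (J : ℕ) (η y : Fin J → E),
    Tendsto (fun R => charFun P (G R) η y) atTop (𝓝 (charFun P F η y))

/-- The integrand
`exp(-i q ∑ η_k·∇Φ(y_k - z)) - 1 + i q ∑ η_k·∇Φ(y_k - z) ξ(y_k - z)`. -/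
def functionalIntegrand (Φ ξ : E → ℝ) (q : ℝ) {J : ℕ} (η y : Fin J → E) (z : E) : ℂ :=
  Complex.exp (-Complex.I * ((q * ∑ k, inner ℝ (η k) (gradient Φ (y k - z)) : ℝ) : ℂ)) - 1 +
    Complex.I * ((q * ∑ k, inner ℝ (η k) (gradient Φ (y k - z)) * ξ (y k - z) : ℝ) : ℂ)

/-- The characteristic functional with mean force `M` and cutoff `ξ`. -/
def limitFunctional {I : Finset ℝ} (μ : Measure I) (Φ ξ : E → ℝ) (M : E → E) {J : ℕ}
    (η y : Fin J → E) : ℂ :=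
  Complex.exp (Complex.I * ((∑ k, inner ℝ (η k) (M (y k)) : ℝ) : ℂ)) *
    Complex.exp (∑ q : I, ((μ.real {q} : ℝ) : ℂ) * ∫ z, functionalIntegrand Φ ξ (q : ℝ) η y z)

/-- `F` is the field with characteristic functional `limitFunctional`, for every admissible `ξ`
(the integrals in it being absolutely convergent), and with mean `M` whenever `|∇Φ|` is integrable
at the origin (otherwise `F x` need not have an expectation). -/
structure IsHoltsmarkField {I : Finset ℝ} (μ : Measure I) (P : Measure (ChargedConfiguration I))
    (Φ : E → ℝ) (M : E → E) (F : E → ChargedConfiguration I → E) : Prop where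
  measurable : ∀ x, Measurable (F x)
  integrable : ∀ ξ : E → ℝ, IsAdmissible Φ ξ → ∀ (q : I) (J : ℕ) (η y : Fin J → E),
    Integrable (functionalIntegrand Φ ξ (q : ℝ) η y)
  charFun_eq : ∀ ξ : E → ℝ, IsAdmissible Φ ξ → ∀ (J : ℕ) (η y : Fin J → E),
    charFun P F η y = limitFunctional μ Φ ξ M η y
  mean : GradIntegrableAtOrigin Φ → ∀ x, Integrable (F x) P ∧ ∫ ω, F x ω ∂P = M x

/-- `M x` is the limit as `R → ∞` of
`-A ∑_j μ(Q_j) Q_j ∫_{D R} ∇(1/|·|^s)(x - y) ξ(x - y) dy`, for every cutoff `ξ`, and also for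
`ξ ≡ 1` if `s < 2`, when the integral converges without cutoff. -/
def IsLimitMeanForce {I : Finset ℝ} (s A : ℝ) (μ : Measure I) (D : ℝ → Set E) (M : E → E) :
    Prop :=
  ∀ ξ : E → ℝ, (IsCutoff ξ ∨ (s < 2 ∧ ξ = fun _ => 1)) → ∀ x : E,
    Tendsto (fun R => (-A * meanCharge μ) •
        ∫ y in D R, ξ (x - y) • gradient (powerPotential s) (x - y))
      atTop (𝓝 (M x))

/-- The symmetry condition `∫_{U ∖ B_δ} ∇(1/|y|^s) dy = 0`, where `B_δ` is a ball centred at the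
origin and contained in `U`; by radial symmetry it does not depend on the choice of `δ`. -/
def IsBalanced (s : ℝ) (U : Set E) : Prop :=
  ∃ δ : ℝ, 0 < δ ∧ Metric.ball 0 δ ⊆ U ∧
    ∫ y in U \ Metric.ball 0 δ, gradient (powerPotential s) y = 0

/-- The condition `∫_U ∇(1/|y|) dy = 0`. -/
def IsCoulombBalanced (U : Set E) : Prop :=
  ∫ y in U, gradient (powerPotential 1) y = 0

/-- The mean force `A ∑_j μ(Q_j) Q_j ∫_{∂U} (x·y) n(y) / |y|³ dS(y)`; the surface measure `dS` is
the two-dimensional Hausdorff measure, normalized as Euclidean area. -/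
def coulombMeanForce {I : Finset ℝ} (A : ℝ) (μ : Measure I) (U : Set E) (x : E) : E :=
  (A * meanCharge μ) • ∫ y in frontier U, (inner ℝ x y / ‖y‖ ^ 3) • outerNormal U y
    ∂(Measure.euclideanHausdorffMeasure 2 : Measure E)

end

end Holtsmark

open MeasureTheory Filter Topology Set
open scoped Pointwise

namespace Holtsmark

noncomputable section

/-! ### The point measure of a configuration -/

variable {I : Finset ℝ}

/-! At distance `|u| ≥ 1` the force is of order `|u|^(-s-1)`, and its square is integrable at
infinity because `s > 1/2`. Its first power is integrable there only for `s > 2`. So fluctuations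
always converge, and the shape of the cloud can influence the limit only through a deterministic
mean force.

Fluctuations. Campbell's formula (`integral_exp_base`) bounds the second moment of a centred sum by
the integral of the squared force (`lintegral_sq_cloudSum_sub_le`). Centred sums over the far
scatterers are therefore Cauchy in `L²`, with one limit for all exhausting families of regions
(`exists_limit_centredSum`). Adding the finitely many near scatterers gives a single translation
invariant field `F₀`, whose characteristic functional is Campbell's formula with a compensated
exponent. By `exists_holtsmarkField`, the cloud field behaves like `F₀` plus a deterministic vector,
and each statement on convergence becomes one about the limit of `∫ ∇Φ(x - y) dy` over the part of
`D R` outside the unit ball about `x`.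

Setwise convergence is stronger than weak convergence and needs smoothing. The scatterers in a fixed
shell around `x` are independent of the others, so the law of the force is a convolution with a
compound Poisson law. Its jump law is isotropic, and the sum of two jumps already has a density
(`shellForceLaw_conv_absolutelyContinuous`). Outside the event of at most one jump, which is rare
for a thick shell, the law thus has a density, and convolution with a density turns convergence in
distribution of the remaining force into convergence on every Borel set
(`tendsto_measure_preimage_of_charFun_mul`).

Mean force. The field `∇Φ - A ∇|u|^(-s)` is odd and integrable at infinity, so it contributes
nothing in the limit, and any odd change near the origin is invisible too. What remains is
homogeneous: over `RU - c` the integral equals `R^(2-s) G((x + c)/R)`, where `G` (`domainForce`) is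
the differentiable force field of `U` for a kernel smoothed near the origin. Balance means `G(0) =
0`. For `1 < s ≤ 2` and `c = 0` the limit is zero. A shift `c = R^(s-1) e` produces `G'(0) e` if `s
< 2` and `G(e)` if `s = 2`. For `s = 1` the limit is `G'(0) x`. The trace of `G'(0)` is negative for
`s ≥ 1` (`domainForceDeriv_ne_zero`), which gives all the nonvanishing claims.

Coulomb case. `G'(0) x` becomes a surface integral by the divergence theorem on `C¹` domains
(`IsC1Domain.setIntegral_fderiv`). It is proved here with Hausdorff measure: near a boundary point
the surface is almost flat, oblique projection to the tangent plane is almost isometric, and Fubini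
along lines transversal to the surface gives the formula up to a relative error that a partition of
unity preserves. A ball and a union of three balls have different `G'(0)`, and fields with different
means have different laws because the characteristic functions differ by a phase
(`IsHoltsmarkField.map_ne`). -/

theorem integrableOn_count_finset {α F : Type*} [MeasurableSpace α] [MeasurableSingletonClass α]
    [NormedAddCommGroup F] (s : Finset α) (f : α → F) :
    IntegrableOn f (s : Set α) Measure.count := by
  rw [← (s : Set α).biUnion_of_singleton]
  simp [integrableOn_finset_iUnion]

namespace ChargedConfiguration

theorem finite_of_isBounded (ω : ChargedConfiguration I) {B : Set E}
    (hB : Bornology.IsBounded B) : {p ∈ ω.carrier | p.1 ∈ B}.Finite :=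
  (ω.locallyFinite _ hB.isCompact_closure).subset fun _ hp => ⟨hp.1, subset_closure hp.2⟩

/-- The finite set of scatterers in a bounded region. -/
def scatterersIn (ω : ChargedConfiguration I) {B : Set E} (hB : Bornology.IsBounded B) :
    Finset (E × I) := (ω.finite_of_isBounded hB).toFinset

@[simp]
theorem mem_scatterersIn (ω : ChargedConfiguration I) {B : Set E} (hB : Bornology.IsBounded B)
    (p : E × I) : p ∈ ω.scatterersIn hB ↔ p ∈ ω.carrier ∧ p.1 ∈ B := by
  simp [scatterersIn]

/-- The sum of unit masses at the scatterers. -/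
def pointMeasure (ω : ChargedConfiguration I) : Measure (E × I) :=
  Measure.count.restrict ω.carrier

theorem pointMeasure_restrict (ω : ChargedConfiguration I) {B : Set E}
    (hB : Bornology.IsBounded B) (hBm : MeasurableSet B) :
    ω.pointMeasure.restrict (B ×ˢ univ) = Measure.count.restrict (ω.scatterersIn hB : Set (E × I)) := by
  rw [pointMeasure, Measure.restrict_restrict (hBm.prod MeasurableSet.univ)]
  congr 1
  ext p
  simp [and_comm]

theorem integrableOn_pointMeasure {F : Type*} [NormedAddCommGroup F]
    (ω : ChargedConfiguration I) {B : Set E}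
    (hB : Bornology.IsBounded B) (hBm : MeasurableSet B) (f : E × I → F) :
    IntegrableOn f (B ×ˢ univ) ω.pointMeasure := by
  rw [IntegrableOn, pointMeasure_restrict ω hB hBm]
  exact integrableOn_count_finset _ f

theorem integral_pointMeasure {F : Type*} [NormedAddCommGroup F] [NormedSpace ℝ F]
    [CompleteSpace F] (ω : ChargedConfiguration I) {B : Set E}
    (hB : Bornology.IsBounded B) (hBm : MeasurableSet B) (f : E × I → F) :
    ∫ p in B ×ˢ univ, f p ∂ω.pointMeasure = ∑ p ∈ ω.scatterersIn hB, f p := by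
  rw [pointMeasure_restrict ω hB hBm, setIntegral_finset]
  · simp [Measure.real]
  · exact integrableOn_count_finset _ f

theorem pointMeasure_prod_singleton (ω : ChargedConfiguration I) {B : Set E}
    (hB : Bornology.IsBounded B) (hBm : MeasurableSet B) (q : I) :
    ω.pointMeasure (B ×ˢ {q}) = ω.count B q := by
  have h : B ×ˢ {q} ∩ ω.carrier = {p ∈ ω.carrier | p.1 ∈ B ∧ p.2 = q} := by
    ext p; simp [and_comm]
  have hf : {p ∈ ω.carrier | p.1 ∈ B ∧ p.2 = q}.Finite :=
    (ω.finite_of_isBounded hB).subset fun p hp => ⟨hp.1, hp.2.1⟩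
  rw [pointMeasure, Measure.restrict_apply (hBm.prod (measurableSet_singleton q)), h,
    Measure.count_apply_finite _ hf, count, Set.ncard_eq_toFinset_card _ hf]

end ChargedConfiguration

open ChargedConfiguration

/-! ### Measurability of counts and of the point measure. -/

/-- Only counts in bounded open sets are measurable by definition. Inside a fixed ball `V ⊇ B` all
counts are finite, so complements become differences, and Dynkin's theorem started from the open
sets reaches every Borel set. -/
theorem measurable_count {B : Set E} (hB : Bornology.IsBounded B) (hBm : MeasurableSet B) (q : I) :
    Measurable fun ω : ChargedConfiguration I => ω.count B q := by
  obtain ⟨r, hr⟩ := hB.subset_ball (0 : E)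
  set V := Metric.ball (0 : E) r with hV
  have hVb : Bornology.IsBounded V := Metric.isBounded_ball
  have open_case : ∀ W : Set E, IsOpen W → Bornology.IsBounded W →
      Measurable fun ω : ChargedConfiguration I => ω.count W q := fun W hW hWb =>
    measurable_to_countable' fun m => MeasurableSpace.measurableSet_generateFrom
      ⟨W, m, q, hW, hWb, rfl⟩
  have key : ∀ T : Set E, MeasurableSet T →
      Measurable fun ω : ChargedConfiguration I => ω.pointMeasure ((T ∩ V) ×ˢ {q}) := by
    intro T hT
    induction T, hT using MeasurableSpace.induction_on_inter
      (s := {W : Set E | IsOpen W}) (BorelSpace.measurable_eq.trans rfl) isPiSystem_isOpen with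
    | empty => simp
    | basic W hW =>
      have hWb : Bornology.IsBounded (W ∩ V) := hVb.subset inter_subset_right
      have hWo : IsOpen (W ∩ V) := IsOpen.inter (by simpa using hW) Metric.isOpen_ball
      simp_rw [pointMeasure_prod_singleton _ hWb hWo.measurableSet]
      exact measurable_from_top.comp (open_case _ hWo hWb)
    | compl W hW ih =>
      have hc : ∀ ω : ChargedConfiguration I, ω.pointMeasure ((Wᶜ ∩ V) ×ˢ {q}) =
          ω.pointMeasure (V ×ˢ {q}) - ω.pointMeasure ((W ∩ V) ×ˢ {q}) := by
        intro ω
        have hWb : Bornology.IsBounded (W ∩ V) := hVb.subset inter_subset_right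
        have hm := hW.inter (Metric.isOpen_ball (x := (0 : E)) (ε := r)).measurableSet
        rw [← measure_sdiff]
        · congr 1
          ext p
          simp only [mem_prod, mem_inter_iff, mem_compl_iff, mem_singleton_iff, Set.mem_sdiff, hV]
          tauto
        · exact prod_mono inter_subset_right le_rfl
        · exact (hm.prod (measurableSet_singleton q)).nullMeasurableSet
        · rw [pointMeasure_prod_singleton _ hWb hm]
          exact ENNReal.natCast_ne_top _
      simp_rw [hc]
      refine Measurable.sub ?_ ih
      simp_rw [pointMeasure_prod_singleton _ hVb Metric.isOpen_ball.measurableSet]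
      exact measurable_from_top.comp (open_case _ Metric.isOpen_ball hVb)
    | iUnion f hd hm ih =>
      have hc : ∀ ω : ChargedConfiguration I, ω.pointMeasure (((⋃ i, f i) ∩ V) ×ˢ {q}) =
          ∑' i, ω.pointMeasure ((f i ∩ V) ×ˢ {q}) := by
        intro ω
        rw [iUnion_inter, iUnion_prod_const, measure_iUnion]
        · intro i j hij
          exact Set.disjoint_prod.2 (.inl ((hd hij).mono inter_subset_left inter_subset_left))
        · exact fun i => ((hm i).inter Metric.isOpen_ball.measurableSet).prod
            (measurableSet_singleton q)
      simp_rw [hc]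
      exact Measurable.tsum ih
  have := key B hBm
  rw [inter_eq_self_of_subset_left hr] at this
  simp_rw [pointMeasure_prod_singleton _ hB hBm] at this
  refine measurable_to_countable' fun m => ?_
  convert this (measurableSet_singleton (m : ENNReal)) using 1
  ext ω
  simp

theorem prod_eq_iUnion_sections (T : Set (E × I)) :
    T = ⋃ q : I, ((fun z : E => (z, q)) ⁻¹' T) ×ˢ {q} := by
  ext ⟨z, q⟩
  simp

/-- A measurable set of marked points splits by charge into finitely many sections, and each section
is an increasing union of bounded ones, whose masses are counts. This is what makes `Measure.bind`
available for the first moments. -/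
theorem measurable_pointMeasure :
    Measurable fun ω : ChargedConfiguration I => ω.pointMeasure := by
  refine Measure.measurable_of_measurable_coe _ fun T hT => ?_
  have hsec : ∀ q : I, MeasurableSet ((fun z : E => (z, q)) ⁻¹' T) := fun q =>
    measurable_prodMk_right hT
  set Tn : ℕ → I → Set E := fun n q => (fun z : E => (z, q)) ⁻¹' T ∩ Metric.ball 0 n
  have hTn : T = ⋃ q : I, ⋃ n : ℕ, Tn n q ×ˢ {q} := by
    ext ⟨z, q⟩
    simp only [Tn, mem_iUnion, mem_prod, mem_inter_iff, mem_preimage, Metric.mem_ball,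
      dist_zero_right, mem_singleton_iff]
    constructor
    · intro h
      obtain ⟨n, hn⟩ := exists_nat_gt ‖z‖
      exact ⟨q, n, ⟨h, hn⟩, rfl⟩
    · rintro ⟨q', n, ⟨h, -⟩, rfl⟩
      exact h
  have hm : ∀ q n, MeasurableSet (Tn n q) := fun q n =>
    (hsec q).inter Metric.isOpen_ball.measurableSet
  have hb : ∀ q n, Bornology.IsBounded (Tn n q) := fun q n =>
    Metric.isBounded_ball.subset inter_subset_right
  have hc : ∀ ω : ChargedConfiguration I, ω.pointMeasure T =
      ∑ q : I, ⨆ n : ℕ, (ω.count (Tn n q) q : ENNReal) := by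
    intro ω
    conv_lhs => rw [hTn]
    rw [measure_iUnion, tsum_fintype]
    · refine Finset.sum_congr rfl fun q _ => ?_
      rw [Monotone.measure_iUnion]
      · simp_rw [pointMeasure_prod_singleton _ (hb q _) (hm q _)]
      · intro m n hmn
        refine prod_mono (inter_subset_inter_right _ (Metric.ball_subset_ball ?_)) le_rfl
        exact_mod_cast hmn
    · intro q q' hqq'
      simp only [Function.onFun, Set.disjoint_left, mem_iUnion, mem_prod, mem_singleton_iff]
      rintro p ⟨_, _, h⟩ ⟨_, _, h'⟩
      exact hqq' (h.symm.trans h')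
    · exact fun q => MeasurableSet.iUnion fun n => (hm q n).prod (measurableSet_singleton q)
  simp_rw [hc]
  exact Finset.measurable_sum _ fun q _ => Measurable.iSup fun n =>
    measurable_from_top.comp (measurable_count (hb q n) (hm q n) q)

/-! ### Sums over the scatterers in a region. -/

/-- The sum of `f` over the scatterers in `D`. -/
def cloudSum {F : Type*} [NormedAddCommGroup F] [NormedSpace ℝ F] (D : Set E) (f : E × I → F)
    (ω : ChargedConfiguration I) : F :=
  ∫ p in D ×ˢ univ, f p ∂ω.pointMeasure

/-- The positive and negative parts are lower integrals, which depend measurably on the measure, and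
the point measure depends measurably on the configuration. -/
theorem measurable_cloudSum_real (D : Set E) {f : E × I → ℝ} (hD : Bornology.IsBounded D)
    (hDm : MeasurableSet D) (hf : Measurable f) : Measurable (cloudSum D f) := by
  have h : ∀ ω : ChargedConfiguration I, cloudSum D f ω =
      (∫⁻ p in D ×ˢ univ, ENNReal.ofReal (f p) ∂ω.pointMeasure).toReal -
      (∫⁻ p in D ×ˢ univ, ENNReal.ofReal (-f p) ∂ω.pointMeasure).toReal := fun ω =>
    integral_eq_lintegral_pos_part_sub_lintegral_neg_part
      (ω.integrableOn_pointMeasure hD hDm f)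
  have hm : ∀ u : E × I → ENNReal, Measurable u → Measurable fun ω : ChargedConfiguration I =>
      (∫⁻ p in D ×ˢ univ, u p ∂ω.pointMeasure).toReal := fun u hu =>
by
    simp_rw [← lintegral_indicator (hDm.prod MeasurableSet.univ)]
    exact ((Measure.measurable_lintegral (hu.indicator (hDm.prod MeasurableSet.univ))).comp
      measurable_pointMeasure).ennreal_toReal
  rw [funext h]
  exact (hm _ (by fun_prop)).sub (hm _ (by fun_prop))

theorem inner_cloudSum {D : Set E} (hD : Bornology.IsBounded D) (hDm : MeasurableSet D)
    (f : E × I → E) (t : E) (ω : ChargedConfiguration I) :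
    inner ℝ t (cloudSum D f ω) = cloudSum D (fun p => inner ℝ t (f p)) ω :=
  (integral_inner (ω.integrableOn_pointMeasure hD hDm f) t).symm

theorem measurable_of_inner {α : Type*} [MeasurableSpace α] {F : α → E}
    (h : ∀ t : E, Measurable fun a => inner ℝ t (F a)) : Measurable F := by
  have h1 : F = fun a => ∑ i, inner ℝ (EuclideanSpace.basisFun (Fin 3) ℝ i) (F a) •
      EuclideanSpace.basisFun (Fin 3) ℝ i :=
    funext fun a => ((EuclideanSpace.basisFun (Fin 3) ℝ).sum_repr' (F a)).symm
  rw [h1]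
  exact Finset.measurable_fun_sum _ fun i _ => (h _).smul_const _

theorem measurable_cloudSum {D : Set E} {f : E × I → E} (hD : Bornology.IsBounded D)
    (hDm : MeasurableSet D) (hf : Measurable f) : Measurable (cloudSum D f) := by
  refine measurable_of_inner fun t => ?_
  simp_rw [inner_cloudSum hD hDm]
  exact measurable_cloudSum_real D hD hDm (by fun_prop)

open ChargedConfiguration

/-! ### Campbell's formula for the characteristic functional -/

theorem IsScattererDistribution.apply_counts {μ : Measure I} {P : Measure (ChargedConfiguration I)}
    (hP : IsScattererDistribution μ P) {ι : Type*} [Fintype ι] {B : ι → Set E}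
    (hBm : ∀ a, MeasurableSet (B a)) (hBb : ∀ a, Bornology.IsBounded (B a))
    (hd : Pairwise (fun a b => Disjoint (B a) (B b))) (n : ι × I → ℕ) :
    P {ω | ∀ a, ω.count (B a.1) a.2 = n a} =
      ∏ a : ι × I, ProbabilityTheory.poissonMeasure
        (Real.toNNReal (μ.real {a.2} * volume.real (B a.1))) {n a} := by
  set e := Fintype.equivFin ι
  have h := hP _ (B ∘ e.symm) (fun a => hBm _) (fun a => hBb _)
    (fun a b hab => hd (e.symm.injective.ne hab)) (fun a q => n (e.symm a, q))
  have h1 : {ω : ChargedConfiguration I | ∀ a, ω.count (B a.1) a.2 = n a} =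
      {ω | ∀ a q, ω.count ((B ∘ e.symm) a) q = n (e.symm a, q)} := by
    ext ω
    simp only [mem_ofPred_eq, Function.comp, Prod.forall]
    exact ⟨fun h a q => h _ q, fun h a q => by simpa using h (e a) q⟩
  rw [h1, h]
  simp_rw [ProbabilityTheory.poissonMeasure_singleton]
  rw [← ENNReal.ofReal_prod_of_nonneg (fun _ _ => by positivity), Fintype.prod_prod_type]
  congr 1
  rw [← e.symm.prod_comp]
  refine Finset.prod_congr rfl fun a _ => Finset.prod_congr rfl fun q _ => ?_
  rw [Real.coe_toNNReal _ (by positivity)]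
  rfl

/-- The joint law of the counts lives on a countable discrete space, so the prescribed probabilities
of single points determine it as a product of Poisson laws. -/
theorem IsScattererDistribution.map_counts {μ : Measure I} {P : Measure (ChargedConfiguration I)}
    (hP : IsScattererDistribution μ P) {ι : Type*} [Fintype ι] {B : ι → Set E}
    (hBm : ∀ a, MeasurableSet (B a)) (hBb : ∀ a, Bornology.IsBounded (B a))
    (hd : Pairwise (fun a b => Disjoint (B a) (B b))) :
    P.map (fun ω (a : ι × I) => ω.count (B a.1) a.2) =
      Measure.pi fun a : ι × I => ProbabilityTheory.poissonMeasure
        (Real.toNNReal (μ.real {a.2} * volume.real (B a.1))) := by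
  classical
  have hm : Measurable fun (ω : ChargedConfiguration I) (a : ι × I) => ω.count (B a.1) a.2 :=
    measurable_pi_lambda _ fun a => measurable_count (hBb _) (hBm _) _
  refine Measure.ext_of_singleton fun n => ?_
  rw [Measure.map_apply hm (measurableSet_singleton _), Measure.pi_singleton,
    ← hP.apply_counts hBm hBb hd n]
  congr 1
  ext ω
  simp [funext_iff]

theorem IsScattererDistribution.integral_exp_counts {μ : Measure I}
    {P : Measure (ChargedConfiguration I)}
    (hP : IsScattererDistribution μ P) {ι : Type*} [Fintype ι] {B : ι → Set E}
    (hBm : ∀ a, MeasurableSet (B a)) (hBb : ∀ a, Bornology.IsBounded (B a))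
    (hd : Pairwise (fun a b => Disjoint (B a) (B b))) (v : ι × I → ℝ) :
    ∫ ω, Complex.exp (((∑ a : ι × I, ω.count (B a.1) a.2 * v a : ℝ) : ℂ) * Complex.I) ∂P =
      Complex.exp (∑ a : ι × I, ((μ.real {a.2} * volume.real (B a.1) : ℝ) : ℂ) *
        (Complex.exp (v a * Complex.I) - 1)) := by
  classical
  have hm : Measurable fun (ω : ChargedConfiguration I) (a : ι × I) => ω.count (B a.1) a.2 :=
    measurable_pi_lambda _ fun a => measurable_count (hBb _) (hBm _) _
  have h1 : ∀ ω : ChargedConfiguration I,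
      Complex.exp (((∑ a : ι × I, ω.count (B a.1) a.2 * v a : ℝ) : ℂ) * Complex.I) =
      (fun n : ι × I → ℕ => ∏ a, Complex.exp (((n a * v a : ℝ) : ℂ) * Complex.I))
        (fun a => ω.count (B a.1) a.2) := by
    intro ω
    push_cast
    rw [Finset.sum_mul, Complex.exp_sum]
  rw [integral_congr_ae (.of_forall h1)]
  rw [← integral_map (f := fun n : ι × I → ℕ => ∏ a, Complex.exp (((n a * v a : ℝ) : ℂ) *
    Complex.I)) hm.aemeasurable Measurable.of_discrete.aestronglyMeasurable,
    hP.map_counts hBm hBb hd,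
    integral_fintype_prod_eq_prod (fun a (n : ℕ) => Complex.exp (((n * v a : ℝ) : ℂ) * Complex.I)),
    Complex.exp_sum]
  refine Finset.prod_congr rfl fun a _ => ?_
  have h2 := ProbabilityTheory.charFun_map_cast_poissonMeasure
    (Real.toNNReal (μ.real {a.2} * volume.real (B a.1))) (v a)
  rw [charFun_apply, integral_map .of_discrete (by fun_prop)] at h2
  simp_rw [Real.inner_apply] at h2
  rw [h2]
  congr 3
  rw [Real.coe_toNNReal _ (by positivity)]

theorem setIntegral_prod_marks {F : Type*} [NormedAddCommGroup F] [NormedSpace ℝ F]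
    [CompleteSpace F] (μ : Measure I) [IsProbabilityMeasure μ] {B : Set E} {f : E × I → F}
    (hf : ∀ q, IntegrableOn (fun z => f (z, q)) B) :
    ∫ p in B ×ˢ univ, f p ∂(volume.prod μ) = ∑ q : I, μ.real {q} • ∫ z in B, f (z, q) := by
  have h : (volume.prod μ).restrict (B ×ˢ (univ : Set I)) = (volume.restrict B).prod μ := by
    rw [← Measure.prod_restrict, Measure.restrict_univ]
  have hint : Integrable f ((volume.restrict B).prod μ) := by
    rw [integrable_prod_iff']
    · exact ⟨.of_forall hf, .of_finite⟩
    · have : f = fun p => ∑ q : I, (univ ×ˢ {q} : Set (E × I)).indicator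
          (fun p => f (p.1, q)) p := by
        ext ⟨z, q⟩
        rw [Finset.sum_eq_single q]
        · simp
        · intro q' _ hq'
          simp [hq'.symm]
        · simp
      rw [this]
      refine Finset.aestronglyMeasurable_fun_sum _ fun q _ => ?_
      exact ((hf q).aestronglyMeasurable.comp_fst).indicator
        (MeasurableSet.univ.prod (measurableSet_singleton q))
  rw [h, integral_prod_symm _ hint, integral_fintype]
  exact .of_finite

theorem integrable_exp_sub_one {α : Type*} [MeasurableSpace α] {m : Measure α} [IsFiniteMeasure m]
    {f : α → ℝ} (hf : Measurable f) :
    Integrable (fun x => Complex.exp (f x * Complex.I) - 1) m := by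
  refine Integrable.of_bound (C := 2) (by fun_prop) (.of_forall fun x => ?_)
  refine (norm_sub_le _ _).trans ?_
  rw [Complex.norm_exp_ofReal_mul_I]
  norm_num

/-- The level sets of `g` are disjoint bounded regions, so the sum is a linear combination of
independent Poisson counts. Values in `I → ℝ` allow one partition of space to serve all charges at
once. -/
theorem IsScattererDistribution.integral_exp_simpleFunc {μ : Measure I} [IsProbabilityMeasure μ]
    {P : Measure (ChargedConfiguration I)} (hP : IsScattererDistribution μ P)
    {B : Set E} (hBb : Bornology.IsBounded B) (hBm : MeasurableSet B) (g : SimpleFunc E (I → ℝ)) :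
    ∫ ω, Complex.exp (((∑ p ∈ ω.scatterersIn hBb, g p.1 p.2 : ℝ) : ℂ) * Complex.I) ∂P =
      Complex.exp (∫ p in B ×ˢ univ, (Complex.exp ((g p.1 p.2 : ℝ) * Complex.I) - 1)
        ∂(volume.prod μ)) := by
  classical
  have hBf : volume B < ⊤ := hBb.measure_lt_top
  have : IsFiniteMeasure (volume.restrict B) := ⟨by simpa using hBf⟩
  set W : g.range → Set E := fun v => g ⁻¹' {v.1} ∩ B with hW
  have hWm : ∀ v, MeasurableSet (W v) := fun v => (g.measurableSet_preimage _).inter hBm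
  have hWb : ∀ v, Bornology.IsBounded (W v) := fun v => hBb.subset inter_subset_right
  have hWd : Pairwise fun a b => Disjoint (W a) (W b) := by
    intro a b hab
    rw [Set.disjoint_left]
    rintro x ⟨hx, -⟩ ⟨hx', -⟩
    exact hab (Subtype.ext (hx.symm.trans hx'))
  have h := hP.integral_exp_counts hWm hWb hWd (fun a => a.1.1 a.2)
  have h1 : ∀ ω : ChargedConfiguration I, ∑ p ∈ ω.scatterersIn hBb, g p.1 p.2 =
      ∑ a : g.range × I, (ω.count (W a.1) a.2 : ℝ) * a.1.1 a.2 := by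
    intro ω
    have hc : ∀ a : g.range × I, (ω.count (W a.1) a.2 : ℝ) * a.1.1 a.2 =
        ∑ p ∈ ω.scatterersIn hBb, if g p.1 = a.1.1 ∧ p.2 = a.2 then g p.1 p.2 else 0 := by
      intro a
      rw [← Finset.sum_filter, Finset.sum_congr rfl (g := fun _ => a.1.1 a.2)]
      · rw [Finset.sum_const, nsmul_eq_mul]
        congr 2
        rw [count, ← Set.ncard_coe_finset]
        congr 1
        ext p
        simp [hW]
        tauto
      · intro p hp
        obtain ⟨-, h1, h2⟩ := Finset.mem_filter.1 hp
        rw [h1, h2]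
    simp_rw [hc]
    rw [Finset.sum_comm]
    refine Finset.sum_congr rfl fun p _ => ?_
    rw [Finset.sum_eq_single (⟨g p.1, SimpleFunc.mem_range_self g p.1⟩, p.2)]
    · simp
    · rintro ⟨v, q⟩ - hne
      rw [if_neg]
      rintro ⟨h1, h2⟩
      exact hne (Prod.ext (Subtype.ext h1.symm) h2.symm)
    · simp
  simp_rw [h1]
  rw [h]
  congr 1
  have hmeas : ∀ q : I, Measurable fun z => g z q := fun q =>
    (measurable_pi_apply q).comp g.measurable
  rw [setIntegral_prod_marks (f := fun p => Complex.exp ((g p.1 p.2 : ℝ) * Complex.I) - 1) μ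
    (fun q => integrable_exp_sub_one (hmeas q)),
    Fintype.sum_prod_type_right]
  refine Finset.sum_congr rfl fun q _ => ?_
  have hBU : B = ⋃ v ∈ (Finset.univ : Finset g.range), W v := by
    ext z
    simp [hW]
  have h2 : ∫ z in B, (Complex.exp ((g z q : ℝ) * Complex.I) - 1) =
      ∑ v : g.range, ∫ z in W v, (Complex.exp ((g z q : ℝ) * Complex.I) - 1) := by
    conv_lhs => rw [hBU]
    refine integral_biUnion_finset _ (fun v _ => hWm v) (fun a _ b _ hab => hWd hab) fun v _ => ?_
    exact IntegrableOn.mono_set (integrable_exp_sub_one (hmeas q)) inter_subset_right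
  rw [h2, Finset.smul_sum]
  refine Finset.sum_congr rfl fun v _ => ?_
  rw [setIntegral_congr_fun (g := fun _ => Complex.exp ((v.1 q : ℝ) * Complex.I) - 1) (hWm v)
    (fun z hz => by rw [show g z = v.1 from hz.1]), setIntegral_const]
  simp only [Complex.real_smul]
  push_cast
  ring

/-- Campbell's formula on a bounded region. -/
theorem IsScattererDistribution.integral_exp_base {μ : Measure I} [IsProbabilityMeasure μ]
    {P : Measure (ChargedConfiguration I)} [IsProbabilityMeasure P]
    (hP : IsScattererDistribution μ P)
    {B : Set E} (hBb : Bornology.IsBounded B) (hBm : MeasurableSet B) {f : E × I → ℝ}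
    (hf : Measurable f) :
    ∫ ω : ChargedConfiguration I, Complex.exp (((∫ p in B ×ˢ univ, f p ∂ω.pointMeasure : ℝ) : ℂ) *
        Complex.I) ∂P =
      Complex.exp (∫ p in B ×ˢ univ, (Complex.exp (f p * Complex.I) - 1) ∂(volume.prod μ)) := by
  have hBf : volume B < ⊤ := hBb.measure_lt_top
  have : IsFiniteMeasure ((volume.prod μ).restrict (B ×ˢ univ)) :=
    ⟨by simpa [Measure.prod_prod] using hBf⟩
  have hgm : Measurable fun (z : E) (q : I) => f (z, q) :=
    measurable_pi_lambda _ fun q => hf.comp measurable_prodMk_right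
  -- Pointwise convergence of the simple functions suffices: each configuration has finitely many
  -- scatterers in `B`, and both sides pass to the limit by bounded convergence.
  set g := hgm.stronglyMeasurable.approx
  have hg : ∀ z q, Tendsto (fun n => g n z q) atTop (𝓝 (f (z, q))) := fun z q =>
    (continuous_apply q).continuousAt.tendsto.comp (hgm.stronglyMeasurable.tendsto_approx z)
  have hgm' : ∀ n, Measurable fun p : E × I => g n p.1 p.2 := by
    intro n
    exact measurable_from_prod_countable_left fun q =>
      (measurable_pi_apply q).comp (g n).measurable
  simp_rw [integral_pointMeasure _ hBb hBm]
  have hlim1 : Tendsto (fun n => ∫ ω : ChargedConfiguration I,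
      Complex.exp (((∑ p ∈ ω.scatterersIn hBb, g n p.1 p.2 : ℝ) : ℂ) * Complex.I) ∂P) atTop
      (𝓝 (∫ ω : ChargedConfiguration I,
        Complex.exp (((∑ p ∈ ω.scatterersIn hBb, f p : ℝ) : ℂ) * Complex.I) ∂P)) := by
    refine tendsto_integral_of_dominated_convergence (fun _ => 1) (fun n => ?_)
      (integrable_const _) (fun n => .of_forall fun ω => ?_) (.of_forall fun ω => ?_)
    · have := measurable_cloudSum_real B hBb hBm (hgm' n)
      rw [show cloudSum B _ = _ from funext (integral_pointMeasure · hBb hBm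
        (fun p : E × I => g n p.1 p.2))] at this
      exact (Complex.measurable_exp.comp ((Complex.measurable_ofReal.comp this).mul_const
        _)).aestronglyMeasurable
    · rw [Complex.norm_exp_ofReal_mul_I]
    · have hc : Continuous fun t : ℝ => Complex.exp ((t : ℂ) * Complex.I) := by fun_prop
      exact (hc.tendsto _).comp (tendsto_finsetSum _ fun p _ => hg p.1 p.2)
  have hlim2 : Tendsto (fun n => Complex.exp (∫ p in B ×ˢ univ,
      (Complex.exp ((g n p.1 p.2 : ℝ) * Complex.I) - 1) ∂(volume.prod μ))) atTop
      (𝓝 (Complex.exp (∫ p in B ×ˢ univ, (Complex.exp (f p * Complex.I) - 1)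
        ∂(volume.prod μ)))) := by
    refine (Complex.continuous_exp.tendsto _).comp ?_
    refine tendsto_integral_of_dominated_convergence (fun _ => 2) (fun n => ?_)
      (integrable_const _) (fun n => .of_forall fun p => ?_) (.of_forall fun p => ?_)
    · exact (integrable_exp_sub_one (hgm' n)).aestronglyMeasurable
    · refine (norm_sub_le _ _).trans ?_
      rw [Complex.norm_exp_ofReal_mul_I]
      norm_num
    · have hc : Continuous fun t : ℝ => Complex.exp ((t : ℂ) * Complex.I) - 1 := by fun_prop
      exact (hc.tendsto _).comp (hg p.1 p.2)
  refine tendsto_nhds_unique hlim1 (hlim2.congr fun n => ?_)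
  exact (hP.integral_exp_simpleFunc hBb hBm (g n)).symm

open ChargedConfiguration

/-- The intensity of the marked Poisson process. -/
def intensity (μ : Measure I) : Measure (E × I) := volume.prod μ

theorem isFiniteMeasure_intensity (μ : Measure I) [IsProbabilityMeasure μ] {B : Set E}
    (hB : Bornology.IsBounded B) : IsFiniteMeasure ((intensity μ).restrict (B ×ˢ univ)) :=
  ⟨by simpa [intensity, Measure.prod_prod] using hB.measure_lt_top⟩

theorem IsScattererDistribution.charFun_cloudSum {μ : Measure I} [IsProbabilityMeasure μ]
    {P : Measure (ChargedConfiguration I)} [IsProbabilityMeasure P]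
    (hP : IsScattererDistribution μ P)
    {D : Set E} (hD : Bornology.IsBounded D) (hDm : MeasurableSet D) {f : E × I → ℝ}
    (hf : Measurable f) :
    ∫ ω : ChargedConfiguration I, Complex.exp (((cloudSum D f ω : ℝ) : ℂ) * Complex.I) ∂P =
      Complex.exp (∫ p in D ×ˢ univ, (Complex.exp (f p * Complex.I) - 1) ∂(intensity μ)) :=
  hP.integral_exp_base hD hDm hf

/-! ### First moments -/

theorem lintegral_poissonMeasure_natCast (r : NNReal) :
    ∫⁻ n : ℕ, (n : ENNReal) ∂ProbabilityTheory.poissonMeasure r = r := by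
  rw [lintegral_countable']
  simp_rw [ProbabilityTheory.poissonMeasure_singleton]
  have h : ∀ n : ℕ, ((n + 1 : ℕ) : ENNReal) *
      ENNReal.ofReal (Real.exp (-r) * r ^ (n + 1) / (n + 1).factorial) =
      r * ENNReal.ofReal (Real.exp (-r) * r ^ n / n.factorial) := by
    intro n
    rw [← ENNReal.ofReal_natCast, ← ENNReal.ofReal_mul (by positivity),
      ← ENNReal.ofReal_coe_nnreal, ← ENNReal.ofReal_mul (by positivity), Nat.factorial_succ]
    congr 1
    push_cast
    field_simp
    ring
  rw [tsum_eq_zero_add' ENNReal.summable]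
  simp_rw [h]
  have h1 := ProbabilityTheory.hasSum_one_poissonMeasure r
  rw [ENNReal.tsum_mul_left, ← ENNReal.ofReal_tsum_of_nonneg (fun n => by positivity) h1.summable,
    h1.tsum_eq]
  simp

theorem IsScattererDistribution.lintegral_count {μ : Measure I} [IsProbabilityMeasure μ]
    {P : Measure (ChargedConfiguration I)} (hP : IsScattererDistribution μ P)
    {B : Set E} (hBb : Bornology.IsBounded B) (hBm : MeasurableSet B) (q : I) :
    ∫⁻ ω : ChargedConfiguration I, (ω.count B q : ENNReal) ∂P = intensity μ (B ×ˢ {q}) := by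
  have hm := hP.map_counts (ι := Unit) (B := fun _ => B) (fun _ => hBm) (fun _ => hBb)
    (fun a b hab => absurd (Subsingleton.elim a b) hab)
  have hmeas : Measurable fun (ω : ChargedConfiguration I) (a : Unit × I) => ω.count B a.2 :=
    measurable_pi_lambda _ fun a => measurable_count hBb hBm _
  rw [← lintegral_map (f := fun n : Unit × I → ℕ => ((n ((), q) : ℕ) : ENNReal))
    (g := fun (ω : ChargedConfiguration I) (a : Unit × I) => ω.count B a.2) (by fun_prop) hmeas, hm,
    show (∫⁻ a : Unit × I → ℕ, (a ((), q) : ENNReal) ∂_) = _ from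
      (measurePreserving_eval (fun a : Unit × I => ProbabilityTheory.poissonMeasure
        (μ.real {a.2} * volume.real B).toNNReal) ((), q)).lintegral_comp
        (f := fun n : ℕ => (n : ENNReal)) (by fun_prop), lintegral_poissonMeasure_natCast,
    intensity, Measure.prod_prod, mul_comm,
    ← ENNReal.ofReal_coe_nnreal, Real.coe_toNNReal _ (by positivity),
    ENNReal.ofReal_mul (by positivity)]
  rw [ofReal_measureReal hBb.measure_lt_top.ne, ofReal_measureReal]

/-- Campbell's first-moment formula in the form of an equality of measures. It then applies to every
nonnegative function, whether or not its integral is finite, and so can be used to establish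
integrability. -/
theorem IsScattererDistribution.bind_pointMeasure {μ : Measure I} [IsProbabilityMeasure μ]
    {P : Measure (ChargedConfiguration I)} (hP : IsScattererDistribution μ P) :
    P.bind pointMeasure = intensity μ := by
  have hmain : ∀ (q : I) (B : Set E), MeasurableSet B → Bornology.IsBounded B →
      P.bind pointMeasure (B ×ˢ {q}) = intensity μ (B ×ˢ {q}) := by
    intro q B hBm hBb
    rw [Measure.bind_apply (hBm.prod (measurableSet_singleton q))
      measurable_pointMeasure.aemeasurable, ← hP.lintegral_count hBb hBm q]
    simp_rw [pointMeasure_prod_singleton _ hBb hBm]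
  refine Measure.ext fun T hT => ?_
  rw [prod_eq_iUnion_sections T]
  have hsec : ∀ q : I, MeasurableSet ((fun z : E => (z, q)) ⁻¹' T) := fun q =>
    measurable_prodMk_right hT
  have hd : Pairwise (Function.onFun Disjoint
      fun q : I => ((fun z : E => (z, q)) ⁻¹' T) ×ˢ ({q} : Set I)) := fun q q' h =>
    Set.disjoint_prod.2 (.inr (by simpa using h))
  rw [measure_iUnion hd fun q => (hsec q).prod (measurableSet_singleton q),
    measure_iUnion hd fun q => (hsec q).prod (measurableSet_singleton q)]
  refine tsum_congr fun q => ?_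
  set S := (fun z : E => (z, q)) ⁻¹' T
  have hS : S ×ˢ ({q} : Set I) = ⋃ n : ℕ, (S ∩ Metric.ball 0 n) ×ˢ {q} := by
    rw [← iUnion_prod_const, ← inter_iUnion, Metric.iUnion_ball_nat, inter_univ]
  have hmono : Monotone fun n : ℕ => (S ∩ Metric.ball (0 : E) n) ×ˢ ({q} : Set I) := by
    intro m n hmn
    refine prod_mono (inter_subset_inter_right _ (Metric.ball_subset_ball ?_)) le_rfl
    exact_mod_cast hmn
  rw [hS, hmono.measure_iUnion, hmono.measure_iUnion]
  refine iSup_congr fun n => hmain q _ ((hsec q).inter Metric.isOpen_ball.measurableSet)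
    (Metric.isBounded_ball.subset inter_subset_right)

theorem IsScattererDistribution.lintegral_pointMeasure {μ : Measure I} [IsProbabilityMeasure μ]
    {P : Measure (ChargedConfiguration I)} (hP : IsScattererDistribution μ P)
    {D : Set E} (hDm : MeasurableSet D) {u : E × I → ENNReal} (hu : Measurable u) :
    ∫⁻ ω : ChargedConfiguration I, ∫⁻ p in D ×ˢ univ, u p ∂ω.pointMeasure ∂P =
      ∫⁻ p in D ×ˢ univ, u p ∂(intensity μ) := by
  have hT : MeasurableSet (D ×ˢ (univ : Set I)) := hDm.prod .univ
  simp_rw [← lintegral_indicator hT]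
  rw [← hP.bind_pointMeasure, Measure.lintegral_bind measurable_pointMeasure.aemeasurable
    (hu.indicator hT).aemeasurable]

theorem IsScattererDistribution.lintegral_enorm_cloudSum_le {μ : Measure I}
    [IsProbabilityMeasure μ]
    {P : Measure (ChargedConfiguration I)} (hP : IsScattererDistribution μ P)
    {D : Set E} (hDm : MeasurableSet D) {f : E × I → E} (hf : Measurable f) :
    ∫⁻ ω : ChargedConfiguration I, ‖cloudSum D f ω‖ₑ ∂P ≤
      ∫⁻ p in D ×ˢ univ, ‖f p‖ₑ ∂(intensity μ) := by
  rw [← hP.lintegral_pointMeasure hDm hf.enorm]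
  exact lintegral_mono fun ω => enorm_integral_le_lintegral_enorm _

theorem IsScattererDistribution.integrable_cloudSum {μ : Measure I} [IsProbabilityMeasure μ]
    {P : Measure (ChargedConfiguration I)} (hP : IsScattererDistribution μ P)
    {D : Set E} (hD : Bornology.IsBounded D) (hDm : MeasurableSet D) {f : E × I → E}
    (hf : Measurable f) (hfi : IntegrableOn f (D ×ˢ univ) (intensity μ)) :
    Integrable (cloudSum D f) P :=
  ⟨(measurable_cloudSum hD hDm hf).aestronglyMeasurable,
    (hP.lintegral_enorm_cloudSum_le hDm hf).trans_lt hfi.2⟩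

theorem IsScattererDistribution.integral_cloudSum_real {μ : Measure I} [IsProbabilityMeasure μ]
    {P : Measure (ChargedConfiguration I)} (hP : IsScattererDistribution μ P)
    {D : Set E} (hD : Bornology.IsBounded D) (hDm : MeasurableSet D) {f : E × I → ℝ}
    (hf : Measurable f) (hfi : IntegrableOn f (D ×ˢ univ) (intensity μ)) :
    ∫ ω, cloudSum D f ω ∂P = ∫ p in D ×ˢ univ, f p ∂(intensity μ) := by
  have hT : MeasurableSet (D ×ˢ (univ : Set I)) := hDm.prod .univ
  have h : ∀ ω : ChargedConfiguration I, cloudSum D f ω =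
      (∫⁻ p in D ×ˢ univ, ENNReal.ofReal (f p) ∂ω.pointMeasure).toReal -
      (∫⁻ p in D ×ˢ univ, ENNReal.ofReal (-f p) ∂ω.pointMeasure).toReal := fun ω =>
    integral_eq_lintegral_pos_part_sub_lintegral_neg_part
      (ω.integrableOn_pointMeasure hD hDm f)
  have hm : ∀ u : E × I → ENNReal, Measurable u → Measurable fun ω : ChargedConfiguration I =>
      ∫⁻ p in D ×ˢ univ, u p ∂ω.pointMeasure := fun u hu => by
    simp_rw [← lintegral_indicator hT]
    exact (Measure.measurable_lintegral (hu.indicator hT)).comp measurable_pointMeasure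
  have hfin : ∀ g : E × I → ℝ, Measurable g → IntegrableOn g (D ×ˢ univ) (intensity μ) →
      ∫⁻ ω : ChargedConfiguration I, ∫⁻ p in D ×ˢ univ, ENNReal.ofReal (g p)
        ∂ω.pointMeasure ∂P ≠ ⊤ := by
    intro g hg hgi
    rw [hP.lintegral_pointMeasure hDm (by fun_prop)]
    exact (Integrable.lintegral_lt_top hgi).ne
  have hint : ∀ g : E × I → ℝ, Measurable g → IntegrableOn g (D ×ˢ univ) (intensity μ) →
      ∫ ω : ChargedConfiguration I, (∫⁻ p in D ×ˢ univ, ENNReal.ofReal (g p)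
        ∂ω.pointMeasure).toReal ∂P =
      (∫⁻ p in D ×ˢ univ, ENNReal.ofReal (g p) ∂(intensity μ)).toReal := by
    intro g hg hgi
    rw [integral_toReal (hm _ (by fun_prop)).aemeasurable
      (ae_lt_top (hm _ (by fun_prop)) (hfin g hg hgi)),
      hP.lintegral_pointMeasure hDm (by fun_prop)]
  simp_rw [h]
  rw [integral_sub, hint f hf hfi, hint (fun p => -f p) hf.neg hfi.neg,
    integral_eq_lintegral_pos_part_sub_lintegral_neg_part hfi]
  · exact integrable_toReal_of_lintegral_ne_top (hm _ (by fun_prop)).aemeasurable (hfin f hf hfi)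
  · exact integrable_toReal_of_lintegral_ne_top (hm _ (by fun_prop)).aemeasurable
      (hfin _ hf.neg hfi.neg)

theorem IsScattererDistribution.integral_cloudSum {μ : Measure I} [IsProbabilityMeasure μ]
    {P : Measure (ChargedConfiguration I)} (hP : IsScattererDistribution μ P)
    {D : Set E} (hD : Bornology.IsBounded D) (hDm : MeasurableSet D) {f : E × I → E}
    (hf : Measurable f) (hfi : IntegrableOn f (D ×ˢ univ) (intensity μ)) :
    ∫ ω, cloudSum D f ω ∂P = ∫ p in D ×ˢ univ, f p ∂(intensity μ) := by
  refine ext_inner_left ℝ fun t => ?_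
  rw [← integral_inner (hP.integrable_cloudSum hD hDm hf hfi), ← integral_inner hfi]
  simp_rw [inner_cloudSum hD hDm]
  exact hP.integral_cloudSum_real hD hDm (by fun_prop) (hfi.const_inner t)

/-! ### Second moments -/

/-- Mean value inequality on the left half-plane, which is convex and on which the derivative of
`exp` has modulus at most one. -/
theorem norm_exp_sub_one_le_of_re_nonpos {z : ℂ} (hz : z.re ≤ 0) : ‖Complex.exp z - 1‖ ≤ ‖z‖ := by
  have h := (convex_halfSpace_re_le 0).norm_image_sub_le_of_norm_deriv_le (f := Complex.exp)
    (C := 1) (x := 0) (y := z) (fun w _ => Complex.differentiableAt_exp) (fun w hw => ?_)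
    (by simp) hz
  · simpa using h
  · rw [Complex.deriv_exp, Complex.norm_exp]
    exact Real.exp_le_one_iff.2 hw

/-- For `|u| ≤ 1` the Taylor bound gives constant one; for `|u| ≥ 1` the trivial bound is `2 + |u| ≤
3 u²`. -/
theorem norm_exp_sub_one_sub_le (u : ℝ) :
    ‖Complex.exp (u * Complex.I) - 1 - u * Complex.I‖ ≤ 3 * u ^ 2 := by
  have hn : ‖(u : ℂ) * Complex.I‖ = |u| := by simp
  rcases le_total |u| 1 with h | h
  · have := Complex.norm_exp_sub_one_sub_id_le (x := u * Complex.I) (by rwa [hn])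
    rw [hn, sq_abs] at this
    nlinarith [sq_nonneg u]
  · refine (norm_sub_le _ _).trans ?_
    have h2 := norm_sub_le (Complex.exp (u * Complex.I)) 1
    rw [Complex.norm_exp_ofReal_mul_I, norm_one] at h2
    rw [hn, ← sq_abs]
    nlinarith

theorem integrable_exp_sub_one_sub {α : Type*} [MeasurableSpace α] {m : Measure α}
    {f : α → ℝ} (hf : Measurable f) (hf2 : Integrable (fun x => f x ^ 2) m) :
    Integrable (fun x => Complex.exp (f x * Complex.I) - 1 - f x * Complex.I) m :=
  (hf2.const_mul 3).mono' (by fun_prop) (.of_forall fun x => norm_exp_sub_one_sub_le _)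

theorem integrable_of_integrable_sq {α : Type*} [MeasurableSpace α] {m : Measure α}
    [IsFiniteMeasure m] {f : α → ℝ} (hf : AEStronglyMeasurable f m)
    (hf2 : Integrable (fun x => f x ^ 2) m) : Integrable f m :=
  (memLp_two_iff_integrable_sq hf |>.2 hf2).integrable one_le_two

/-- Centred cloud sums have variance at most six times the integral of the square. -/
theorem IsScattererDistribution.lintegral_sq_cloudSum_sub_le {μ : Measure I}
    [IsProbabilityMeasure μ]
    {P : Measure (ChargedConfiguration I)} [IsProbabilityMeasure P]
    (hP : IsScattererDistribution μ P)
    {D : Set E} (hD : Bornology.IsBounded D) (hDm : MeasurableSet D) {f : E × I → ℝ}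
    (hf : Measurable f) (hf2 : IntegrableOn (fun p => f p ^ 2) (D ×ˢ univ) (intensity μ)) :
    ∫⁻ ω, ENNReal.ofReal ((cloudSum D f ω - ∫ p in D ×ˢ univ, f p ∂(intensity μ)) ^ 2) ∂P ≤
      ENNReal.ofReal (6 * ∫ p in D ×ˢ univ, f p ^ 2 ∂(intensity μ)) := by
  have := isFiniteMeasure_intensity μ hD
  set c := ∫ p in D ×ˢ univ, f p ∂(intensity μ)
  set V := ∫ p in D ×ˢ univ, f p ^ 2 ∂(intensity μ)
  have hfi : IntegrableOn f (D ×ˢ univ) (intensity μ) :=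
    integrable_of_integrable_sq hf.aestronglyMeasurable hf2
  set X : ChargedConfiguration I → ℝ := fun ω => cloudSum D f ω - c
  have hX : Measurable X := (measurable_cloudSum_real D hD hDm hf).sub_const _
  -- Centring removes the linear term of the exponent, leaving an integrand of size `3 (t f)²`.
  have hchar : ∀ t : ℝ, ∫ ω, Complex.exp (((t * X ω : ℝ) : ℂ) * Complex.I) ∂P =
      Complex.exp (∫ p in D ×ˢ univ, (Complex.exp (((t * f p : ℝ) : ℂ) * Complex.I) - 1 -
        ((t * f p : ℝ) : ℂ) * Complex.I) ∂(intensity μ)) := by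
    intro t
    have h1 := hP.charFun_cloudSum hD hDm (f := fun p => t * f p) (by fun_prop)
    have h2 : ∀ ω : ChargedConfiguration I, cloudSum D (fun p => t * f p) ω =
      t * cloudSum D f ω := fun ω => integral_const_mul _ _
    have h3 : ∀ ω : ChargedConfiguration I, Complex.exp (((t * X ω : ℝ) : ℂ) * Complex.I) =
        Complex.exp (((cloudSum D (fun p => t * f p) ω : ℝ) : ℂ) * Complex.I) *
          Complex.exp (-(((t * c : ℝ) : ℂ) * Complex.I)) := by
      intro ω
      rw [← Complex.exp_add, h2]
      congr 1
      simp only [X]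
      push_cast
      ring
    simp_rw [h3]
    rw [integral_mul_const, h1, ← Complex.exp_add]
    congr 1
    have h4 : Integrable (fun p => ((t * f p : ℝ) : ℂ) * Complex.I)
        ((intensity μ).restrict (D ×ˢ univ)) := (hfi.const_mul t).ofReal.mul_const _
    rw [integral_sub (integrable_exp_sub_one (f := fun p => t * f p) (by fun_prop)) h4,
      integral_mul_const, integral_complex_ofReal, integral_const_mul, sub_eq_add_neg]
  -- The characteristic function is `exp ψ` with `Re ψ ≤ 0`, so `|1 - exp ψ| ≤ |ψ| ≤ 3 t² V`.
  have hbound : ∀ t : ℝ, ∫ ω, (1 - Real.cos (t * X ω)) ∂P ≤ 3 * (t ^ 2 * V) := by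
    intro t
    set ψ := ∫ p in D ×ˢ univ, (Complex.exp (((t * f p : ℝ) : ℂ) * Complex.I) - 1 -
        ((t * f p : ℝ) : ℂ) * Complex.I) ∂(intensity μ) with hψ
    have hint := integrable_exp_sub_one_sub (m := (intensity μ).restrict (D ×ˢ univ))
      (f := fun p => t * f p) (by fun_prop) (by simpa [mul_pow] using hf2.const_mul (t ^ 2))
    have hre : ψ.re ≤ 0 := by
      rw [hψ, ← Complex.reCLM_apply, ← ContinuousLinearMap.integral_comp_comm _ hint]
      refine integral_nonpos fun p => ?_
      simp only [Complex.reCLM_apply, Complex.sub_re, Complex.exp_ofReal_mul_I_re, Complex.one_re,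
        Complex.re_ofReal_mul, Complex.I_re, mul_zero, sub_zero, Pi.zero_apply]
      linarith [Real.cos_le_one (t * f p)]
    have hnorm : ‖ψ‖ ≤ 3 * (t ^ 2 * V) := by
      refine (norm_integral_le_of_norm_le ((hf2.const_mul (t ^ 2)).const_mul 3)
        (.of_forall fun p => ?_)).trans_eq ?_
      · exact (norm_exp_sub_one_sub_le _).trans_eq (by ring)
      · rw [integral_const_mul, integral_const_mul]
    have hi : Integrable (fun ω => Complex.exp (((t * X ω : ℝ) : ℂ) * Complex.I)) P :=
      Integrable.of_bound (C := 1) (by fun_prop) (.of_forall fun ω => by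
        rw [Complex.norm_exp_ofReal_mul_I])
    have h1 : ∫ ω, (1 - Real.cos (t * X ω)) ∂P = (1 - Complex.exp ψ).re := by
      rw [← hchar t, Complex.sub_re, ← Complex.reCLM_apply (∫ ω, _ ∂P),
        ← ContinuousLinearMap.integral_comp_comm _ hi]
      simp only [Complex.reCLM_apply, Complex.exp_ofReal_mul_I_re]
      rw [integral_sub (integrable_const _)
        (Integrable.of_bound (C := 1) (by fun_prop) (.of_forall fun ω => Real.abs_cos_le_one _))]
      simp
    rw [h1]
    refine (Complex.re_le_norm _).trans ?_
    rw [norm_sub_rev]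
    exact (norm_exp_sub_one_le_of_re_nonpos hre).trans hnorm
  -- As `t → 0`, `2 (1 - cos (t x)) / t²` tends to `x²`. Fatou's lemma then bounds the second moment
  -- without presupposing that it is finite, and the constant six is twice the three of `hbound`.
  set t : ℕ → ℝ := fun n => 1 / ((n : ℝ) + 1)
  have ht : ∀ n, 0 < t n := fun n => by positivity
  have hlim : ∀ x : ℝ, Tendsto (fun n => ENNReal.ofReal (2 / t n ^ 2 * (1 - Real.cos (t n * x))))
      atTop (𝓝 (ENNReal.ofReal (x ^ 2))) := by
    intro x
    refine (ENNReal.continuous_ofReal.tendsto _).comp ?_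
    have ht0 : Tendsto t atTop (𝓝 0) := tendsto_one_div_add_atTop_nhds_zero_nat
    have hsinc : Tendsto (fun n => x ^ 2 * Real.sinc (t n * x / 2) ^ 2) atTop (𝓝 (x ^ 2)) := by
      have : Tendsto (fun n => t n * x / 2) atTop (𝓝 0) := by
        simpa using (ht0.mul_const x).div_const 2
      have h3 := ((Real.continuous_sinc.tendsto 0).comp this).pow 2
      simpa using h3.const_mul (x ^ 2)
    refine hsinc.congr fun n => ?_
    rcases eq_or_ne x 0 with rfl | hx
    · simp
    · have h0 : t n * x / 2 ≠ 0 := by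
        have := (ht n).ne'
        positivity
      rw [Real.sinc_of_ne_zero h0]
      have hc : Real.cos (t n * x) = 1 - 2 * Real.sin (t n * x / 2) ^ 2 := by
        rw [Real.sin_sq_eq_half_sub]
        ring_nf
      rw [hc]
      have := (ht n).ne'
      field_simp
      ring
  calc ∫⁻ ω, ENNReal.ofReal (X ω ^ 2) ∂P
      = ∫⁻ ω, liminf (fun n => ENNReal.ofReal (2 / t n ^ 2 * (1 - Real.cos (t n * X ω)))) atTop ∂P :=
        lintegral_congr fun ω => (hlim _).liminf_eq.symm
    _ ≤ liminf (fun n => ∫⁻ ω, ENNReal.ofReal (2 / t n ^ 2 * (1 - Real.cos (t n * X ω))) ∂P) atTop :=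
        lintegral_liminf_le fun n => by fun_prop
    _ ≤ liminf (fun _ : ℕ => ENNReal.ofReal (6 * V)) atTop := by
        refine liminf_le_liminf (.of_forall fun n => ?_)
        rw [← ofReal_integral_eq_lintegral_ofReal]
        · refine ENNReal.ofReal_le_ofReal ?_
          rw [integral_const_mul]
          refine (mul_le_mul_of_nonneg_left (hbound (t n)) (by positivity)).trans_eq ?_
          have := (ht n).ne'
          field_simp
          ring
        · refine Integrable.const_mul ?_ _
          exact (integrable_const _).sub
            (Integrable.of_bound (C := 1) (by fun_prop) (.of_forall fun ω => Real.abs_cos_le_one _))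
        · exact .of_forall fun ω => mul_nonneg (by positivity)
            (by linarith [Real.cos_le_one (t n * X ω)])
    _ = _ := by simp

open ChargedConfiguration

/-! ### Centred sums and their limits -/

/-- The sum of `g` over the scatterers in `D`, minus its expectation. -/
def centredSum (μ : Measure I) (D : Set E) (g : E × I → E) (ω : ChargedConfiguration I) : E :=
  cloudSum D g ω - ∫ p in D ×ˢ univ, g p ∂(intensity μ)

/-- Bounded measurable sets which eventually contain every ball. -/
structure Exhausts (D : ℝ → Set E) : Prop where
  isBounded : ∀ R, 0 < R → Bornology.IsBounded (D R)
  measurableSet : ∀ R, 0 < R → MeasurableSet (D R)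
  ball_subset : ∀ ρ : ℝ, ∀ᶠ R in atTop, Metric.ball 0 ρ ⊆ D R

theorem diff_prod_univ (D D' : Set E) :
    (D \ D') ×ˢ (univ : Set I) = D ×ˢ univ \ D' ×ˢ univ := by
  ext p
  simp

theorem cloudSum_diff {F : Type*} [NormedAddCommGroup F] [NormedSpace ℝ F] {D D' : Set E}
    (hD : Bornology.IsBounded D) (hDm : MeasurableSet D) (hDm' : MeasurableSet D')
    (h : D' ⊆ D) (f : E × I → F) (ω : ChargedConfiguration I) :
    cloudSum (D \ D') f ω = cloudSum D f ω - cloudSum D' f ω := by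
  rw [cloudSum, diff_prod_univ, cloudSum, cloudSum]
  exact setIntegral_sdiff (hDm'.prod .univ) (ω.integrableOn_pointMeasure hD hDm f)
    (prod_mono h le_rfl)

theorem cloudSum_indicator {F : Type*} [NormedAddCommGroup F] [NormedSpace ℝ F] {D S : Set E}
    (hS : MeasurableSet S) (f : E × I → F) (ω : ChargedConfiguration I) :
    cloudSum D ((S ×ˢ univ).indicator f) ω = cloudSum (D ∩ S) f ω := by
  rw [cloudSum, setIntegral_indicator (hS.prod .univ), Set.prod_inter_prod, univ_inter, cloudSum]

theorem integrableOn_of_sq {μ : Measure I} [IsProbabilityMeasure μ] {D : Set E}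
    (hD : Bornology.IsBounded D) {g : E × I → E}
    (hg : Measurable g) (hg2 : Integrable (fun p => ‖g p‖ ^ 2) (intensity μ)) :
    IntegrableOn g (D ×ˢ univ) (intensity μ) := by
  have := isFiniteMeasure_intensity μ hD
  rw [IntegrableOn, ← integrable_norm_iff hg.aestronglyMeasurable]
  exact integrable_of_integrable_sq hg.norm.aestronglyMeasurable hg2.integrableOn

theorem centredSum_diff {μ : Measure I} [IsProbabilityMeasure μ] {D D' : Set E}
    (hD : Bornology.IsBounded D) (hDm : MeasurableSet D) (hDm' : MeasurableSet D')
    (h : D' ⊆ D) {g : E × I → E}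
    (hg : Measurable g) (hg2 : Integrable (fun p => ‖g p‖ ^ 2) (intensity μ)) :
    centredSum μ (D \ D') g = centredSum μ D g - centredSum μ D' g := by
  ext1 ω
  rw [Pi.sub_apply, centredSum, cloudSum_diff hD hDm hDm' h, diff_prod_univ,
    setIntegral_sdiff (hDm'.prod .univ) (integrableOn_of_sq hD hg hg2) (prod_mono h le_rfl), centredSum,
    centredSum]
  abel

theorem measurable_centredSum {μ : Measure I} {D : Set E} (hD : Bornology.IsBounded D)
    (hDm : MeasurableSet D) {g : E × I → E} (hg : Measurable g) :
    Measurable (centredSum μ D g) :=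
  (measurable_cloudSum hD hDm hg).sub_const _

/-- The scalar bound is applied in each coordinate of an orthonormal basis; summing the squares
recovers the norm on both sides with the same constant. -/
theorem IsScattererDistribution.eLpNorm_centredSum_le {μ : Measure I} [IsProbabilityMeasure μ]
    {P : Measure (ChargedConfiguration I)} [IsProbabilityMeasure P]
    (hP : IsScattererDistribution μ P) {D : Set E} (hD : Bornology.IsBounded D)
    (hDm : MeasurableSet D) {g : E × I → E}
    (hg : Measurable g) (hg2 : Integrable (fun p => ‖g p‖ ^ 2) (intensity μ)) :
    eLpNorm (centredSum μ D g) 2 P ≤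
      ENNReal.ofReal (6 * ∫ p in D ×ˢ univ, ‖g p‖ ^ 2 ∂(intensity μ)) ^ (1 / 2 : ℝ) := by
  rw [eLpNorm_eq_lintegral_rpow_enorm_toReal (by norm_num) (by norm_num)]
  simp only [ENNReal.toReal_ofNat]
  refine ENNReal.rpow_le_rpow ?_ (by norm_num)
  set b := EuclideanSpace.basisFun (Fin 3) ℝ
  have hgi := integrableOn_of_sq hD hg hg2
  have hsq : ∀ x : E, ‖x‖ ^ 2 = ∑ i, (inner ℝ (b i) x) ^ 2 := fun x => by
    rw [← b.sum_sq_norm_inner_right x]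
    simp
  have hcoord : ∀ i ω, inner ℝ (b i) (centredSum μ D g ω) =
      cloudSum D (fun p => inner ℝ (b i) (g p)) ω -
        ∫ p in D ×ˢ univ, inner ℝ (b i) (g p) ∂(intensity μ) := by
    intro i ω
    rw [centredSum, inner_sub_right, inner_cloudSum hD hDm, integral_inner hgi]
  have hi2 : ∀ i, Integrable (fun p => (inner ℝ (b i) (g p)) ^ 2) (intensity μ) := fun i =>
    hg2.mono' (by fun_prop) (.of_forall fun p => by
      rw [Real.norm_of_nonneg (sq_nonneg _), hsq]
      exact Finset.single_le_sum (f := fun i => (inner ℝ (b i) (g p)) ^ 2)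
        (fun j _ => sq_nonneg _) (Finset.mem_univ i))
  calc ∫⁻ ω, ‖centredSum μ D g ω‖ₑ ^ (2 : ℝ) ∂P
      = ∫⁻ ω, ∑ i, ENNReal.ofReal ((inner ℝ (b i) (centredSum μ D g ω)) ^ 2) ∂P := by
        refine lintegral_congr fun ω => ?_
        rw [← ENNReal.ofReal_sum_of_nonneg (fun _ _ => sq_nonneg _), ← hsq,
          ENNReal.rpow_ofNat, ← ofReal_norm, ENNReal.ofReal_pow (norm_nonneg _)]
    _ = ∑ i, ∫⁻ ω, ENNReal.ofReal ((inner ℝ (b i) (centredSum μ D g ω)) ^ 2) ∂P := by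
        have := measurable_centredSum (μ := μ) hD hDm hg
        exact lintegral_finsetSum _ fun i _ => by fun_prop
    _ ≤ ∑ i, ENNReal.ofReal (6 * ∫ p in D ×ˢ univ, (inner ℝ (b i) (g p)) ^ 2 ∂(intensity μ)) := by
        refine Finset.sum_le_sum fun i _ => ?_
        simp_rw [hcoord]
        exact hP.lintegral_sq_cloudSum_sub_le hD hDm (by fun_prop) (hi2 i).integrableOn
    _ = _ := by
        rw [← ENNReal.ofReal_sum_of_nonneg (fun _ _ => by positivity), ← Finset.mul_sum,
          ← integral_finsetSum _ fun i _ => (hi2 i).integrableOn]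
        simp_rw [hsq]

/-- For `D ⊇ B n`, the difference of the two centred sums is the centred sum over `D \ B n`, whose
`L²` norm is controlled by the tail of `∫ ‖g‖²` outside `B n` alone. Hence sums over balls are
Cauchy, and every exhausting family has the same limit. -/
theorem IsScattererDistribution.exists_limit_centredSum {μ : Measure I} [IsProbabilityMeasure μ]
    {P : Measure (ChargedConfiguration I)} [IsProbabilityMeasure P]
    (hP : IsScattererDistribution μ P) {g : E × I → E}
    (hg : Measurable g) (hg2 : Integrable (fun p => ‖g p‖ ^ 2) (intensity μ)) :
    ∃ L : ChargedConfiguration I → E, Measurable L ∧ Integrable L P ∧ ∫ ω, L ω ∂P = 0 ∧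
      ∀ D : ℝ → Set E, Exhausts D →
        Tendsto (fun R => eLpNorm (centredSum μ (D R) g - L) 1 P) atTop (𝓝 0) := by
  set B : ℕ → Set E := fun n => Metric.ball 0 n
  have hBb : ∀ n, Bornology.IsBounded (B n) := fun n => Metric.isBounded_ball
  have hBm : ∀ n, MeasurableSet (B n) := fun n => Metric.isOpen_ball.measurableSet
  have hBmono : Monotone B := fun m n h => Metric.ball_subset_ball (by exact_mod_cast h)
  set τ : ℕ → ENNReal := fun n =>
    ENNReal.ofReal (6 * ∫ p in (B n)ᶜ ×ˢ univ, ‖g p‖ ^ 2 ∂(intensity μ)) ^ (1 / 2 : ℝ)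
  have hτ : Tendsto τ atTop (𝓝 0) := by
    have h0 : Tendsto (fun n => ∫ p in (B n)ᶜ ×ˢ (univ : Set I), ‖g p‖ ^ 2 ∂(intensity μ)) atTop
        (𝓝 (∫ p in ⋂ n, (B n)ᶜ ×ˢ (univ : Set I), ‖g p‖ ^ 2 ∂(intensity μ))) := by
      refine tendsto_setIntegral_of_antitone (fun n => (hBm n).compl.prod .univ) ?_
        ⟨0, hg2.integrableOn⟩
      exact fun m n h => prod_mono (compl_subset_compl.2 (hBmono h)) le_rfl
    have he : ⋂ n, (B n)ᶜ ×ˢ (univ : Set I) = ∅ := by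
      ext ⟨z, q⟩
      simp only [B, mem_iInter, mem_prod, mem_compl_iff, Metric.mem_ball, dist_zero_right, mem_univ,
        and_true, mem_empty_iff_false, iff_false, not_forall, not_not]
      exact exists_nat_gt ‖z‖
    rw [he] at h0
    simp only [Measure.restrict_empty, integral_zero_measure] at h0
    have h1 := ENNReal.tendsto_ofReal (h0.const_mul 6)
    rw [mul_zero, ENNReal.ofReal_zero] at h1
    have h2 := ((ENNReal.continuous_rpow_const (y := 1 / 2)).tendsto 0).comp h1
    rwa [ENNReal.zero_rpow_of_pos (by norm_num)] at h2
  have htail : ∀ n (D : Set E), Bornology.IsBounded D → MeasurableSet D → B n ⊆ D →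
      eLpNorm (centredSum μ D g - centredSum μ (B n) g) 2 P ≤ τ n := by
    intro n D hD hDm h
    rw [← centredSum_diff hD hDm (hBm n) h hg hg2]
    refine (hP.eLpNorm_centredSum_le (hD.subset sdiff_subset) (hDm.diff (hBm n)) hg hg2).trans ?_
    refine ENNReal.rpow_le_rpow (ENNReal.ofReal_le_ofReal ?_) (by norm_num)
    refine mul_le_mul_of_nonneg_left ?_ (by norm_num)
    refine setIntegral_mono_set hg2.integrableOn (.of_forall fun p => sq_nonneg _) ?_
    exact (prod_mono (fun x hx => hx.2) le_rfl).eventuallyLE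
  have hmem : ∀ n, MemLp (centredSum μ (B n) g) 2 P := fun n =>
    ⟨(measurable_centredSum (hBb n) (hBm n) hg).aestronglyMeasurable,
      (hP.eLpNorm_centredSum_le (hBb n) (hBm n) hg hg2).trans_lt
        (ENNReal.rpow_lt_top_of_nonneg (by norm_num) ENNReal.ofReal_ne_top)⟩
  have hcauchy : CauchySeq fun n => (hmem n).toLp := by
    refine EMetric.cauchySeq_iff_le_tendsto_0.2 ⟨fun N => 2 * τ N, fun n m N hn hm => ?_, ?_⟩
    · have h1 : ∀ k, N ≤ k → edist (hmem k).toLp (hmem N).toLp ≤ τ N := fun k hk => by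
        rw [Lp.edist_toLp_toLp]
        exact htail N (B k) (hBb k) (hBm k) (hBmono hk)
      refine (edist_triangle_right _ _ (hmem N).toLp).trans ?_
      refine le_of_le_of_eq ?_ (two_mul _).symm
      exact add_le_add (h1 n hn) (h1 m hm)
    · simpa using ENNReal.Tendsto.const_mul hτ (.inr ENNReal.ofNat_ne_top)
  obtain ⟨L', hL'⟩ := cauchySeq_tendsto_of_complete hcauchy
  have hL'm := Lp.memLp L'
  -- The limit class is replaced by a genuinely measurable representative, since random fields are
  -- required to consist of measurable maps.
  obtain ⟨L, hLm, hLae⟩ := hL'm.aestronglyMeasurable.aemeasurable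
  have hLmem : MemLp L 2 P := hL'm.ae_eq hLae
  have hlim : Tendsto (fun n => eLpNorm (centredSum μ (B n) g - L) 2 P) atTop (𝓝 0) := by
    have h1 := tendsto_iff_edist_tendsto_0.1 hL'
    refine h1.congr fun n => ?_
    rw [Lp.edist_def]
    exact eLpNorm_congr_ae ((hmem n).coeFn_toLp.sub hLae)
  have hexh : ∀ D : ℝ → Set E, Exhausts D →
      Tendsto (fun R => eLpNorm (centredSum μ (D R) g - L) 1 P) atTop (𝓝 0) := by
    intro D hD
    rw [ENNReal.tendsto_nhds_zero]
    intro ε hε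
    have h1 : Tendsto (fun n => τ n + eLpNorm (centredSum μ (B n) g - L) 2 P) atTop (𝓝 0) := by
      simpa using hτ.add hlim
    obtain ⟨n, hn⟩ := ((ENNReal.tendsto_nhds_zero.1 h1) ε hε).exists
    filter_upwards [hD.ball_subset n, eventually_gt_atTop 0] with R hR hR0
    have hmR := measurable_centredSum (μ := μ) (hD.isBounded R hR0) (hD.measurableSet R hR0) hg
    refine (eLpNorm_le_eLpNorm_of_exponent_le one_le_two
      (hmR.sub hLm).aestronglyMeasurable).trans ?_
    rw [← sub_add_sub_cancel (centredSum μ (D R) g) (centredSum μ (B n) g) L]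
    refine (eLpNorm_add_le ?_ ?_ one_le_two).trans (le_trans (add_le_add_left ?_ _) hn)
    · exact (hmR.sub (measurable_centredSum (hBb n) (hBm n) hg)).aestronglyMeasurable
    · exact ((measurable_centredSum (hBb n) (hBm n) hg).sub hLm).aestronglyMeasurable
    · exact htail n _ (hD.isBounded R hR0) (hD.measurableSet R hR0) hR
  refine ⟨L, hLm, hLmem.integrable one_le_two, ?_, hexh⟩
  have h1 : Tendsto (fun n => eLpNorm (centredSum μ (B n) g - L) 1 P) atTop (𝓝 0) :=
    tendsto_of_tendsto_of_tendsto_of_le_of_le tendsto_const_nhds hlim (fun _ => zero_le) fun n =>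
      eLpNorm_le_eLpNorm_of_exponent_le one_le_two
        ((measurable_centredSum (hBb n) (hBm n) hg).sub hLm).aestronglyMeasurable
  have h2 := tendsto_integral_of_L1' L hLm.aestronglyMeasurable
    (.of_forall fun n => (hmem n).integrable one_le_two) h1
  refine tendsto_nhds_unique h2 ?_
  have h3 : ∀ n, ∫ ω, centredSum μ (B n) g ω ∂P = 0 := by
    intro n
    have hgi := integrableOn_of_sq (hBb n) hg hg2
    simp only [centredSum]
    rw [integral_sub (hP.integrable_cloudSum (hBb n) (hBm n) hg hgi) (integrable_const _),
      hP.integral_cloudSum (hBb n) (hBm n) hg hgi]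
    simp
  simp_rw [h3]
  exact tendsto_const_nhds

theorem tendsto_integral_exp_of_tendsto_eLpNorm {Ω : Type*} [MeasurableSpace Ω] {P : Measure Ω}
    [IsProbabilityMeasure P] {Y : ℝ → Ω → ℝ} {Z : Ω → ℝ} (hY : ∀ᶠ R in atTop, Measurable (Y R))
    (hZ : Measurable Z) (h : Tendsto (fun R => eLpNorm (Y R - Z) 1 P) atTop (𝓝 0)) :
    Tendsto (fun R => ∫ ω, Complex.exp ((Y R ω : ℂ) * Complex.I) ∂P) atTop
      (𝓝 (∫ ω, Complex.exp ((Z ω : ℂ) * Complex.I) ∂P)) := by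
  have hint : ∀ W : Ω → ℝ, Measurable W → Integrable (fun ω => Complex.exp ((W ω : ℂ) * Complex.I))
      P := fun W hW => Integrable.of_bound (C := 1) (by fun_prop) (.of_forall fun ω => by
        rw [Complex.norm_exp_ofReal_mul_I])
  refine tendsto_integral_of_L1' _ (hint Z hZ).1 (hY.mono fun R hR => hint _ hR) ?_
  refine tendsto_of_tendsto_of_tendsto_of_le_of_le tendsto_const_nhds h (fun _ => zero_le)
    fun R => ?_
  refine eLpNorm_mono fun ω => ?_
  have h1 : Complex.exp ((Y R ω : ℂ) * Complex.I) - Complex.exp ((Z ω : ℂ) * Complex.I) =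
      Complex.exp ((Z ω : ℂ) * Complex.I) *
        (Complex.exp (Complex.I * ((Y R ω - Z ω : ℝ) : ℂ)) - 1) := by
    rw [mul_sub, ← Complex.exp_add]
    congr 2
    · push_cast; ring
    · simp
  simp only [Pi.sub_apply]
  rw [h1, norm_mul, Complex.norm_exp_ofReal_mul_I, one_mul]
  exact Real.norm_exp_I_mul_ofReal_sub_one_le

/-! ### Isotropic measures -/

/-- A measure invariant under all linear isometries. -/
def Isotropic (ρ : Measure E) : Prop := ∀ L : E ≃ₗᵢ[ℝ] E, ρ.map L = ρ

theorem exists_linearIsometryEquiv_apply_eq {x y : E} (h : ‖x‖ = ‖y‖) :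
    ∃ L : E ≃ₗᵢ[ℝ] E, L x = y :=
  ⟨_, Submodule.reflection_sub h⟩

theorem isotropic_volume : Isotropic (volume : Measure E) := fun L => L.measurePreserving.map_eq

theorem Isotropic.charFun_apply {ρ : Measure E} (h : Isotropic ρ) (L : E ≃ₗᵢ[ℝ] E) (t : E) :
    MeasureTheory.charFun ρ (L t) = MeasureTheory.charFun ρ t := by
  conv_lhs => rw [← h L]
  rw [MeasureTheory.charFun_apply, MeasureTheory.charFun_apply,
    integral_map L.continuous.measurable.aemeasurable (by fun_prop)]
  simp_rw [LinearIsometryEquiv.inner_map_map]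

/-- The characteristic function of an isotropic measure is radial, so it may be averaged over the
directions of its argument. After exchanging the integrals, the averaged exponential `κ` depends on
`x` only through `‖x‖`, and only the law of the norm remains. Normalized points of the unit ball
serve as uniform directions. -/
theorem Isotropic.eq_of_map_norm_eq {ρ ρ' : Measure E} [IsFiniteMeasure ρ] [IsFiniteMeasure ρ']
    (h : Isotropic ρ) (h' : Isotropic ρ') (hn : ρ.map norm = ρ'.map norm) : ρ = ρ' := by
  set β : Measure E := volume.restrict (Metric.ball 0 1)
  have hβ : IsFiniteMeasure β := ⟨by simp [β]⟩
  set e : E := EuclideanSpace.single 0 1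
  have he : ‖e‖ = 1 := by simp [e]
  set κ : ℝ → E → ℂ := fun r x => ∫ z, Complex.exp ((inner ℝ x (r • ‖z‖⁻¹ • z) : ℂ) * Complex.I) ∂β
  have hκ : ∀ r x, κ r x = κ r (‖x‖ • e) := by
    intro r x
    obtain ⟨L, hL⟩ := exists_linearIsometryEquiv_apply_eq (x := x) (y := ‖x‖ • e)
      (by simp [norm_smul, he])
    have hmp : MeasurePreserving L β β := by
      have h1 := L.measurePreserving.restrict_preimage
        (Metric.isOpen_ball (x := (0 : E)) (ε := 1)).measurableSet
      have h2 : L ⁻¹' Metric.ball 0 1 = Metric.ball 0 1 := by ext; simp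
      rwa [h2] at h1
    rw [← hL]
    simp only [κ]
    conv_rhs => rw [← hmp.integral_comp L.toHomeomorph.measurableEmbedding]
    refine integral_congr_ae (.of_forall fun z => ?_)
    simp only
    rw [L.norm_map, ← map_smul, ← map_smul, L.inner_map_map]
  have key : ∀ σ : Measure E, IsFiniteMeasure σ → Isotropic σ → ∀ t : E,
      β.real univ • MeasureTheory.charFun σ t = ∫ s : ℝ, κ ‖t‖ (s • e) ∂(σ.map norm) := by
    intro σ _ hσ t
    have hc : Measurable fun p : E × E =>
      Complex.exp ((inner ℝ p.1 (‖t‖ • ‖p.2‖⁻¹ • p.2) : ℂ) * Complex.I) := by fun_prop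
    have hκm : StronglyMeasurable (κ ‖t‖) := hc.stronglyMeasurable.integral_prod_right'
    have h1 : ∫ z, MeasureTheory.charFun σ t ∂β =
        ∫ z, MeasureTheory.charFun σ (‖t‖ • ‖z‖⁻¹ • z) ∂β := by
      refine integral_congr_ae ?_
      have hz : ∀ᵐ z ∂β, z ≠ 0 := by
        refine ae_restrict_of_ae ?_
        simp [ae_iff]
      filter_upwards [hz] with z hz
      obtain ⟨L, hL⟩ := exists_linearIsometryEquiv_apply_eq (x := t) (y := ‖t‖ • ‖z‖⁻¹ • z)
        (by simp [norm_smul, hz])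
      rw [← hL, hσ.charFun_apply]
    rw [integral_const] at h1
    rw [h1, integral_map (φ := (norm : E → ℝ)) (f := fun s => κ ‖t‖ (s • e)) (by fun_prop)
      (hκm.comp_measurable (by fun_prop : Measurable fun s : ℝ => s • e)).aestronglyMeasurable]
    simp_rw [← hκ, MeasureTheory.charFun_apply]
    simp only [κ]
    rw [integral_integral_swap]
    refine Integrable.of_bound (C := 1) (by fun_prop) (.of_forall fun p => ?_)
    rw [Function.uncurry, Complex.norm_exp_ofReal_mul_I]
  refine Measure.ext_of_charFun (funext fun t => ?_)
  have hpos : β.real univ ≠ 0 := by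
    simp only [β, measureReal_def, Measure.restrict_apply_univ]
    exact ENNReal.toReal_ne_zero.2 ⟨(Metric.measure_ball_pos _ _ one_pos).ne',
      measure_ball_lt_top.ne⟩
  have := (key ρ inferInstance h t).trans ((congrArg (fun m => ∫ s : ℝ, κ ‖t‖ (s • e) ∂m) hn).trans
    (key ρ' inferInstance h' t).symm)
  exact smul_right_injective _ hpos this

/-- If `m` is the density of the law of the norm with respect to the radial image of Lebesgue
measure, then `m(‖z‖) dz` is isotropic with the same radial law, hence equal to `ρ`. -/
theorem Isotropic.absolutelyContinuous {ρ : Measure E} [IsFiniteMeasure ρ] (h : Isotropic ρ)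
    (hn : ρ.map norm ≪ (volume : Measure E).map norm) : ρ ≪ volume := by
  set κ := (volume : Measure E).map norm
  have hκ : SigmaFinite κ := by
    refine ⟨⟨⟨fun n : ℕ => Metric.ball 0 n, fun _ => trivial, fun n => ?_,
      Metric.iUnion_ball_nat 0⟩⟩⟩
    rw [Measure.map_apply measurable_norm Metric.isOpen_ball.measurableSet]
    refine (measure_mono ?_).trans_lt (measure_ball_lt_top (x := (0 : E)) (r := n))
    intro z hz
    simpa using hz
  set m := (ρ.map norm).rnDeriv κ
  have hm : Measurable m := Measure.measurable_rnDeriv _ _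
  have hden : κ.withDensity m = ρ.map norm := Measure.withDensity_rnDeriv_eq _ _ hn
  set τ := (volume : Measure E).withDensity fun z => m ‖z‖
  have hτn : τ.map norm = ρ.map norm := by
    rw [← hden]
    ext s hs
    rw [Measure.map_apply measurable_norm hs, withDensity_apply _ (measurable_norm hs),
      withDensity_apply _ hs, setLIntegral_map hs hm measurable_norm]
  have hτfin : IsFiniteMeasure τ := by
    refine ⟨?_⟩
    have : τ.map norm univ < ⊤ := by
      rw [hτn]
      exact measure_lt_top _ _
    rwa [Measure.map_apply measurable_norm .univ, preimage_univ] at this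
  have hτ : Isotropic τ := by
    intro L
    ext s hs
    have hL := L.continuous.measurable
    rw [Measure.map_apply hL hs, withDensity_apply _ (hL hs), withDensity_apply _ hs]
    conv_rhs => rw [← isotropic_volume L]
    rw [setLIntegral_map hs (by fun_prop) hL]
    simp
  rw [h.eq_of_map_norm_eq hτ hτn.symm]
  exact withDensity_absolutelyContinuous _ _

theorem Isotropic.conv {ρ ρ' : Measure E} [IsFiniteMeasure ρ] [IsFiniteMeasure ρ']
    (h : Isotropic ρ) (h' : Isotropic ρ') : Isotropic (ρ.conv ρ') := by
  intro L
  have hL := L.continuous.measurable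
  refine Measure.ext_of_charFun (funext fun t => ?_)
  have hadj : ∀ σ : Measure E, MeasureTheory.charFun (σ.map L) t =
      MeasureTheory.charFun σ (L.symm t) := by
    intro σ
    rw [MeasureTheory.charFun_apply, MeasureTheory.charFun_apply,
      integral_map hL.aemeasurable (by fun_prop)]
    refine integral_congr_ae (.of_forall fun x => ?_)
    simp only
    rw [← L.inner_map_map x (L.symm t), L.apply_symm_apply]
  rw [hadj, charFun_conv, charFun_conv, h.charFun_apply, h'.charFun_apply]

/-! ### Null cones -/

/-- Fubini along the lines parallel to `a`. On a line off the axis the quotient `⟨a, y⟩ / ‖y‖` has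
an explicit differentiable inverse, and differentiable maps send null sets to null sets. The axis
itself is a null set. -/
theorem volume_cone_eq_zero {a : E} (ha : a ≠ 0) {N : Set ℝ} (hN : volume N = 0) :
    volume {y : E | inner ℝ a y / ‖y‖ ∈ N} = 0 := by
  -- The values `±‖a‖` are attained exactly on the axis, by equality in Cauchy–Schwarz, and there
  -- the inverse below would be singular.
  set N₁ := toMeasurable volume N \ {‖a‖, -‖a‖}
  have hN₁m : MeasurableSet N₁ :=
    (measurableSet_toMeasurable _ _).diff ((measurableSet_singleton _).insert _)
  have hN₁ : volume N₁ = 0 :=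
    measure_mono_null sdiff_subset (by rwa [measure_toMeasurable])
  have hline : volume ((Submodule.span ℝ {a} : Submodule ℝ E) : Set E) = 0 := by
    refine Measure.addHaar_submodule _ _ fun htop => ?_
    have h1 := finrank_span_singleton (K := ℝ) ha
    rw [htop, finrank_top, finrank_euclideanSpace_fin] at h1
    omega
  have hsub : {y : E | inner ℝ a y / ‖y‖ ∈ N} ⊆
      ((Submodule.span ℝ {a} : Submodule ℝ E) : Set E) ∪ {y : E | inner ℝ a y / ‖y‖ ∈ N₁} := by
    intro y hy
    by_cases hspan : y ∈ Submodule.span ℝ {a}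
    · exact .inl hspan
    refine .inr ⟨subset_toMeasurable _ _ hy, fun hy' => hspan ?_⟩
    have hy0 : y ≠ 0 := by
      rintro rfl
      exact hspan (zero_mem _)
    have hyn : ‖y‖ ≠ 0 := norm_ne_zero_iff.2 hy0
    have habs : |inner ℝ a y| = ‖a‖ * ‖y‖ := by
      rcases hy' with h | h
      · rw [div_eq_iff hyn] at h
        rw [h, abs_of_nonneg (by positivity)]
      · rw [mem_singleton_iff, div_eq_iff hyn] at h
        rw [h, neg_mul, abs_neg, abs_of_nonneg (by positivity)]
    obtain ⟨r, -, hr⟩ := (abs_real_inner_div_norm_mul_norm_eq_one_iff a y).1 (by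
      rw [abs_div, habs, abs_of_nonneg (a := ‖a‖ * ‖y‖) (by positivity)]
      exact div_self (by have := norm_ne_zero_iff.2 ha; positivity)) |>.2
    exact Submodule.mem_span_singleton.2 ⟨r, hr.symm⟩
  refine measure_mono_null hsub (measure_union_null hline ?_)
  have hCm : MeasurableSet {y : E | inner ℝ a y / ‖y‖ ∈ N₁}ᶜ := by
    refine (hN₁m.preimage (f := fun y : E => inner ℝ a y / ‖y‖) ?_).compl
    fun_prop
  have hae : ∀ᵐ y : E, y ∈ {y : E | inner ℝ a y / ‖y‖ ∈ N₁}ᶜ := by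
    refine ae_mem_of_ae_add_linearMap_mem (LinearMap.toSpanSingleton ℝ E a) volume volume hCm ?_
    intro y
    set t₀ := inner ℝ a y / ‖a‖ ^ 2
    set w := y - t₀ • a
    have han : ‖a‖ ≠ 0 := norm_ne_zero_iff.2 ha
    have haw : inner ℝ a w = 0 := by
      simp only [w, t₀, inner_sub_right, inner_smul_right, real_inner_self_eq_norm_sq]
      field_simp
      ring
    have hnorm : ∀ t : ℝ, ‖y + t • a‖ ^ 2 = ‖w‖ ^ 2 + (t + t₀) ^ 2 * ‖a‖ ^ 2 := by
      intro t
      have : y + t • a = w + (t + t₀) • a := by simp only [w]; module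
      rw [this, norm_add_sq_real, inner_smul_right, real_inner_comm, haw, norm_smul, mul_pow,
        Real.norm_eq_abs, sq_abs]
      ring
    have hin : ∀ t : ℝ, inner ℝ a (y + t • a) = (t + t₀) * ‖a‖ ^ 2 := by
      intro t
      rw [inner_add_right, inner_smul_right, real_inner_self_eq_norm_sq]
      simp only [t₀]
      field_simp
      ring
    -- With `w` the component of `y` orthogonal to `a`, solving `u = τ ‖a‖² / √(‖w‖² + τ² ‖a‖²)` for
    -- `τ = t + t₀` gives this function of `u`.
    have himage : volume ((fun u : ℝ => u * ‖w‖ / (‖a‖ * √(‖a‖ ^ 2 - u ^ 2)) - t₀) ''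
        (N₁ ∩ {u | 0 < ‖a‖ ^ 2 - u ^ 2})) = 0 := by
      refine addHaar_image_eq_zero_of_differentiableOn_of_addHaar_eq_zero _ ?_
        (measure_mono_null inter_subset_left hN₁)
      intro u hu
      have hu2 : (0 : ℝ) < ‖a‖ ^ 2 - u ^ 2 := hu.2
      refine DifferentiableAt.differentiableWithinAt ?_
      refine DifferentiableAt.sub_const (DifferentiableAt.div (by fun_prop)
        ((DifferentiableAt.sqrt (f := fun u : ℝ => ‖a‖ ^ 2 - u ^ 2) (by fun_prop)
          hu2.ne').const_mul _) ?_) _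
      have := (Real.sqrt_pos.2 hu2).ne'
      positivity
    refine measure_mono_null ?_ himage
    intro t ht
    have ht' : inner ℝ a (y + t • a) / ‖y + t • a‖ ∈ N₁ := by
      by_contra hcon
      exact ht hcon
    set u := inner ℝ a (y + t • a) / ‖y + t • a‖ with hu
    have hne : u ≠ ‖a‖ ∧ u ≠ -‖a‖ := by
      have := ht'.2
      simpa [not_or] using this
    set r := ‖y + t • a‖
    have hr0 : 0 ≤ r := norm_nonneg _
    rw [hin] at hu
    have hr2 := hnorm t
    change r ^ 2 = _ at hr2
    rcases hr0.eq_or_lt with hr | hr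
    · have hT : t + t₀ = 0 := by
        rw [← hr] at hr2
        have h1 : (t + t₀) ^ 2 * ‖a‖ ^ 2 = 0 := by nlinarith [sq_nonneg ‖w‖, sq_nonneg ((t + t₀) * ‖a‖)]
        have h2 : (t + t₀) ^ 2 = 0 := by
          rcases mul_eq_zero.1 h1 with h | h
          · exact h
          · exact absurd h (by positivity)
        exact pow_eq_zero_iff two_ne_zero |>.1 h2
      have hu0 : u = 0 := by rw [hu, hT]; simp
      refine ⟨u, ⟨ht', ?_⟩, ?_⟩
      · rw [mem_ofPred_eq, hu0, zero_pow two_ne_zero, sub_zero]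
        positivity
      · simp only [hu0]
        simp
        linarith
    · have hsq : ‖a‖ ^ 2 - u ^ 2 = (‖a‖ * ‖w‖ / r) ^ 2 := by
        rw [hu]
        field_simp
        rw [hr2]
        ring
      have hwn : ‖w‖ ≠ 0 := by
        intro hw
        rw [hw] at hsq
        have : (‖a‖ - u) * (‖a‖ + u) = 0 := by
          rw [show (‖a‖ - u) * (‖a‖ + u) = ‖a‖ ^ 2 - u ^ 2 by ring, hsq]
          simp
        rcases mul_eq_zero.1 this with h | h
        · exact hne.1 (by linarith)
        · exact hne.2 (by linarith)
      refine ⟨u, ⟨ht', ?_⟩, ?_⟩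
      · rw [mem_ofPred_eq, hsq]
        positivity
      · simp only
        rw [hsq, Real.sqrt_sq (by positivity), hu]
        field_simp
        ring
  simpa [ae_iff] using hae

/-! ### Polar coordinates -/

/-- Fubini in polar coordinates. The measure of a subset of the unit sphere is defined through the
volume of the cone over it, so nullity of a section can be stated for a cone in space. -/
theorem volume_eq_zero_of_sphere_sections {S : Set E} (hS : MeasurableSet S)
    (h : ∀ r : ℝ, 0 < r → volume {y : E | y ≠ 0 ∧ r • ‖y‖⁻¹ • y ∈ S} = 0) : volume S = 0 := by
  set S' : Set (Metric.sphere (0 : E) 1 × Ioi (0 : ℝ)) := {p | (p.2 : ℝ) • (p.1 : E) ∈ S}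
  have hS' : MeasurableSet S' :=
    hS.preimage (f := fun p : Metric.sphere (0 : E) 1 × Ioi (0 : ℝ) => (p.2 : ℝ) • (p.1 : E))
      (by fun_prop)
  have hmp := Measure.measurePreserving_homeomorphUnitSphereProd (volume : Measure E)
  have hpre : homeomorphUnitSphereProd E ⁻¹' S' = (Subtype.val : ({0}ᶜ : Set E) → E) ⁻¹' S := by
    ext y
    have hy : ‖(y : E)‖ ≠ 0 := norm_ne_zero_iff.2 y.2
    simp only [S', mem_preimage, mem_ofPred_eq, homeomorphUnitSphereProd_apply_snd_coe,
      homeomorphUnitSphereProd_apply_fst_coe]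
    rw [smul_smul, mul_inv_cancel₀ hy, one_smul]
  have h0 : (Measure.comap Subtype.val volume) ((Subtype.val : ({0}ᶜ : Set E) → E) ⁻¹' S) = 0 := by
    rw [← hpre, hmp.measure_preimage hS'.nullMeasurableSet, Measure.prod_apply_symm hS']
    refine (lintegral_congr fun r => ?_).trans lintegral_zero
    have hm : MeasurableSet ((fun w : Metric.sphere (0 : E) 1 => (w, r)) ⁻¹' S') :=
      measurable_prodMk_right hS'
    rw [Measure.toSphere_apply' _ hm, mul_eq_zero]
    right
    refine measure_mono_null ?_ (h r r.2)
    rintro _ ⟨c, hc, _, ⟨w, hw, rfl⟩, rfl⟩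
    have hw1 : ‖(w : E)‖ = 1 := by simp
    have hc0 : (0 : ℝ) < c := hc.1
    refine ⟨?_, ?_⟩
    · simp only [ne_eq, smul_eq_zero, not_or]
      exact ⟨hc0.ne', norm_ne_zero_iff.1 (by rw [hw1]; exact one_ne_zero)⟩
    · have : (r : ℝ) • ‖c • (w : E)‖⁻¹ • c • (w : E) = (r : ℝ) • (w : E) := by
        rw [norm_smul, hw1, Real.norm_of_nonneg hc0.le, mul_one, smul_smul c⁻¹,
          inv_mul_cancel₀ hc0.ne', one_smul]
      simp only
      rw [this]
      exact hw
  rw [comap_subtype_coe_apply (measurableSet_singleton _).compl, Subtype.image_preimage_coe] at h0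
  refine measure_mono_null (t := ({0} : Set E) ∪ ({0}ᶜ ∩ S)) ?_ (measure_union_null (by simp) h0)
  intro y hy
  by_cases hy0 : y = 0
  · exact .inl hy0
  · exact .inr ⟨hy0, hy⟩

theorem volume_inter_Ioi_eq_zero_of_norm {N : Set ℝ} (hN : MeasurableSet N)
    (h : (volume : Measure E) {z | ‖z‖ ∈ N} = 0) : volume (N ∩ Ioi 0) = 0 := by
  set N' : Set (Ioi (0 : ℝ)) := Subtype.val ⁻¹' N
  have hN' : MeasurableSet N' := hN.preimage measurable_subtype_coe
  have hmp := Measure.measurePreserving_homeomorphUnitSphereProd (volume : Measure E)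
  have hpre : homeomorphUnitSphereProd E ⁻¹' (univ ×ˢ N') =
      (Subtype.val : ({0}ᶜ : Set E) → E) ⁻¹' {z | ‖z‖ ∈ N} := by
    ext y
    simp [N']
  have h0 := hmp.measure_preimage (MeasurableSet.univ.prod hN').nullMeasurableSet
  rw [hpre, comap_subtype_coe_apply (measurableSet_singleton _).compl,
    measure_mono_null (by simp) h, Measure.prod_prod] at h0
  have hσ : (volume : Measure E).toSphere univ ≠ 0 := by
    rw [Measure.toSphere_apply_univ]
    simp [Real.pi_pos]
  have h1 : Measure.volumeIoiPow (Module.finrank ℝ E - 1) N' = 0 :=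
    (mul_eq_zero.1 h0.symm).resolve_left hσ
  rw [Measure.volumeIoiPow, withDensity_apply_eq_zero' (by fun_prop)] at h1
  have h2 : (Measure.comap Subtype.val (volume : Measure ℝ)) N' = 0 := by
    refine measure_mono_null ?_ h1
    intro r hr
    refine ⟨?_, hr⟩
    have : (0 : ℝ) < r := r.2
    simp only [mem_ofPred_eq, ne_eq, ENNReal.ofReal_eq_zero, not_le]
    positivity
  rw [comap_subtype_coe_apply measurableSet_Ioi, Subtype.image_preimage_coe] at h2
  rwa [inter_comm]

/-- On the sphere of radius `r`, with `c = r h(r)`, the square of the norm is `‖a‖² + c² + 2 c ⟨a,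
y⟩ / ‖y‖`, an invertible affine function of the cosine of the angle. The preimage of a null set is
therefore a cone over a null set. -/
theorem volume_norm_add_radial_eq_zero {a : E} (ha : a ≠ 0) {h : ℝ → ℝ} (hh : Measurable h)
    {N : Set ℝ} (hNm : MeasurableSet N) (hN : volume N = 0) :
    volume {y : E | h ‖y‖ ≠ 0 ∧ ‖a + h ‖y‖ • y‖ ∈ N} = 0 := by
  refine volume_eq_zero_of_sphere_sections ?_ fun r hr => ?_
  · refine MeasurableSet.inter ?_ ?_
    · exact (measurableSet_singleton (0 : ℝ)).compl.preimage (f := fun y : E => h ‖y‖) (by fun_prop)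
    · exact hNm.preimage (f := fun y : E => ‖a + h ‖y‖ • y‖) (by fun_prop)
  by_cases h0 : h r = 0
  · refine measure_mono_null (t := ∅) ?_ measure_empty
    rintro y ⟨hy, hy', -⟩
    have : ‖r • ‖y‖⁻¹ • y‖ = r := by
      rw [norm_smul, norm_smul, norm_inv, norm_norm, inv_mul_cancel₀ (norm_ne_zero_iff.2 hy),
        mul_one, Real.norm_of_nonneg hr.le]
    rw [this] at hy'
    exact hy' h0
  · set c := h r * r
    have hc : c ≠ 0 := mul_ne_zero h0 hr.ne'
    have himg : volume ((fun s : ℝ => (s ^ 2 - ‖a‖ ^ 2 - c ^ 2) / (2 * c)) '' N) = 0 :=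
      addHaar_image_eq_zero_of_differentiableOn_of_addHaar_eq_zero _
        (by fun_prop) hN
    refine measure_mono_null ?_ (volume_cone_eq_zero ha himg)
    rintro y ⟨hy, hy', hy''⟩
    have hyn : ‖y‖ ≠ 0 := norm_ne_zero_iff.2 hy
    have hnr : ‖r • ‖y‖⁻¹ • y‖ = r := by
      rw [norm_smul, norm_smul, norm_inv, norm_norm, inv_mul_cancel₀ hyn,
        mul_one, Real.norm_of_nonneg hr.le]
    rw [hnr] at hy''
    refine ⟨_, hy'', ?_⟩
    simp only
    rw [norm_add_sq_real, inner_smul_right, inner_smul_right, inner_smul_right, norm_smul, hnr,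
      mul_pow, Real.norm_eq_abs, sq_abs]
    simp only [c] at hc ⊢
    field_simp
    ring

/-! ### Forces of radial form -/

/-- A field of central forces at `x`, proportional to the charges. -/
def centralForce (h : ℝ → ℝ) (x : E) (p : E × I) : E := ((p.2 : ℝ) * h ‖x - p.1‖) • (x - p.1)

theorem measurable_centralForce {h : ℝ → ℝ} (hh : Measurable h) (x : E) :
    Measurable (centralForce h x : E × I → E) := by
  unfold centralForce
  fun_prop

/-- The law of the force exerted by a single charged scatterer in the shell `a < ‖x - z‖ < b`,
multiplied by the expected number of such scatterers. -/
def shellForceLaw (μ : Measure I) (h : ℝ → ℝ) (x : E) (D : Set E) : Measure E :=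
  ((intensity μ).restrict (D ×ˢ {q : I | (q : ℝ) ≠ 0})).map (centralForce h x)

/-- The points at distance between `a` and `b` from `x`. -/
def shell (x : E) (a b : ℝ) : Set E := {z | a < ‖x - z‖ ∧ ‖x - z‖ < b}

theorem measurableSet_shell (x : E) (a b : ℝ) : MeasurableSet (shell x a b) :=
  (measurableSet_lt (f := fun _ : E => a) (g := fun z => ‖x - z‖) (by fun_prop)
    (by fun_prop)).inter
    (measurableSet_lt (f := fun z => ‖x - z‖) (g := fun _ : E => b) (by fun_prop) (by fun_prop))

theorem isBounded_shell (x : E) (a b : ℝ) : Bornology.IsBounded (shell x a b) :=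
  (Metric.isBounded_ball (x := x) (r := b)).subset fun z hz => by
    rw [Metric.mem_ball, dist_comm, dist_eq_norm]
    exact hz.2

theorem isFiniteMeasure_shellForceLaw (μ : Measure I) [IsProbabilityMeasure μ] (h : ℝ → ℝ) (x : E)
    {D : Set E} (hD : Bornology.IsBounded D) : IsFiniteMeasure (shellForceLaw μ h x D) := by
  have := isFiniteMeasure_intensity μ hD
  have : IsFiniteMeasure ((intensity μ).restrict (D ×ˢ {q : I | (q : ℝ) ≠ 0})) :=
    isFiniteMeasure_of_le _ (Measure.restrict_mono (prod_mono le_rfl (subset_univ _)) le_rfl)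
  exact Measure.isFiniteMeasure_map _ _

theorem measurePreserving_const_sub_linearIsometry (L : E ≃ₗᵢ[ℝ] E) (x : E) :
    MeasurePreserving (fun z : E => x - L (x - z)) :=
  (Measure.measurePreserving_sub_left volume x).comp
    (L.measurePreserving.comp (Measure.measurePreserving_sub_left volume x))

/-- Rotating the scatterers about `x` preserves the shell and the intensity and rotates the force.
-/
theorem isotropic_shellForceLaw (μ : Measure I) [IsProbabilityMeasure μ] {h : ℝ → ℝ}
    (hh : Measurable h) (x : E) (a b : ℝ) : Isotropic (shellForceLaw μ h x (shell x a b)) := by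
  intro L
  have hL := L.continuous.measurable
  have hmp : MeasurePreserving (Prod.map (fun z : E => x - L (x - z)) (id : I → I))
      (intensity μ) (intensity μ) :=
    (measurePreserving_const_sub_linearIsometry L x).prod (MeasurePreserving.id μ)
  have hpre : Prod.map (fun z : E => x - L (x - z)) (id : I → I) ⁻¹'
      (shell x a b ×ˢ {q : I | (q : ℝ) ≠ 0}) = shell x a b ×ˢ {q : I | (q : ℝ) ≠ 0} := by
    ext ⟨z, q⟩
    simp [shell, -map_sub]
  have hmp' := hmp.restrict_preimage
    ((measurableSet_shell x a b).prod (.of_discrete (s := {q : I | (q : ℝ) ≠ 0})))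
  rw [hpre] at hmp'
  rw [shellForceLaw, Measure.map_map hL (measurable_centralForce hh x)]
  conv_rhs => rw [← hmp'.map_eq]
  rw [Measure.map_map (measurable_centralForce hh x) hmp'.measurable]
  congr 1
  ext1 ⟨z, q⟩
  simp [centralForce, -map_sub]

theorem shellForceLaw_apply_norm_add_eq_zero (μ : Measure I) [IsProbabilityMeasure μ] {h : ℝ → ℝ}
    (hh : Measurable h) (x : E) {a b : ℝ} (hab : ∀ r, a < r → r < b → h r ≠ 0)
    {v : E} (hv : v ≠ 0) {N : Set ℝ} (hNm : MeasurableSet N) (hN : volume N = 0) :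
    shellForceLaw μ h x (shell x a b) {w | ‖v + w‖ ∈ N} = 0 := by
  have hm : MeasurableSet {w : E | ‖v + w‖ ∈ N} := hNm.preimage (by fun_prop)
  rw [shellForceLaw, Measure.map_apply (measurable_centralForce hh x) hm, Measure.restrict_apply
    (hm.preimage (measurable_centralForce hh x)), intensity]
  have hmeas := (hm.preimage (measurable_centralForce (I := I) hh x)).inter
    ((measurableSet_shell x a b).prod (.of_discrete (s := {q : I | (q : ℝ) ≠ 0})))
  rw [Measure.prod_apply_symm hmeas]
  refine (lintegral_congr fun q => ?_).trans lintegral_zero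
  by_cases hq : (q : ℝ) = 0
  · refine measure_mono_null (t := ∅) ?_ measure_empty
    rintro z ⟨-, -, hz⟩
    exact hz hq
  · have hnull := volume_norm_add_radial_eq_zero hv (h := fun r => (q : ℝ) * h r) (by fun_prop)
      hNm hN
    have hpres := (Measure.measurePreserving_sub_left (volume : Measure E) x).quasiMeasurePreserving
      |>.preimage_null hnull
    refine measure_mono_null ?_ hpres
    rintro z ⟨hz, ⟨hz1, hz2⟩, -⟩
    exact ⟨mul_ne_zero hq (hab _ hz1 hz2), hz⟩

theorem shellForceLaw_singleton_zero (μ : Measure I) [IsProbabilityMeasure μ] {h : ℝ → ℝ}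
    (hh : Measurable h) (x : E) {a b : ℝ} (ha : 0 ≤ a) (hab : ∀ r, a < r → r < b → h r ≠ 0) :
    shellForceLaw μ h x (shell x a b) {0} = 0 := by
  rw [shellForceLaw, Measure.map_apply (measurable_centralForce hh x) (measurableSet_singleton _),
    Measure.restrict_apply ((measurableSet_singleton _).preimage (measurable_centralForce hh x))]
  refine measure_mono_null (t := ∅) ?_ measure_empty
  rintro ⟨z, q⟩ ⟨hz, ⟨hz1, hz2⟩, hq⟩
  have h1 : ((q : ℝ) * h ‖x - z‖) • (x - z) = 0 := hz
  rcases smul_eq_zero.1 h1 with h2 | h2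
  · exact mul_ne_zero hq (hab _ hz1 hz2) h2
  · simp only [h2, norm_zero] at hz1
    exact absurd hz1 (not_lt.2 ha)

/-- One jump need not have a density: its length could be constant on the shell. For two jumps, fix
the first one `v ≠ 0`; the angle of the second then makes `‖v + w‖` avoid any null set. The sum is
isotropic with an absolutely continuous radial law, hence absolutely continuous. -/
theorem shellForceLaw_conv_absolutelyContinuous (μ : Measure I) [IsProbabilityMeasure μ]
    {h : ℝ → ℝ} (hh : Measurable h) (x : E) {a b : ℝ} (ha : 0 ≤ a)
    (hab : ∀ r, a < r → r < b → h r ≠ 0) :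
    (shellForceLaw μ h x (shell x a b)).conv (shellForceLaw μ h x (shell x a b)) ≪ volume := by
  have := isFiniteMeasure_shellForceLaw μ h x (isBounded_shell x a b)
  set ρ := shellForceLaw μ h x (shell x a b) with hρ
  have hiso := isotropic_shellForceLaw μ hh x a b
  refine (hiso.conv hiso).absolutelyContinuous (Measure.AbsolutelyContinuous.mk fun N hN h0 => ?_)
  rw [Measure.map_apply measurable_norm hN] at h0 ⊢
  -- The radial image of volume controls `N` only on positive reals; norms are nonnegative, and the
  -- single extra value zero is null.
  have hN' : volume (N ∩ Ici 0) = 0 := by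
    refine measure_mono_null (t := (N ∩ Ioi 0) ∪ {0}) ?_
      (measure_union_null (volume_inter_Ioi_eq_zero_of_norm hN h0) (by simp))
    rintro r ⟨hr, hr0⟩
    rcases (mem_Ici.1 hr0).eq_or_lt with h | h
    · exact .inr h.symm
    · exact .inl ⟨hr, h⟩
  have hm : MeasurableSet ((norm : E → ℝ) ⁻¹' N) := measurable_norm hN
  rw [← lintegral_indicator_one hm, Measure.lintegral_conv (measurable_one.indicator hm)]
  rw [← hρ]
  have hz : ∀ᵐ v ∂ρ, v ≠ 0 := by
    rw [ae_iff]
    simpa using shellForceLaw_singleton_zero μ hh x ha hab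
  refine (lintegral_congr_ae ?_).trans lintegral_zero
  filter_upwards [hz] with v hv
  have h1 : ∀ w : E, ((norm : E → ℝ) ⁻¹' N).indicator (1 : E → ENNReal) (v + w) =
      ((fun w : E => ‖v + w‖) ⁻¹' (N ∩ Ici 0)).indicator 1 w := by
    intro w
    have hs : (fun w : E => ‖v + w‖) ⁻¹' (N ∩ Ici 0) =
        (fun w => v + w) ⁻¹' ((norm : E → ℝ) ⁻¹' N) := by
      ext w
      simp
    rw [hs]
    rfl
  simp_rw [h1]
  rw [lintegral_indicator_one ((hN.inter measurableSet_Ici).preimage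
    (f := fun w : E => ‖v + w‖) (by fun_prop))]
  exact shellForceLaw_apply_norm_add_eq_zero μ hh x hab hv (hN.inter measurableSet_Ici) hN'

/-! ### Compound Poisson laws -/

/-- Convolution powers of a measure. -/
def convPow (ρ : Measure E) : ℕ → Measure E
  | 0 => Measure.dirac 0
  | n + 1 => (convPow ρ n).conv ρ

instance (ρ : Measure E) [IsFiniteMeasure ρ] (n : ℕ) : IsFiniteMeasure (convPow ρ n) := by
  induction n with
  | zero => exact inferInstanceAs (IsFiniteMeasure (Measure.dirac (0 : E)))
  | succ n ih => exact inferInstanceAs (IsFiniteMeasure ((convPow ρ n).conv ρ))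

theorem charFun_convPow (ρ : Measure E) [IsFiniteMeasure ρ] (n : ℕ) (t : E) :
    MeasureTheory.charFun (convPow ρ n) t = MeasureTheory.charFun ρ t ^ n := by
  induction n with
  | zero => simp [convPow, MeasureTheory.charFun_apply]
  | succ n ih => rw [convPow, charFun_conv, ih, pow_succ]

theorem convPow_univ (ρ : Measure E) [IsFiniteMeasure ρ] (n : ℕ) :
    convPow ρ n univ = ρ univ ^ n := by
  induction n with
  | zero => simp [convPow]
  | succ n ih =>
    rw [convPow, ← lintegral_one, Measure.lintegral_conv measurable_const, pow_succ, ← ih]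
    simp [mul_comm]

theorem convPow_absolutelyContinuous {ρ : Measure E} [IsFiniteMeasure ρ]
    (h : ρ.conv ρ ≪ volume) (n : ℕ) : convPow ρ (n + 2) ≪ volume := by
  rw [convPow, convPow, Measure.conv_assoc]
  exact Measure.conv_absolutelyContinuous h

/-- The part of the compound Poisson law with at most one jump. -/
def fewJumps (ρ : Measure E) : Measure E :=
  ENNReal.ofReal (Real.exp (-ρ.real univ)) • (Measure.dirac 0 + ρ)

/-- The part of the compound Poisson law with at least two jumps. -/
def manyJumps (ρ : Measure E) : Measure E :=
  Measure.sum fun n : ℕ =>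
    ENNReal.ofReal (Real.exp (-ρ.real univ) / (n + 2).factorial) • convPow ρ (n + 2)

theorem fewJumps_univ (ρ : Measure E) [IsFiniteMeasure ρ] :
    fewJumps ρ univ = ENNReal.ofReal (Real.exp (-ρ.real univ) * (1 + ρ.real univ)) := by
  rw [ENNReal.ofReal_mul (Real.exp_pos _).le, ENNReal.ofReal_add zero_le_one measureReal_nonneg]
  simp [fewJumps, mul_add]

theorem manyJumps_absolutelyContinuous {ρ : Measure E} [IsFiniteMeasure ρ]
    (h : ρ.conv ρ ≪ volume) : manyJumps ρ ≪ volume :=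
  Measure.absolutelyContinuous_sum_left fun n =>
    (convPow_absolutelyContinuous h n).smul_left _

instance (ρ : Measure E) [IsFiniteMeasure ρ] : IsFiniteMeasure (fewJumps ρ) :=
  ⟨by rw [fewJumps_univ]; exact ENNReal.ofReal_lt_top⟩

instance (ρ : Measure E) [IsFiniteMeasure ρ] : IsFiniteMeasure (manyJumps ρ) := by
  refine ⟨?_⟩
  have h : ∀ n : ℕ, (ENNReal.ofReal (Real.exp (-ρ.real univ) / (n + 2).factorial) •
      convPow ρ (n + 2)) univ = ENNReal.ofReal (Real.exp (-ρ.real univ) *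
        (ρ.real univ ^ (n + 2) / (n + 2).factorial)) := by
    intro n
    rw [Measure.smul_apply, convPow_univ, smul_eq_mul, ← ofReal_measureReal,
      ← ENNReal.ofReal_pow measureReal_nonneg, ← ENNReal.ofReal_mul (by positivity)]
    congr 1
    ring
  rw [manyJumps, Measure.sum_apply _ .univ]
  simp_rw [h]
  have hs : Summable fun n : ℕ => Real.exp (-ρ.real univ) *
      (ρ.real univ ^ (n + 2) / (n + 2).factorial) :=
    ((summable_nat_add_iff 2).2 (Real.summable_pow_div_factorial (ρ.real univ))).mul_left _
  rw [← ENNReal.ofReal_tsum_of_nonneg (fun n => by positivity) hs]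
  exact ENNReal.ofReal_lt_top

/-- Convolution powers become powers of the characteristic function, and the exponential series is
cut after its first two terms. -/
theorem charFun_compoundPoisson (ρ : Measure E) [IsFiniteMeasure ρ] (t : E) :
    MeasureTheory.charFun (fewJumps ρ + manyJumps ρ) t =
      Complex.exp (MeasureTheory.charFun ρ t - ρ.real univ) := by
  have hint : ∀ (σ : Measure E) [IsFiniteMeasure σ],
      Integrable (fun x => Complex.exp ((inner ℝ x t : ℂ) * Complex.I)) σ := fun σ _ =>
    Integrable.of_bound (C := 1) (by fun_prop) (.of_forall fun ω => by
        rw [Complex.norm_exp_ofReal_mul_I])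
  set c := Real.exp (-ρ.real univ)
  set z := MeasureTheory.charFun ρ t
  have h1 : MeasureTheory.charFun (fewJumps ρ) t = c * (1 + z) := by
    rw [MeasureTheory.charFun_apply, fewJumps, integral_smul_measure,
      integral_add_measure (hint _) (hint _), ENNReal.toReal_ofReal (Real.exp_pos _).le]
    simp [z, MeasureTheory.charFun_apply, c, mul_add]
  have h2 : HasSum (fun n : ℕ => (c : ℂ) * (z ^ (n + 2) / (n + 2).factorial))
      (MeasureTheory.charFun (manyJumps ρ) t) := by
    rw [MeasureTheory.charFun_apply]
    have h3 := hasSum_integral_measure (hint (manyJumps ρ))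
    have h4 : (fun n : ℕ => (c : ℂ) * (z ^ (n + 2) / (n + 2).factorial)) = fun n =>
        ∫ x, Complex.exp ((inner ℝ x t : ℂ) * Complex.I) ∂(ENNReal.ofReal
          (Real.exp (-ρ.real univ) / (n + 2).factorial) • convPow ρ (n + 2)) := funext fun n => ?_
    · rw [h4]
      exact h3
    rw [integral_smul_measure, ← MeasureTheory.charFun_apply, charFun_convPow,
      ENNReal.toReal_ofReal (by positivity), Complex.real_smul]
    simp only [c, z]
    push_cast
    ring
  have h4 : HasSum (fun n : ℕ => (c : ℂ) * (z ^ n / n.factorial)) (c * Complex.exp z) := by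
    have := NormedSpace.expSeries_div_hasSum_exp z
    rw [← Complex.exp_eq_exp_ℂ] at this
    exact this.mul_left _
  have h5 := (hasSum_nat_add_iff' 2).2 h4
  have h6 := h2.unique h5
  rw [Finset.sum_range_succ, Finset.sum_range_one] at h6
  have h7 : MeasureTheory.charFun (fewJumps ρ + manyJumps ρ) t =
      MeasureTheory.charFun (fewJumps ρ) t + MeasureTheory.charFun (manyJumps ρ) t := by
    simp only [MeasureTheory.charFun_apply]
    exact integral_add_measure (hint _) (hint _)
  have h8 : Complex.exp (z - ρ.real univ) = c * Complex.exp z := by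
    rw [Complex.exp_sub, Complex.ofReal_exp, Complex.ofReal_neg, Complex.exp_neg]
    field_simp
  rw [h7, h6, h1, h8]
  simp
  ring

/-! ### Smoothing by absolutely continuous measures -/

/-- `W` has a density in `L¹`, and translations act continuously on `L¹`. No regularity of `S` is
used. -/
theorem continuous_measureReal_translate {W : Measure E} [IsFiniteMeasure W] (hW : W ≪ volume)
    {S : Set E} (hS : MeasurableSet S) : Continuous fun h : E => W.real {z | z + h ∈ S} := by
  set g : E → ℝ := fun z => (W.rnDeriv volume z).toReal
  have hg : Integrable g := Measure.integrable_toReal_rnDeriv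
  have hgm : MemLp g 1 volume := memLp_one_iff_integrable.2 hg
  have : Fact ((1 : ENNReal) ≠ ⊤) := ⟨ENNReal.one_ne_top⟩
  have hcont : Continuous fun h : E =>
      ∫ z in S, (DomAddAct.mk (-h) +ᵥ hgm.toLp : Lp ℝ 1 (volume : Measure E)) z := by
    have h1 : Continuous fun f : Lp ℝ 1 (volume : Measure E) => ∫ z in S, f z :=
      continuous_setIntegral S
    refine h1.comp ?_
    have h2 : Continuous fun h : E => DomAddAct.mk (-h) :=
      DomAddAct.continuous_mk.comp continuous_neg
    exact h2.vadd continuous_const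
  refine hcont.congr fun h => ?_
  have hae : (DomAddAct.mk (-h) +ᵥ hgm.toLp : Lp ℝ 1 (volume : Measure E)) =ᵐ[volume]
      fun z => g (-h + z) := by
    have h1 : (DomAddAct.mk (-h) +ᵥ hgm.toLp : Lp ℝ 1 (volume : Measure E)) =
      Lp.compMeasurePreserving (-h +ᵥ ·) (measurePreserving_vadd (-h) volume) hgm.toLp := rfl
    rw [h1]
    refine (Lp.coeFn_compMeasurePreserving _ _).trans ?_
    exact (measurePreserving_vadd (-h) volume).quasiMeasurePreserving.ae_eq_comp hgm.coeFn_toLp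
  rw [setIntegral_congr_ae hS (hae.mono fun z hz _ => hz)]
  have hT : MeasurableSet {z : E | z + h ∈ S} := hS.preimage (by fun_prop)
  rw [← Measure.setIntegral_toReal_rnDeriv hW {z : E | z + h ∈ S}, ← integral_indicator hS,
    ← integral_indicator hT, ← integral_add_right_eq_self _ h]
  refine integral_congr_ae (.of_forall fun z => ?_)
  simp only [indicator, mem_ofPred_eq, g]
  congr 3
  abel

/-- The hypothesis says that the laws are convolutions of a common measure `W₁ + W₂` with the laws
of `H R` and `H'`. The part with `W₁` has mass at most `ε`; the part with `W₂` is the expectation of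
a bounded continuous function of `H R`, so convergence in distribution suffices for it, for an
arbitrary Borel set. -/
theorem tendsto_measure_preimage_of_charFun_mul {Ω : Type*} [MeasurableSpace Ω] {P : Measure Ω}
    [IsProbabilityMeasure P] {G : ℝ → Ω → E} {F : Ω → E}
    (hG : ∀ᶠ R in atTop, Measurable (G R)) (hF : Measurable F)
    (h : ∀ ε : ℝ, 0 < ε → ∃ (W₁ W₂ : Measure E) (H : ℝ → Ω → E) (H' : Ω → E),
      IsFiniteMeasure W₁ ∧ IsFiniteMeasure W₂ ∧ W₁ univ ≤ ENNReal.ofReal ε ∧ W₂ ≪ volume ∧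
      (∀ᶠ R in atTop, Measurable (H R)) ∧ Measurable H' ∧
      Tendsto (fun R => eLpNorm (H R - H') 1 P) atTop (𝓝 0) ∧
      (∀ᶠ R in atTop, ∀ t, MeasureTheory.charFun (P.map (G R)) t =
        MeasureTheory.charFun (W₁ + W₂) t * MeasureTheory.charFun (P.map (H R)) t) ∧
      ∀ t, MeasureTheory.charFun (P.map F) t =
        MeasureTheory.charFun (W₁ + W₂) t * MeasureTheory.charFun (P.map H') t)
    {S : Set E} (hS : MeasurableSet S) :
    Tendsto (fun R => P (G R ⁻¹' S)) atTop (𝓝 (P (F ⁻¹' S))) := by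
  have key : Tendsto (fun R => P.real (G R ⁻¹' S)) atTop (𝓝 (P.real (F ⁻¹' S))) := by
    rw [Metric.tendsto_nhds]
    intro ε hε
    obtain ⟨W₁, W₂, H, H', _, _, hW₁, hW₂, hH, hH', hlim, hGH, hFH⟩ := h (ε / 4) (by positivity)
    set φ : E → ℝ := fun h => W₂.real {z | z + h ∈ S}
    have hφ : Continuous φ := continuous_measureReal_translate hW₂ hS
    have hsplit : ∀ (X Y : Ω → E), Measurable X → Measurable Y →
        (∀ t, MeasureTheory.charFun (P.map X) t =
          MeasureTheory.charFun (W₁ + W₂) t * MeasureTheory.charFun (P.map Y) t) →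
        ∃ r : ℝ, 0 ≤ r ∧ r ≤ ε / 4 ∧ P.real (X ⁻¹' S) = r + ∫ ω, φ (Y ω) ∂P := by
      intro X Y hX hY hXY
      have : IsProbabilityMeasure (P.map X) := Measure.isProbabilityMeasure_map hX.aemeasurable
      have : IsProbabilityMeasure (P.map Y) := Measure.isProbabilityMeasure_map hY.aemeasurable
      have heq : P.map X = (P.map Y).conv W₁ + (P.map Y).conv W₂ := by
        rw [← Measure.conv_add]
        refine Measure.ext_of_charFun (funext fun t => ?_)
        rw [hXY, charFun_conv, mul_comm]
      have hconv : ∀ (W : Measure E) [IsFiniteMeasure W], (P.map Y).conv W S =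
          ∫⁻ ω, W {z | z + Y ω ∈ S} ∂P := by
        intro W _
        have h1 : ∀ y : E, ∫⁻ z, S.indicator (1 : E → ENNReal) (y + z) ∂W = W {z | z + y ∈ S} := by
          intro y
          have hT : MeasurableSet {z : E | z + y ∈ S} := hS.preimage (f := fun z => z + y) (by fun_prop)
          rw [← lintegral_indicator_one hT]
          refine lintegral_congr fun z => ?_
          rw [add_comm]
          rfl
        rw [← lintegral_indicator_one hS, Measure.lintegral_conv (measurable_one.indicator hS),
          lintegral_map _ hY]
        · simp_rw [h1]
        · exact (measurable_one.indicator hS).comp measurable_add |>.lintegral_prod_right'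
      refine ⟨((P.map Y).conv W₁).real S, measureReal_nonneg, ?_, ?_⟩
      · refine ENNReal.toReal_le_of_le_ofReal (by positivity) ?_
        rw [hconv]
        calc ∫⁻ ω, W₁ {z | z + Y ω ∈ S} ∂P ≤ ∫⁻ _, ENNReal.ofReal (ε / 4) ∂P :=
              lintegral_mono fun ω => (measure_mono (subset_univ _)).trans hW₁
          _ = _ := by simp
      · rw [← map_measureReal_apply hX hS, heq, measureReal_add_apply]
        congr 1
        rw [measureReal_def, hconv, integral_eq_lintegral_of_nonneg_ae
          (.of_forall fun ω => measureReal_nonneg)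
          (hφ.measurable.comp hY).aestronglyMeasurable]
        congr 1
        refine lintegral_congr fun ω => ?_
        exact (ofReal_measureReal (measure_ne_top _ _)).symm
    have hφlim : Tendsto (fun R => ∫ ω, φ (H R ω) ∂P) atTop (𝓝 (∫ ω, φ (H' ω) ∂P)) := by
      obtain ⟨R₀, hR₀⟩ := eventually_atTop.1 hH
      -- Measurability holds only for large `R`; freezing the index below `R₀` makes it hold for
      -- all.
      set H₁ : ℝ → Ω → E := fun R => H (max R R₀)
      have hH₁ : ∀ R, Measurable (H₁ R) := fun R => hR₀ _ (le_max_right _ _)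
      have hev : ∀ᶠ R in atTop, H R = H₁ R := by
        filter_upwards [eventually_ge_atTop R₀] with R hR
        simp only [H₁, max_eq_left hR]
      have hlim₁ : Tendsto (fun R => eLpNorm (H₁ R - H') 1 P) atTop (𝓝 0) :=
        hlim.congr' (hev.mono fun R hR => by rw [hR])
      have hd := (tendstoInMeasure_of_tendsto_eLpNorm one_ne_zero
        (fun R => (hH₁ R).aestronglyMeasurable) hH'.aestronglyMeasurable
        hlim₁).tendstoInDistribution fun R => (hH₁ R).aemeasurable
      have hd' := (ProbabilityMeasure.tendsto_iff_forall_integral_tendsto.1 hd.tendsto)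
        (BoundedContinuousFunction.ofNormedAddCommGroup φ hφ (W₂.real univ) fun x => by
          rw [Real.norm_of_nonneg measureReal_nonneg]
          exact measureReal_mono (subset_univ _))
      simp only [ProbabilityMeasure.coe_mk, BoundedContinuousFunction.coe_ofNormedAddCommGroup]
        at hd'
      rw [integral_map hH'.aemeasurable hφ.aestronglyMeasurable] at hd'
      refine hd'.congr' (hev.mono fun R hR => ?_)
      change _ = ∫ ω, φ (H R ω) ∂P
      rw [hR]
      exact integral_map (hH₁ R).aemeasurable hφ.aestronglyMeasurable
    obtain ⟨r', hr'0, hr', hF'⟩ := hsplit F H' hF hH' hFH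
    filter_upwards [hG, hH, hGH, (Metric.tendsto_nhds.1 hφlim) (ε / 4) (by positivity)]
      with R hGR hHR hGHR hφR
    obtain ⟨r, hr0, hr, hG'⟩ := hsplit (G R) (H R) hGR hHR hGHR
    rw [hG', hF', Real.dist_eq]
    rw [Real.dist_eq, abs_lt] at hφR
    rw [abs_lt]
    constructor <;> linarith [hφR.1, hφR.2]
  have h1 := ENNReal.tendsto_ofReal key
  simpa only [ofReal_measureReal (measure_ne_top P _)] using h1

open ChargedConfiguration

/-! ### Sums over all scatterers -/

theorem Exhausts.eventually_subset {D : ℝ → Set E} (hD : Exhausts D) {K : Set E}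
    (hK : Bornology.IsBounded K) : ∀ᶠ R in atTop, K ⊆ D R := by
  obtain ⟨r, hr⟩ := hK.subset_ball (0 : E)
  exact (hD.ball_subset r).mono fun R h => hr.trans h

theorem exhausts_ball : Exhausts (fun R => Metric.ball (0 : E) R) where
  isBounded _ _ := Metric.isBounded_ball
  measurableSet _ _ := Metric.isOpen_ball.measurableSet
  ball_subset ρ := (eventually_ge_atTop ρ).mono fun _ h => Metric.ball_subset_ball h

/-- The scatterers in `K` are summed without centring, because `f` may fail to be integrable there;
only the square integrable part outside `K` is compensated. The expectation exists under the extra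
hypothesis of integrability on `K`. -/
theorem IsScattererDistribution.exists_totalSum {μ : Measure I} [IsProbabilityMeasure μ]
    {P : Measure (ChargedConfiguration I)} [IsProbabilityMeasure P]
    (hP : IsScattererDistribution μ P) {K : Set E} (hK : Bornology.IsBounded K)
    (hKm : MeasurableSet K) {f : E × I → E} (hf : Measurable f)
    (hf2 : Integrable (fun p => ‖(Kᶜ ×ˢ univ).indicator f p‖ ^ 2) (intensity μ)) :
    ∃ F : ChargedConfiguration I → E, Measurable F ∧
      (IntegrableOn f (K ×ˢ univ) (intensity μ) →
        Integrable F P ∧ ∫ ω, F ω ∂P = ∫ p in K ×ˢ univ, f p ∂(intensity μ)) ∧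
      ∀ D : ℝ → Set E, Exhausts D →
        Tendsto (fun R => eLpNorm (fun ω => cloudSum (D R) f ω -
          ∫ p in D R ×ˢ univ, (Kᶜ ×ˢ univ).indicator f p ∂(intensity μ) - F ω) 1 P) atTop (𝓝 0) := by
  obtain ⟨L, hLm, hLi, hL0, hL⟩ := hP.exists_limit_centredSum
    (hf.indicator (hKm.compl.prod .univ)) hf2
  refine ⟨fun ω => cloudSum K f ω + L ω, (measurable_cloudSum hK hKm hf).add hLm, fun hi => ?_,
    fun D hD => ?_⟩
  · have h1 := hP.integrable_cloudSum hK hKm hf hi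
    exact ⟨h1.add hLi, by rw [integral_add h1 hLi, hL0, add_zero, hP.integral_cloudSum hK hKm hf hi]⟩
  · refine (hL D hD).congr' ?_
    filter_upwards [hD.eventually_subset hK, eventually_gt_atTop 0] with R hR hR0
    congr 1
    ext1 ω
    simp only [Pi.sub_apply, centredSum]
    rw [cloudSum_indicator hKm.compl, ← sdiff_eq,
      cloudSum_diff (hD.isBounded R hR0) (hD.measurableSet R hR0) hKm hR]
    abel

/-! ### Convergence of characteristic functions -/

theorem tendsto_charFun_of_eLpNorm {Ω : Type*} [MeasurableSpace Ω] {P : Measure Ω}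
    [IsProbabilityMeasure P] {G : ℝ → E → Ω → E} {F : E → Ω → E}
    (hG : ∀ᶠ R in atTop, ∀ x, Measurable (G R x)) (hF : ∀ x, Measurable (F x))
    (h : ∀ x, Tendsto (fun R => eLpNorm (G R x - F x) 1 P) atTop (𝓝 0)) {J : ℕ} (η y : Fin J → E) :
    Tendsto (fun R => charFun P (G R) η y) atTop (𝓝 (charFun P F η y)) := by
  unfold charFun
  simp_rw [mul_comm Complex.I]
  refine tendsto_integral_exp_of_tendsto_eLpNorm (Y := fun R ω => ∑ k, inner ℝ (η k) (G R (y k) ω))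
    (Z := fun ω => ∑ k, inner ℝ (η k) (F (y k) ω)) ?_ ?_ ?_
  · filter_upwards [hG] with R hR
    exact Finset.measurable_fun_sum _ fun k _ => (hR _).const_inner
  · exact Finset.measurable_fun_sum _ fun k _ => (hF _).const_inner
  · have hlim : Tendsto (fun R => ∑ k, ENNReal.ofReal ‖η k‖ * eLpNorm (G R (y k) - F (y k)) 1 P)
        atTop (𝓝 (∑ k : Fin J, ENNReal.ofReal ‖η k‖ * 0)) :=
      tendsto_finsetSum _ fun k _ => ENNReal.Tendsto.const_mul (h _) (.inr ENNReal.ofReal_ne_top)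
    simp only [mul_zero, Finset.sum_const_zero] at hlim
    refine tendsto_of_tendsto_of_tendsto_of_le_of_le' tendsto_const_nhds hlim
      (.of_forall fun _ => zero_le) ?_
    filter_upwards [hG] with R hR
    have h1 : (fun ω => ∑ k, inner ℝ (η k) (G R (y k) ω)) - (fun ω => ∑ k, inner ℝ (η k) (F (y k) ω))
        = ∑ k, fun ω => inner ℝ (η k) ((G R (y k) - F (y k)) ω) := by
      ext ω
      simp [inner_sub_right]
    rw [h1]
    refine (eLpNorm_sum_le (fun k _ => (((hR _).sub (hF _)).const_inner).aestronglyMeasurable)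
      le_rfl).trans (Finset.sum_le_sum fun k _ => ?_)
    refine eLpNorm_le_mul_eLpNorm_of_ae_le_mul (.of_forall fun ω => norm_inner_le_norm _ _) 1

theorem charFun_map_eq {Ω : Type*} [MeasurableSpace Ω] {P : Measure Ω} {X : Ω → E}
    (hX : Measurable X) (t : E) : MeasureTheory.charFun (P.map X) t =
      charFun P (fun _ => X) (fun _ : Fin 1 => t) (fun _ => 0) := by
  rw [MeasureTheory.charFun_apply, integral_map hX.aemeasurable (by fun_prop)]
  simp [charFun, mul_comm, real_inner_comm]

theorem IsScattererDistribution.charFun_cloudSum_add {μ : Measure I} [IsProbabilityMeasure μ]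
    {P : Measure (ChargedConfiguration I)} [IsProbabilityMeasure P]
    (hP : IsScattererDistribution μ P) {D : Set E} (hD : Bornology.IsBounded D)
    (hDm : MeasurableSet D) {f : E → E × I → E} (hf : ∀ x, Measurable (f x)) (c : E → E) {J : ℕ}
    (η y : Fin J → E) :
    charFun P (fun x ω => cloudSum D (f x) ω + c x) η y =
      Complex.exp (Complex.I * ((∑ k, inner ℝ (η k) (c (y k)) : ℝ) : ℂ)) *
        Complex.exp (∫ p in D ×ˢ univ, (Complex.exp
          (((∑ k, inner ℝ (η k) (f (y k) p) : ℝ) : ℂ) * Complex.I) - 1) ∂(intensity μ)) := by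
  rw [← hP.charFun_cloudSum hD hDm (Finset.measurable_fun_sum _ fun k _ => (hf _).const_inner),
    ← integral_const_mul, charFun]
  refine integral_congr_ae (.of_forall fun ω => ?_)
  simp only
  rw [← Complex.exp_add]
  congr 1
  have h1 : cloudSum D (fun p => ∑ k, inner ℝ (η k) (f (y k) p)) ω =
      ∑ k, inner ℝ (η k) (cloudSum D (f (y k)) ω) := by
    simp_rw [inner_cloudSum hD hDm]
    exact integral_finsetSum _ fun k _ => ω.integrableOn_pointMeasure hD hDm _
  rw [h1]
  simp_rw [inner_add_right, Finset.sum_add_distrib]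
  push_cast
  ring

/-- On `B` the intensity is finite, the exponential is bounded and `g` is integrable; off `B` the
two functions agree and the integrand is quadratic. -/
theorem integrable_exp_sub_one_sub_of_eqOn {μ : Measure I} [IsProbabilityMeasure μ] {B : Set E}
    (hB : Bornology.IsBounded B) (hBm : MeasurableSet B) {f g : E × I → ℝ} (hf : Measurable f)
    (hg : Measurable g) (hg2 : Integrable (fun p => g p ^ 2) (intensity μ))
    (h : ∀ p ∉ B ×ˢ univ, f p = g p) :
    Integrable (fun p => Complex.exp (f p * Complex.I) - 1 - g p * Complex.I) (intensity μ) := by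
  have := isFiniteMeasure_intensity μ hB
  have hT : MeasurableSet (B ×ˢ (univ : Set I)) := hBm.prod .univ
  rw [← integrableOn_univ, ← union_compl_self (B ×ˢ (univ : Set I))]
  refine IntegrableOn.union ?_ ?_
  · refine Integrable.sub (Integrable.of_bound (C := 2) (by fun_prop) (.of_forall fun p => ?_)) ?_
    · refine (norm_sub_le _ _).trans ?_
      rw [Complex.norm_exp_ofReal_mul_I, norm_one]
      norm_num
    · exact ((integrable_of_integrable_sq hg.aestronglyMeasurable
        hg2.integrableOn).ofReal).mul_const _
  · exact ((integrable_exp_sub_one_sub hg hg2).integrableOn).congr_fun (fun p hp => by simp [h p hp])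
      hT.compl

theorem integrable_exp_sum_sub_one_sub {μ : Measure I} [IsProbabilityMeasure μ] {K : E → Set E}
    (hK : ∀ x, Bornology.IsBounded (K x))
    (hKm : ∀ x, MeasurableSet (K x)) {f : E → E × I → E} (hf : ∀ x, Measurable (f x))
    (hf2 : ∀ x, Integrable (fun p => ‖((K x)ᶜ ×ˢ univ).indicator (f x) p‖ ^ 2) (intensity μ))
    {J : ℕ} (η y : Fin J → E) :
    Integrable (fun p => (∑ k, inner ℝ (η k) (((K (y k))ᶜ ×ˢ univ).indicator (f (y k)) p)) ^ 2)
        (intensity μ) ∧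
    Integrable (fun p => Complex.exp (((∑ k, inner ℝ (η k) (f (y k) p) : ℝ) : ℂ) * Complex.I) - 1 -
        ((∑ k, inner ℝ (η k) (((K (y k))ᶜ ×ˢ univ).indicator (f (y k)) p) : ℝ) : ℂ) * Complex.I)
        (intensity μ) := by
  set g : E → E × I → E := fun x => ((K x)ᶜ ×ˢ univ).indicator (f x)
  have hgm : ∀ x, Measurable (g x) := fun x => (hf x).indicator ((hKm x).compl.prod .univ)
  set φ : E × I → ℝ := fun p => ∑ k, inner ℝ (η k) (f (y k) p)
  set γ : E × I → ℝ := fun p => ∑ k, inner ℝ (η k) (g (y k) p)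
  have hφ : Measurable φ := Finset.measurable_fun_sum _ fun k _ => (hf _).const_inner
  have hγ : Measurable γ := Finset.measurable_fun_sum _ fun k _ => (hgm _).const_inner
  have hγ2 : Integrable (fun p => γ p ^ 2) (intensity μ) := by
    have h1 : ∀ k, MemLp (fun p => inner ℝ (η k) (g (y k) p)) 2 (intensity μ) := fun k =>
      ((memLp_two_iff_integrable_sq_norm (hgm _).aestronglyMeasurable).2 (hf2 (y k))).const_inner _
    exact (memLp_finsetSum _ fun k _ => h1 k).integrable_sq
  have hBb : Bornology.IsBounded (⋃ k, K (y k)) := Bornology.isBounded_iUnion.2 fun k => hK _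
  have hBm : MeasurableSet (⋃ k, K (y k)) := MeasurableSet.iUnion fun k => hKm _
  have hout : ∀ p ∉ (⋃ k, K (y k)) ×ˢ univ, φ p = γ p := by
    intro p hp
    refine Finset.sum_congr rfl fun k _ => ?_
    congr 1
    refine (indicator_of_mem ?_ _).symm
    refine ⟨fun hk => hp ⟨mem_iUnion.2 ⟨k, hk⟩, mem_univ _⟩, mem_univ _⟩
  exact ⟨hγ2, integrable_exp_sub_one_sub_of_eqOn hBb hBm hφ hγ hγ2 hout⟩

/-- On a ball, subtracting the mean of the far part multiplies the characteristic function by a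
phase, which is the compensator of the exponent. Letting the ball grow, the left side converges by
convergence in mean, the right side because the compensated exponent is integrable. -/
theorem IsScattererDistribution.charFun_totalSum {μ : Measure I} [IsProbabilityMeasure μ]
    {P : Measure (ChargedConfiguration I)} [IsProbabilityMeasure P]
    (hP : IsScattererDistribution μ P) {K : E → Set E} (hK : ∀ x, Bornology.IsBounded (K x))
    (hKm : ∀ x, MeasurableSet (K x)) {f : E → E × I → E} (hf : ∀ x, Measurable (f x))
    (hf2 : ∀ x, Integrable (fun p => ‖((K x)ᶜ ×ˢ univ).indicator (f x) p‖ ^ 2) (intensity μ))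
    {F : E → ChargedConfiguration I → E} (hFm : ∀ x, Measurable (F x))
    (hF : ∀ x, ∀ D : ℝ → Set E, Exhausts D →
        Tendsto (fun R => eLpNorm (fun ω => cloudSum (D R) (f x) ω -
          ∫ p in D R ×ˢ univ, ((K x)ᶜ ×ˢ univ).indicator (f x) p ∂(intensity μ) - F x ω) 1 P)
          atTop (𝓝 0)) (M : E → E) {J : ℕ} (η y : Fin J → E) :
    charFun P (fun x ω => F x ω + M x) η y =
      Complex.exp (Complex.I * ((∑ k, inner ℝ (η k) (M (y k)) : ℝ) : ℂ)) *
        Complex.exp (∫ p, (Complex.exp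
          (((∑ k, inner ℝ (η k) (f (y k) p) : ℝ) : ℂ) * Complex.I) - 1 -
          ((∑ k, inner ℝ (η k) (((K (y k))ᶜ ×ˢ univ).indicator (f (y k)) p) : ℝ) : ℂ) * Complex.I)
          ∂(intensity μ)) := by
  set g : E → E × I → E := fun x => ((K x)ᶜ ×ˢ univ).indicator (f x)
  have hgm : ∀ x, Measurable (g x) := fun x => (hf x).indicator ((hKm x).compl.prod .univ)
  set φ : E × I → ℝ := fun p => ∑ k, inner ℝ (η k) (f (y k) p)
  set γ : E × I → ℝ := fun p => ∑ k, inner ℝ (η k) (g (y k) p)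
  have hφ : Measurable φ := Finset.measurable_fun_sum _ fun k _ => (hf _).const_inner
  have hγ : Measurable γ := Finset.measurable_fun_sum _ fun k _ => (hgm _).const_inner
  obtain ⟨hγ2, hint⟩ := integrable_exp_sum_sub_one_sub hK hKm hf hf2 η y
  set D : ℝ → Set E := fun R => Metric.ball (0 : E) R
  have hD : Exhausts D := exhausts_ball
  set c : ℝ → E → E := fun R x => M x - ∫ p in D R ×ˢ univ, g x p ∂(intensity μ)
  have hlim := tendsto_charFun_of_eLpNorm (P := P)
    (G := fun R x ω => cloudSum (D R) (f x) ω + c R x) (F := fun x ω => F x ω + M x)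
    (by filter_upwards [eventually_gt_atTop 0] with R hR x
        exact (measurable_cloudSum (hD.isBounded R hR) (hD.measurableSet R hR) (hf x)).add_const _)
    (fun x => (hFm x).add_const _)
    (fun x => by
      refine (hF x D hD).congr fun R => ?_
      congr 1
      ext1 ω
      simp only [Pi.sub_apply, c]
      abel) η y
  refine tendsto_nhds_unique hlim ?_
  have hset : Tendsto (fun R => ∫ p in D R ×ˢ univ, (Complex.exp (φ p * Complex.I) - 1 -
      γ p * Complex.I) ∂(intensity μ)) atTop
      (𝓝 (∫ p, (Complex.exp (φ p * Complex.I) - 1 - γ p * Complex.I) ∂(intensity μ))) := by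
    refine AECover.integral_tendsto_of_countably_generated (φ := fun R => D R ×ˢ univ) ⟨?_, ?_⟩ hint
    · refine .of_forall fun p => ?_
      filter_upwards [eventually_gt_atTop ‖p.1‖] with R hR
      simpa [D] using hR
    · exact fun R => (Metric.isOpen_ball.measurableSet).prod .univ
  refine ((Complex.continuous_exp.tendsto _).comp hset |>.const_mul _).congr' ?_
  filter_upwards [eventually_gt_atTop 0] with R hR
  have hDb := hD.isBounded R hR
  have := isFiniteMeasure_intensity μ hDb
  rw [hP.charFun_cloudSum_add hDb (hD.measurableSet R hR) hf (c R)]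
  have hγi : IntegrableOn γ (D R ×ˢ univ) (intensity μ) :=
    integrable_of_integrable_sq hγ.aestronglyMeasurable hγ2.integrableOn
  have hei : IntegrableOn (fun p => Complex.exp (φ p * Complex.I) - 1) (D R ×ˢ univ)
      (intensity μ) := by
    refine Integrable.of_bound (C := 2) (by fun_prop) (.of_forall fun p => ?_)
    refine (norm_sub_le _ _).trans ?_
    rw [Complex.norm_exp_ofReal_mul_I, norm_one]
    norm_num
  have hmean : ∫ p in D R ×ˢ univ, γ p ∂(intensity μ) =
      ∑ k, inner ℝ (η k) (∫ p in D R ×ˢ univ, g (y k) p ∂(intensity μ)) := by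
    have hgi : ∀ k, IntegrableOn (g (y k)) (D R ×ˢ univ) (intensity μ) := fun k =>
      integrableOn_of_sq hDb (hgm _) (hf2 _)
    rw [integral_finsetSum _ fun k _ => (hgi k).const_inner _]
    exact Finset.sum_congr rfl fun k _ => integral_inner (hgi k) _
  have hsub : ∫ p in D R ×ˢ univ, (Complex.exp (φ p * Complex.I) - 1 - γ p * Complex.I)
      ∂(intensity μ) = (∫ p in D R ×ˢ univ, (Complex.exp (φ p * Complex.I) - 1) ∂(intensity μ)) -
      ∫ p in D R ×ˢ univ, (γ p : ℂ) * Complex.I ∂(intensity μ) :=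
    integral_sub hei ((Integrable.ofReal hγi).mul_const _)
  rw [Function.comp_apply, hsub, integral_mul_const,
    integral_complex_ofReal, hmean, ← Complex.exp_add, ← Complex.exp_add]
  change Complex.exp (_ + ((∫ p in D R ×ˢ univ, (Complex.exp (φ p * Complex.I) - 1)
    ∂(intensity μ)) - _)) = Complex.exp (_ + ∫ p in D R ×ˢ univ, (Complex.exp (φ p * Complex.I) - 1)
    ∂(intensity μ))
  generalize (∫ p in D R ×ˢ univ, (Complex.exp (φ p * Complex.I) - 1) ∂(intensity μ)) = W
  simp only [c, inner_sub_right, Finset.sum_sub_distrib, Complex.ofReal_sub]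
  congr 1
  ring

open ChargedConfiguration

/-! ### Setwise convergence of the force at a point -/

/-- Central forces of strength `ρ h(ρ)` at distance `ρ`, which are square integrable at infinity
and do not vanish at large distances. -/
structure IsForceProfile (h : ℝ → ℝ) : Prop where
  measurable : Measurable h
  integrable_sq : IntegrableOn (fun u : E => ‖h ‖u‖ • u‖ ^ 2) (Metric.ball 0 1)ᶜ
  ne_zero : ∃ r₀ : ℝ, ∀ r, r₀ < r → h r ≠ 0

/-- The forces at `x` of the scatterers at distance at least one from `x`. -/
def farForce (h : ℝ → ℝ) (x : E) : E × I → E :=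
  ((Metric.ball x 1)ᶜ ×ˢ univ).indicator (centralForce h x)

theorem measurable_farForce {h : ℝ → ℝ} (hh : Measurable h) (x : E) :
    Measurable (farForce h x : E × I → E) :=
  (measurable_centralForce hh x).indicator (Metric.isOpen_ball.measurableSet.compl.prod .univ)

theorem farForce_eq (h : ℝ → ℝ) (x : E) (p : E × I) :
    farForce h x p = (p.2 : ℝ) • (Metric.ball (0 : E) 1)ᶜ.indicator (fun u => h ‖u‖ • u) (x - p.1) := by
  have hiff : p ∈ (Metric.ball x 1)ᶜ ×ˢ (univ : Set I) ↔ x - p.1 ∈ (Metric.ball (0 : E) 1)ᶜ := by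
    simp [dist_eq_norm, norm_sub_rev]
  by_cases hp : x - p.1 ∈ (Metric.ball (0 : E) 1)ᶜ
  · rw [farForce, indicator_of_mem (hiff.2 hp), indicator_of_mem hp, centralForce, mul_smul]
  · rw [farForce, indicator_of_notMem (hiff.not.2 hp), indicator_of_notMem hp, smul_zero]

theorem IsForceProfile.integrable_sq_farForce {h : ℝ → ℝ} (hh : IsForceProfile h) (μ : Measure I)
    [IsProbabilityMeasure μ] (x : E) :
    Integrable (fun p => ‖farForce h x p‖ ^ 2) (intensity μ) := by
  have h1 : Integrable (fun u : E =>
      ‖(Metric.ball (0 : E) 1)ᶜ.indicator (fun u => h ‖u‖ • u) u‖ ^ 2) := by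
    have h2 := (integrable_indicator_iff (Metric.isOpen_ball.measurableSet.compl)).2 hh.integrable_sq
    refine h2.congr (.of_forall fun u => ?_)
    by_cases hu : u ∈ (Metric.ball (0 : E) 1)ᶜ <;> simp [hu]
  have h3 : Integrable (fun q : I => (q : ℝ) ^ 2) μ := .of_finite
  refine ((h1.comp_sub_left x).mul_prod h3).congr (.of_forall fun p => ?_)
  simp only
  rw [farForce_eq, norm_smul, mul_pow, Real.norm_eq_abs, sq_abs, mul_comm]

theorem volume_compl_closedBall (x : E) (r : ℝ) : volume (Metric.closedBall x r)ᶜ = ⊤ := by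
  rw [measure_compl Metric.isClosed_closedBall.measurableSet measure_closedBall_lt_top.ne,
    measure_univ_of_isAddLeftInvariant, ENNReal.top_sub measure_closedBall_lt_top.ne]

/-- Widening the shell makes the expected number `V` of charged scatterers tend to infinity, and the
probability `exp(-V) (1 + V)` of at most one of them tends to zero. -/
theorem exists_fewJumps_shell_le (μ : Measure I) [IsProbabilityMeasure μ] {h : ℝ → ℝ}
    (hh : Measurable h) (x : E) (a : ℝ) (hμ : μ {q : I | (q : ℝ) ≠ 0} ≠ 0) {ε : ℝ} (hε : 0 < ε) :
    ∃ b : ℝ, fewJumps (shellForceLaw μ h x (shell x a b)) univ ≤ ENNReal.ofReal ε := by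
  have hlim : Tendsto (fun v : ℝ => Real.exp (-v) * (1 + v)) atTop (𝓝 0) := by
    have h1 := (Real.tendsto_pow_mul_exp_neg_atTop_nhds_zero 0).add
      (Real.tendsto_pow_mul_exp_neg_atTop_nhds_zero 1)
    simp only [pow_zero, one_mul, pow_one, add_zero] at h1
    exact h1.congr fun v => by ring
  obtain ⟨V, hV⟩ := eventually_atTop.1 (hlim.eventually_lt_const hε)
  set m := μ {q : I | (q : ℝ) ≠ 0}
  have huniv : ∀ b, shellForceLaw μ h x (shell x a b) univ = volume (shell x a b) * m := by
    intro b
    rw [shellForceLaw, Measure.map_apply (measurable_centralForce hh x) .univ, preimage_univ,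
      Measure.restrict_apply_univ, intensity, Measure.prod_prod]
  have hvol : Tendsto (fun n : ℕ => volume (shell x a n) * m) atTop (𝓝 (⊤ * m)) := by
    refine ENNReal.Tendsto.mul_const ?_ (.inl ENNReal.top_ne_zero)
    have h1 : ⋃ n : ℕ, shell x a n = (Metric.closedBall x a)ᶜ := by
      ext z
      simp only [shell, mem_iUnion, mem_ofPred_eq, mem_compl_iff, Metric.mem_closedBall, dist_comm z,
        dist_eq_norm, not_le]
      exact ⟨fun ⟨n, h⟩ => h.1, fun h => (exists_nat_gt ‖x - z‖).imp fun n hn => ⟨h, hn⟩⟩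
    rw [← volume_compl_closedBall x a, ← h1]
    refine tendsto_measure_iUnion_atTop fun n k hnk z hz => ⟨hz.1, hz.2.trans_le ?_⟩
    exact_mod_cast hnk
  rw [ENNReal.top_mul hμ] at hvol
  obtain ⟨n, hn⟩ := (hvol.eventually_const_lt (u := ENNReal.ofReal V) ENNReal.ofReal_lt_top).exists
  refine ⟨n, ?_⟩
  have := isFiniteMeasure_shellForceLaw μ h x (isBounded_shell x a n)
  rw [fewJumps_univ]
  refine ENNReal.ofReal_le_ofReal (hV _ ?_).le
  rw [← huniv] at hn
  exact (ENNReal.ofReal_le_iff_le_toReal (measure_ne_top _ _)).1 hn.le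

theorem charFun_shellForceLaw (μ : Measure I) [IsProbabilityMeasure μ] {h : ℝ → ℝ}
    (hh : Measurable h) (x : E) {D : Set E} (hD : Bornology.IsBounded D) (hDm : MeasurableSet D)
    (t : E) :
    MeasureTheory.charFun (shellForceLaw μ h x D) t - (shellForceLaw μ h x D).real univ =
      ∫ p in D ×ˢ univ, (Complex.exp (((inner ℝ t (centralForce h x p) : ℝ) : ℂ) * Complex.I) - 1)
        ∂(intensity μ) := by
  have hf := measurable_centralForce (I := I) hh x
  have := isFiniteMeasure_shellForceLaw μ h x hD
  have := isFiniteMeasure_intensity μ hD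
  have hres : IsFiniteMeasure ((intensity μ).restrict (D ×ˢ {q : I | (q : ℝ) ≠ 0})) :=
    isFiniteMeasure_of_le _ (Measure.restrict_mono (prod_mono le_rfl (subset_univ _)) le_rfl)
  have h1 : ∫ p in D ×ˢ univ, (Complex.exp (((inner ℝ t (centralForce h x p) : ℝ) : ℂ) * Complex.I)
      - 1) ∂(intensity μ) = ∫ p in D ×ˢ {q : I | (q : ℝ) ≠ 0},
      (Complex.exp (((inner ℝ t (centralForce h x p) : ℝ) : ℂ) * Complex.I) - 1) ∂(intensity μ) := by
    refine setIntegral_eq_of_subset_of_forall_sdiff_eq_zero (hDm.prod .univ)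
      (prod_mono le_rfl (subset_univ _)) ?_
    rintro ⟨z, q⟩ ⟨hz, hz'⟩
    have hq : (q : ℝ) = 0 := by
      by_contra hq
      exact hz' ⟨hz.1, hq⟩
    simp [centralForce, hq]
  have hexp : Integrable (fun p : E × I => Complex.exp (((inner ℝ t (centralForce h x p) : ℝ) : ℂ) *
      Complex.I)) ((intensity μ).restrict (D ×ˢ {q : I | (q : ℝ) ≠ 0})) :=
    Integrable.of_bound (C := 1) (by fun_prop) (.of_forall fun p => by
      rw [Complex.norm_exp_ofReal_mul_I])
  rw [h1, integral_sub hexp (integrable_const _), MeasureTheory.charFun_apply, shellForceLaw,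
    integral_map hf.aemeasurable (by fun_prop)]
  simp only [real_inner_comm, integral_const, mul_one, Complex.real_smul]
  congr 2
  rw [measureReal_def, measureReal_def, Measure.map_apply hf .univ, preimage_univ]

theorem IsScattererDistribution.cloudSum_ae_eq_zero {μ : Measure I} [IsProbabilityMeasure μ]
    {P : Measure (ChargedConfiguration I)} (hP : IsScattererDistribution μ P)
    (hμ : μ {q : I | (q : ℝ) ≠ 0} = 0) {h : ℝ → ℝ} (hh : Measurable h) (x : E) {D : Set E}
    (hD : Bornology.IsBounded D) (hDm : MeasurableSet D) :
    cloudSum D (centralForce h x) =ᵐ[P] 0 := by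
  have hf := measurable_centralForce (I := I) hh x
  have h1 : ∀ᵐ p ∂(intensity μ), centralForce h x p = 0 := by
    have h2 : ∀ᵐ q : I ∂μ, (q : ℝ) = 0 := by
      rw [ae_iff]
      exact hμ
    have h3 : ∀ᵐ p ∂(intensity μ), (p.2 : ℝ) = 0 :=
      (Measure.quasiMeasurePreserving_snd (μ := (volume : Measure E)) (ν := μ)).ae h2
    filter_upwards [h3] with p hp
    simp [centralForce, hp]
  have h4 := hP.lintegral_enorm_cloudSum_le hDm hf
  have h5 : ∫⁻ p in D ×ˢ univ, ‖centralForce h x p‖ₑ ∂(intensity μ) = 0 := by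
    refine (lintegral_congr_ae (ae_restrict_of_ae (h1.mono fun p hp => ?_))).trans lintegral_zero
    rw [hp, enorm_zero]
  rw [h5, nonpos_iff_eq_zero, lintegral_eq_zero_iff (measurable_cloudSum hD hDm hf).enorm] at h4
  exact h4.mono fun ω hω => by simpa using hω

theorem tendsto_charFun_map {Ω : Type*} [MeasurableSpace Ω] {P : Measure Ω}
    [IsProbabilityMeasure P] {G : ℝ → Ω → E} {F : Ω → E}
    (hG : ∀ᶠ R in atTop, Measurable (G R)) (hF : Measurable F)
    (h : Tendsto (fun R => eLpNorm (G R - F) 1 P) atTop (𝓝 0)) (t : E) :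
    Tendsto (fun R => MeasureTheory.charFun (P.map (G R)) t) atTop
      (𝓝 (MeasureTheory.charFun (P.map F) t)) := by
  rw [charFun_map_eq hF]
  refine (tendsto_charFun_of_eLpNorm (G := fun R _ => G R) (F := fun _ => F)
    (hG.mono fun R hR _ => hR) (fun _ => hF) (fun _ => h) _ _).congr' ?_
  filter_upwards [hG] with R hR
  rw [charFun_map_eq hR]

theorem IsScattererDistribution.charFun_map_cloudSum_add {μ : Measure I} [IsProbabilityMeasure μ]
    {P : Measure (ChargedConfiguration I)} [IsProbabilityMeasure P]
    (hP : IsScattererDistribution μ P) {D : Set E} (hD : Bornology.IsBounded D)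
    (hDm : MeasurableSet D) {f : E × I → E} (hf : Measurable f) (c t : E) :
    MeasureTheory.charFun (P.map fun ω => cloudSum D f ω + c) t =
      Complex.exp (Complex.I * ((inner ℝ t c : ℝ) : ℂ)) *
        Complex.exp (∫ p in D ×ˢ univ, (Complex.exp
          (((inner ℝ t (f p) : ℝ) : ℂ) * Complex.I) - 1) ∂(intensity μ)) := by
  rw [charFun_map_eq ((measurable_cloudSum hD hDm hf).add_const c),
    hP.charFun_cloudSum_add hD hDm (f := fun _ => f) (fun _ => hf) (fun _ => c)]
  simp

/-- The scatterers in a shell `T` around `x` supply the smoothing factor. The remaining scatterers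
give a sum that still converges in mean, with its deterministic part corrected by the mean over `T`.
-/
theorem IsScattererDistribution.tendsto_measure_preimage_cloudSum {μ : Measure I}
    [IsProbabilityMeasure μ] {P : Measure (ChargedConfiguration I)} [IsProbabilityMeasure P]
    (hP : IsScattererDistribution μ P) {h : ℝ → ℝ} (hh : IsForceProfile h) {D : ℝ → Set E}
    (hD : Exhausts D) (x : E) {c : ℝ → E} {m : E} {F : ChargedConfiguration I → E}
    (hF : Measurable F)
    (hlim : Tendsto (fun R => eLpNorm (fun ω => cloudSum (D R) (centralForce h x) ω + c R - F ω) 1 P)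
      atTop (𝓝 0))
    (hc : Tendsto (fun R => (∫ p in D R ×ˢ univ, farForce h x p ∂(intensity μ)) + c R) atTop (𝓝 m))
    (hdeg : μ {q : I | (q : ℝ) ≠ 0} = 0 → ∀ R, c R = 0) {S : Set E} (hS : MeasurableSet S) :
    Tendsto (fun R => P ((fun ω => cloudSum (D R) (centralForce h x) ω + c R) ⁻¹' S)) atTop
      (𝓝 (P (F ⁻¹' S))) := by
  have hfm := measurable_centralForce (I := I) hh.measurable x
  have hgm := measurable_farForce (I := I) hh.measurable x
  have hGm : ∀ᶠ R in atTop, Measurable fun ω : ChargedConfiguration I =>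
      cloudSum (D R) (centralForce h x) ω + c R := by
    filter_upwards [eventually_gt_atTop 0] with R hR
    exact (measurable_cloudSum (hD.isBounded R hR) (hD.measurableSet R hR) hfm).add_const _
  -- Without charges there is no smoothing: the force is the constant `c R`, and moving point masses
  -- need not converge on every Borel set. Hence the hypothesis `hdeg`, which makes both sides
  -- almost surely zero.
  by_cases hμ : μ {q : I | (q : ℝ) ≠ 0} = 0
  · have hG0 : ∀ᶠ R in atTop, (fun ω => cloudSum (D R) (centralForce h x) ω + c R) =ᵐ[P] 0 := by
      filter_upwards [eventually_gt_atTop 0] with R hR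
      filter_upwards [hP.cloudSum_ae_eq_zero hμ hh.measurable x (hD.isBounded R hR)
        (hD.measurableSet R hR)] with ω hω
      rw [hω, hdeg hμ]
      simp
    have hF0 : F =ᵐ[P] 0 := by
      have h1 : Tendsto (fun R : ℝ => eLpNorm F 1 P) atTop (𝓝 0) := by
        refine hlim.congr' (hG0.mono fun R hR => ?_)
        rw [← eLpNorm_neg]
        refine eLpNorm_congr_ae (hR.mono fun ω hω => ?_)
        have hω' : cloudSum (D R) (centralForce h x) ω + c R = 0 := hω
        simp [hω']
      have h2 := tendsto_nhds_unique tendsto_const_nhds h1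
      exact (eLpNorm_eq_zero_iff hF.aestronglyMeasurable one_ne_zero).1 h2
    refine tendsto_const_nhds.congr' (hG0.mono fun R hR => ?_)
    refine measure_congr ?_
    filter_upwards [hF0, hR] with ω h1 h2
    have h3 : F ω = cloudSum (D R) (centralForce h x) ω + c R := h1.trans h2.symm
    change (F ω ∈ S) = (cloudSum (D R) (centralForce h x) ω + c R ∈ S)
    rw [h3]
  · refine tendsto_measure_preimage_of_charFun_mul hGm hF (fun ε hε => ?_) hS
    obtain ⟨r₀, hr₀⟩ := hh.ne_zero
    -- The shell starts where the profile no longer vanishes, so that every charged scatterer in it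
    -- exerts a nonzero force.
    set a := max r₀ 0
    obtain ⟨b, hb⟩ := exists_fewJumps_shell_le μ hh.measurable x a hμ hε
    set T := shell x a b
    have hTb : Bornology.IsBounded T := isBounded_shell x a b
    have hTm : MeasurableSet T := measurableSet_shell x a b
    set ρ := shellForceLaw μ h x T with hρ
    have hρf : IsFiniteMeasure ρ := isFiniteMeasure_shellForceLaw μ h x hTb
    set f' : E × I → E := (Tᶜ ×ˢ univ).indicator (centralForce h x)
    have hf'm : Measurable f' := hfm.indicator (hTm.compl.prod .univ)
    have hcomm : ((Metric.ball x 1)ᶜ ×ˢ (univ : Set I)).indicator f' =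
        (Tᶜ ×ˢ univ).indicator (farForce h x) := by
      simp only [f', farForce, indicator_indicator, inter_comm]
    obtain ⟨F', hF'm, -, hF'⟩ := hP.exists_totalSum (Metric.isBounded_ball (x := x) (r := 1))
      Metric.isOpen_ball.measurableSet hf'm (by
        rw [hcomm]
        refine (hh.integrable_sq_farForce μ x).mono'
          ((hgm.indicator (hTm.compl.prod .univ)).norm.pow_const 2).aestronglyMeasurable
          (.of_forall fun p => ?_)
        rw [Real.norm_of_nonneg (sq_nonneg _)]
        exact pow_le_pow_left₀ (norm_nonneg _) (norm_indicator_le_norm_self _ _) 2)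
    set mT := ∫ p in T ×ˢ univ, farForce h x p ∂(intensity μ)
    have hHm : ∀ᶠ R in atTop, Measurable fun ω : ChargedConfiguration I =>
        cloudSum (D R \ T) (centralForce h x) ω + c R := by
      filter_upwards [eventually_gt_atTop 0] with R hR
      exact (measurable_cloudSum ((hD.isBounded R hR).subset sdiff_subset)
        ((hD.measurableSet R hR).diff hTm) hfm).add_const _
    have hHlim : Tendsto (fun R => eLpNorm ((fun ω => cloudSum (D R \ T) (centralForce h x) ω + c R)
        - fun ω => F' ω + (m - mT)) 1 P) atTop (𝓝 0) := by
      have h1 : Tendsto (fun R => eLpNorm (fun _ : ChargedConfiguration I =>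
          (∫ p in D R ×ˢ univ, farForce h x p ∂(intensity μ)) + c R - m) 1 P) atTop (𝓝 0) := by
        simp only [eLpNorm_const _ one_ne_zero (IsProbabilityMeasure.ne_zero P), measure_univ,
          ENNReal.one_rpow, mul_one]
        have h2 := (hc.sub_const m).enorm
        simpa using h2
      have h3 := (hF' D hD).add h1
      rw [add_zero] at h3
      refine tendsto_of_tendsto_of_tendsto_of_le_of_le' tendsto_const_nhds h3
        (.of_forall fun _ => zero_le) ?_
      filter_upwards [hD.eventually_subset hTb, eventually_gt_atTop 0] with R hR hR0
      have hgi := integrableOn_of_sq (hD.isBounded R hR0) hgm (hh.integrable_sq_farForce μ x)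
      have h4 : ∫ p in D R ×ˢ univ, ((Metric.ball x 1)ᶜ ×ˢ (univ : Set I)).indicator f' p
          ∂(intensity μ) = (∫ p in D R ×ˢ univ, farForce h x p ∂(intensity μ)) - mT := by
        rw [hcomm, setIntegral_indicator (hTm.compl.prod .univ), Set.prod_inter_prod, univ_inter,
          ← Set.sdiff_eq, diff_prod_univ,
          setIntegral_sdiff (hTm.prod .univ) hgi (prod_mono hR le_rfl)]
      refine le_trans (le_of_eq ?_) (eLpNorm_add_le
        (((measurable_cloudSum (hD.isBounded R hR0) (hD.measurableSet R hR0)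
          hf'm).sub_const _).sub hF'm).aestronglyMeasurable aestronglyMeasurable_const le_rfl)
      congr 1
      ext1 ω
      simp only [Pi.sub_apply, Pi.add_apply]
      rw [h4, cloudSum_indicator hTm.compl, ← Set.sdiff_eq]
      abel
    -- Campbell's exponent is additive over disjoint regions, and its part over `T` is the exponent
    -- of the compound Poisson law.
    have hfac : ∀ᶠ R in atTop, ∀ t,
        MeasureTheory.charFun (P.map fun ω => cloudSum (D R) (centralForce h x) ω + c R) t =
        MeasureTheory.charFun (fewJumps ρ + manyJumps ρ) t *
        MeasureTheory.charFun (P.map fun ω => cloudSum (D R \ T) (centralForce h x) ω + c R) t := by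
      filter_upwards [hD.eventually_subset hTb, eventually_gt_atTop 0] with R hR hR0 t
      have := isFiniteMeasure_intensity μ (hD.isBounded R hR0)
      have hint : IntegrableOn (fun p : E × I => Complex.exp (((inner ℝ t (centralForce h x p) : ℝ) : ℂ)
          * Complex.I) - 1) (D R ×ˢ univ) (intensity μ) := by
        refine Integrable.of_bound (C := 2) (by fun_prop) (.of_forall fun p => ?_)
        refine (norm_sub_le _ _).trans ?_
        rw [Complex.norm_exp_ofReal_mul_I, norm_one]
        norm_num
      rw [hP.charFun_map_cloudSum_add (hD.isBounded R hR0) (hD.measurableSet R hR0) hfm,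
        hP.charFun_map_cloudSum_add ((hD.isBounded R hR0).subset sdiff_subset)
          ((hD.measurableSet R hR0).diff hTm) hfm, charFun_compoundPoisson, hρ,
        charFun_shellForceLaw μ hh.measurable x hTb hTm, diff_prod_univ,
        setIntegral_sdiff (hTm.prod .univ) hint (prod_mono hR le_rfl), mul_left_comm]
      congr 1
      rw [← Complex.exp_add, add_sub_cancel]
    refine ⟨fewJumps ρ, manyJumps ρ, fun R ω => cloudSum (D R \ T) (centralForce h x) ω + c R,
      fun ω => F' ω + (m - mT), inferInstance, inferInstance, hb,
      manyJumps_absolutelyContinuous (shellForceLaw_conv_absolutelyContinuous μ hh.measurable x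
        (le_max_right _ _) fun r hr _ => hr₀ r ((le_max_left _ _).trans_lt hr)),
      hHm, hF'm.add_const _, hHlim, hfac, fun t => ?_⟩
    -- The factorization for the limit `F` is inherited from that of the approximating sums.
    refine tendsto_nhds_unique (tendsto_charFun_map hGm hF hlim t) ?_
    refine ((tendsto_charFun_map hHm (hF'm.add_const _) hHlim t).const_mul _).congr' ?_
    exact hfac.mono fun R hR => (hR t).symm

/-! ### Gradients of radial functions -/

theorem inner_gradient (Φ : E → ℝ) (u w : E) : inner ℝ (gradient Φ u) w = fderiv ℝ Φ u w := by
  rw [gradient, InnerProductSpace.toDual_symm_apply]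

theorem measurable_gradient (Φ : E → ℝ) : Measurable (gradient Φ) := by
  refine measurable_of_inner fun t => ?_
  have h : (fun a => inner ℝ t (gradient Φ a)) = fun a => fderiv ℝ Φ a t :=
    funext fun a => by rw [real_inner_comm, inner_gradient]
  rw [h]
  exact measurable_fderiv_apply_const ℝ Φ t

theorem gradient_sub {f g : E → ℝ} {u : E} (hf : DifferentiableAt ℝ f u)
    (hg : DifferentiableAt ℝ g u) :
    gradient (fun y => f y - g y) u = gradient f u - gradient g u := by
  rw [gradient, gradient, gradient, fderiv_fun_sub hf hg, map_sub]

theorem gradient_const_mul {f : E → ℝ} {u : E} (hf : DifferentiableAt ℝ f u) (A : ℝ) :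
    gradient (fun y => A * f y) u = A • gradient f u := by
  rw [gradient, gradient, fderiv_const_mul hf, map_smul]

theorem gradient_radial_isometry {Φ : E → ℝ} (hΦ : ∀ x y : E, ‖x‖ = ‖y‖ → Φ x = Φ y)
    (L : E ≃ₗᵢ[ℝ] E) (u : E) : gradient Φ (L u) = L (gradient Φ u) := by
  have h : Φ ∘ L.toContinuousLinearEquiv = Φ := funext fun x => hΦ _ _ (L.norm_map x)
  refine ext_inner_right ℝ fun w => ?_
  obtain ⟨w, rfl⟩ := L.surjective w
  rw [L.inner_map_map, inner_gradient, inner_gradient]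
  conv_rhs => rw [← h, ContinuousLinearEquiv.comp_right_fderiv]
  rfl

/-- The reflection fixing the line through `u` preserves `Φ` and `u`, hence also the gradient, which
must then lie on that line. Differentiability is not needed, since the junk value zero lies there as
well. -/
theorem gradient_radial_mem_span {Φ : E → ℝ} (hΦ : ∀ x y : E, ‖x‖ = ‖y‖ → Φ x = Φ y) (u : E) :
    gradient Φ u ∈ Submodule.span ℝ {u} := by
  rw [← Submodule.reflection_eq_self_iff, ← gradient_radial_isometry hΦ,
    Submodule.reflection_mem_subspace_eq_self (Submodule.mem_span_singleton_self u)]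

/-- A fixed unit vector. -/
def unitVec : E := EuclideanSpace.single 0 1

@[simp] theorem norm_unitVec : ‖unitVec‖ = 1 := by simp [unitVec]

/-- The function `h` for which `-∇Φ(u) = h(|u|) u`. -/
def radialProfile (Φ : E → ℝ) (ρ : ℝ) : ℝ := -(inner ℝ (gradient Φ (ρ • unitVec)) unitVec) / ρ

theorem measurable_radialProfile (Φ : E → ℝ) : Measurable (radialProfile Φ) := by
  have := measurable_gradient Φ
  unfold radialProfile
  fun_prop

theorem gradient_radial_eq {Φ : E → ℝ} (hΦ : ∀ x y : E, ‖x‖ = ‖y‖ → Φ x = Φ y) (u : E) :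
    gradient Φ u = -(radialProfile Φ ‖u‖ • u) := by
  rcases eq_or_ne u 0 with rfl | hu
  · obtain ⟨a, ha⟩ := Submodule.mem_span_singleton.1 (gradient_radial_mem_span hΦ 0)
    rw [← ha]
    simp
  · have hu' : ‖u‖ ≠ 0 := norm_ne_zero_iff.2 hu
    obtain ⟨L, hL⟩ := exists_linearIsometryEquiv_apply_eq (x := ‖u‖ • unitVec) (y := u)
      (by simp [norm_smul])
    obtain ⟨a, ha⟩ := Submodule.mem_span_singleton.1
      (gradient_radial_mem_span hΦ (‖u‖ • unitVec))
    have h1 : radialProfile Φ ‖u‖ = -a := by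
      rw [radialProfile, ← ha, inner_smul_left, inner_smul_left, real_inner_self_eq_norm_sq]
      simp
      field_simp
    rw [h1, neg_smul, neg_neg]
    conv_lhs => rw [← hL, gradient_radial_isometry hΦ, ← ha, map_smul, hL]

theorem gradient_radial_neg {Φ : E → ℝ} (hΦ : ∀ x y : E, ‖x‖ = ‖y‖ → Φ x = Φ y) (u : E) :
    gradient Φ (-u) = -gradient Φ u := by
  rw [gradient_radial_eq hΦ, gradient_radial_eq hΦ u, norm_neg, smul_neg]

/-! ### The power potential -/

theorem powerPotential_radial (s : ℝ) (x y : E) (h : ‖x‖ = ‖y‖) :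
    powerPotential s x = powerPotential s y := by
  rw [powerPotential, powerPotential, h]

theorem powerPotential_eq (s : ℝ) : powerPotential s = fun x => (‖x‖ ^ 2) ^ (-(s / 2)) := by
  ext x
  rw [powerPotential, ← Real.rpow_natCast, ← Real.rpow_mul (norm_nonneg x), one_div,
    ← Real.rpow_neg (norm_nonneg x)]
  congr 1
  push_cast
  ring

theorem hasFDerivAt_powerPotential (s : ℝ) {x : E} (hx : x ≠ 0) :
    HasFDerivAt (powerPotential s)
      ((-(s / 2) * (‖x‖ ^ 2) ^ (-(s / 2) - 1)) • (2 • innerSL ℝ x)) x := by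
  rw [powerPotential_eq]
  exact (hasStrictFDerivAt_norm_sq x).hasFDerivAt.rpow_const (.inl (by positivity))

theorem gradient_powerPotential (s : ℝ) (x : E) :
    gradient (powerPotential s) x = (-s * ‖x‖ ^ (-s - 2)) • x := by
  rcases eq_or_ne x 0 with rfl | hx
  · rw [gradient_radial_eq (powerPotential_radial s)]
    simp
  · refine ext_inner_right ℝ fun w => ?_
    have h1 : (‖x‖ ^ 2) ^ (-(s / 2) - 1) = ‖x‖ ^ (-s - 2) := by
      rw [← Real.rpow_natCast, ← Real.rpow_mul (norm_nonneg x)]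
      congr 1
      push_cast
      ring
    rw [inner_gradient, (hasFDerivAt_powerPotential s hx).fderiv, h1, inner_smul_left]
    simp
    ring

theorem norm_gradient_powerPotential (s : ℝ) {x : E} (hx : x ≠ 0) :
    ‖gradient (powerPotential s) x‖ = |s| * ‖x‖ ^ (-s - 1) := by
  have h : ‖x‖ ^ (-s - 1) = ‖x‖ ^ (-s - 2) * ‖x‖ := by
    rw [← Real.rpow_add_one (norm_ne_zero_iff.2 hx)]
    congr 1
    ring
  rw [gradient_powerPotential, norm_smul, Real.norm_eq_abs, abs_mul, abs_neg,
    abs_of_nonneg (Real.rpow_nonneg (norm_nonneg x) _), h, mul_assoc]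

theorem integrableOn_norm_rpow {p : ℝ} (hp : 3 < p) :
    IntegrableOn (fun u : E => ‖u‖ ^ (-p)) (Metric.ball 0 1)ᶜ := by
  have h1 : Integrable (fun u : E => 2 ^ p * (1 + ‖u‖) ^ (-p)) :=
    (integrable_one_add_norm (by simpa using hp)).const_mul _
  refine h1.integrableOn.mono' (measurable_norm.pow_const _).aestronglyMeasurable ?_
  refine (ae_restrict_iff' Metric.isOpen_ball.measurableSet.compl).2 (.of_forall fun u hu => ?_)
  have hu1 : 1 ≤ ‖u‖ := by simpa using hu
  rw [Real.norm_of_nonneg (by positivity)]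
  have h2 : (2 * ‖u‖) ^ (-p) ≤ (1 + ‖u‖) ^ (-p) :=
    Real.rpow_le_rpow_of_nonpos (by positivity) (by linarith) (by linarith)
  rw [Real.mul_rpow (by norm_num) (by positivity), Real.rpow_neg (by norm_num)] at h2
  have h3 : (0 : ℝ) < 2 ^ p := by positivity
  calc ‖u‖ ^ (-p) = 2 ^ p * ((2 ^ p)⁻¹ * ‖u‖ ^ (-p)) := by field_simp
    _ ≤ _ := mul_le_mul_of_nonneg_left h2 h3.le

/-! ### Potentials of the class `𝒞_s` -/

section Class

variable {s A : ℝ} {Φ : E → ℝ} (hΦ : IsInClass s A Φ)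
include hΦ

theorem IsInClass.gradient_eq (u : E) : gradient Φ u = -(radialProfile Φ ‖u‖ • u) :=
  gradient_radial_eq hΦ.radial u

theorem IsInClass.gradient_neg (u : E) : gradient Φ (-u) = -gradient Φ u :=
  gradient_radial_neg hΦ.radial u

theorem IsInClass.differentiableAt {u : E} (hu : u ≠ 0) : DifferentiableAt ℝ Φ u :=
  (hΦ.contDiffOn.contDiffAt (isOpen_compl_singleton.mem_nhds hu)).differentiableAt (by norm_num)

theorem IsInClass.continuousOn_gradient : ContinuousOn (gradient Φ) {0}ᶜ := by
  have h := hΦ.contDiffOn.continuousOn_fderiv_of_isOpen isOpen_compl_singleton (by norm_num)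
  exact (InnerProductSpace.toDual ℝ E).symm.continuous.comp_continuousOn h

theorem IsInClass.exists_norm_gradient_sub_le : ∃ C r : ℝ, max s 2 < r ∧ 0 ≤ C ∧
    ∀ u : E, 1 ≤ ‖u‖ →
      ‖gradient Φ u - A • gradient (powerPotential s) u‖ ≤ C * ‖u‖ ^ (-r - 1) := by
  obtain ⟨C, r, hr, hC⟩ := hΦ.decay
  have hC0 : 0 ≤ C := by
    have := hC unitVec (by simp)
    simp only [norm_unitVec, one_mul, Real.one_rpow, div_one] at this
    exact le_trans (by positivity) this
  refine ⟨C, r, hr, hC0, fun u hu => ?_⟩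
  have hu0 : u ≠ 0 := by
    rintro rfl
    simp at hu
    linarith
  have hpos : 0 < ‖u‖ := by positivity
  have hd := (hasFDerivAt_powerPotential s hu0).differentiableAt
  have h1 := hC u hu
  rw [gradient_sub (hΦ.differentiableAt hu0) (hd.const_mul A), gradient_const_mul hd] at h1
  have h2 := (le_add_of_nonneg_left (abs_nonneg (Φ u - A * powerPotential s u))).trans h1
  have h3 : ‖u‖ ^ (-r - 1) = (‖u‖ ^ r)⁻¹ * ‖u‖⁻¹ := by
    rw [Real.rpow_sub_one hpos.ne', Real.rpow_neg hpos.le, div_eq_mul_inv]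
  rw [h3, ← mul_assoc, ← div_eq_mul_inv, ← div_eq_mul_inv, le_div_iff₀ hpos, mul_comm]
  exact h2

/-- Here `r > 2` enters: the remainder of the force decays like `|u|^(-r-1)` with exponent above
three. -/
theorem IsInClass.integrableOn_gradient_sub :
    IntegrableOn (fun u => gradient Φ u - A • gradient (powerPotential s) u) (Metric.ball 0 1)ᶜ := by
  obtain ⟨C, r, hr, -, hC⟩ := hΦ.exists_norm_gradient_sub_le
  have h1 : (3 : ℝ) < r + 1 := by linarith [(le_max_right s 2).trans_lt hr]
  refine ((integrableOn_norm_rpow h1).const_mul C).mono' ?_ ?_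
  · exact ((measurable_gradient Φ).sub
      ((measurable_gradient (powerPotential s)).const_smul A)).aestronglyMeasurable
  · refine (ae_restrict_iff' Metric.isOpen_ball.measurableSet.compl).2 (.of_forall fun u hu => ?_)
    rw [neg_add, ← sub_eq_add_neg]
    exact hC u (by simpa using hu)

/-- Square integrability uses `2 s + 2 > 3`. Nonvanishing at large distances holds because `|A| s
|u|^(-s-1)` eventually exceeds the remainder `C |u|^(-r-1)`, as `r > s`. -/
theorem IsInClass.isForceProfile (hs : 1 / 2 < s) : IsForceProfile (radialProfile Φ) where
  measurable := measurable_radialProfile Φ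
  integrable_sq := by
    obtain ⟨C, r, hr, hC0, hC⟩ := hΦ.exists_norm_gradient_sub_le
    have h1 : (3 : ℝ) < 2 * s + 2 := by linarith
    have hm := measurable_gradient Φ
    refine ((integrableOn_norm_rpow h1).const_mul ((C + |A| * |s|) ^ 2)).mono' ?_ ?_
    · have : (fun u : E => ‖radialProfile Φ ‖u‖ • u‖ ^ 2) = fun u => ‖gradient Φ u‖ ^ 2 := by
        ext u
        rw [hΦ.gradient_eq, norm_neg]
      rw [this]
      fun_prop
    · refine (ae_restrict_iff' Metric.isOpen_ball.measurableSet.compl).2 (.of_forall fun u hu => ?_)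
      have hu1 : 1 ≤ ‖u‖ := by simpa using hu
      have hu0 : u ≠ 0 := norm_ne_zero_iff.1 (by linarith)
      have h2 : ‖gradient Φ u‖ ≤ (C + |A| * |s|) * ‖u‖ ^ (-s - 1) := by
        have h3 : ‖u‖ ^ (-r - 1) ≤ ‖u‖ ^ (-s - 1) :=
          Real.rpow_le_rpow_of_exponent_le hu1 (by linarith [(le_max_left s 2).trans_lt hr])
        calc ‖gradient Φ u‖ ≤ ‖gradient Φ u - A • gradient (powerPotential s) u‖ +
              ‖A • gradient (powerPotential s) u‖ := norm_le_norm_sub_add _ _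
          _ ≤ C * ‖u‖ ^ (-s - 1) + |A| * (|s| * ‖u‖ ^ (-s - 1)) := by
              refine add_le_add ((hC u hu1).trans (mul_le_mul_of_nonneg_left h3 hC0)) (le_of_eq ?_)
              rw [norm_smul, norm_gradient_powerPotential s hu0, Real.norm_eq_abs]
          _ = _ := by ring
      rw [Real.norm_of_nonneg (sq_nonneg _), ← norm_neg, ← hΦ.gradient_eq]
      refine (pow_le_pow_left₀ (norm_nonneg _) h2 2).trans (le_of_eq ?_)
      rw [mul_pow, ← Real.rpow_natCast (‖u‖ ^ (-s - 1)), ← Real.rpow_mul (norm_nonneg u)]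
      congr 2
      push_cast
      ring
  ne_zero := by
    obtain ⟨C, r, hr, hC0, hC⟩ := hΦ.exists_norm_gradient_sub_le
    have hrs : 0 < r - s := by linarith [(le_max_left s 2).trans_lt hr]
    have hA : 0 < |A| * |s| := mul_pos (abs_pos.2 hΦ.ne_zero) (abs_pos.2 (by linarith))
    have hlim : Tendsto (fun ρ : ℝ => C * ρ ^ (-(r - s))) atTop (𝓝 0) := by
      simpa using (tendsto_rpow_neg_atTop hrs).const_mul C
    obtain ⟨r₀, hr₀⟩ := eventually_atTop.1 (hlim.eventually_lt_const hA)
    refine ⟨max r₀ 1, fun ρ hρ h0 => ?_⟩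
    have hρ1 : 1 < ρ := (le_max_right _ _).trans_lt hρ
    have hρ0 : 0 < ρ := by linarith
    have hn : ‖ρ • unitVec‖ = ρ := by rw [norm_smul, norm_unitVec, mul_one, Real.norm_of_nonneg hρ0.le]
    have h1 := hC (ρ • unitVec) (by rw [hn]; exact hρ1.le)
    rw [hΦ.gradient_eq, hn, h0, zero_smul, neg_zero, zero_sub, norm_neg, norm_smul,
      norm_gradient_powerPotential s (norm_ne_zero_iff.1 (by rw [hn]; exact hρ0.ne')), hn,
      Real.norm_eq_abs, ← mul_assoc] at h1
    have h2 : ρ ^ (-r - 1) = ρ ^ (-(r - s)) * ρ ^ (-s - 1) := by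
      rw [← Real.rpow_add hρ0]
      congr 1
      ring
    rw [h2, ← mul_assoc] at h1
    exact (hr₀ ρ ((le_max_left _ _).trans hρ.le)).not_ge (le_of_mul_le_mul_right h1 (by positivity))

end Class

open ChargedConfiguration

/-! ### Fields determined by their characteristic functions -/

theorem map_eq_of_charFun_eq {Ω : Type*} [MeasurableSpace Ω] {P : Measure Ω}
    [IsProbabilityMeasure P] {F : E → Ω → E} (hF : ∀ x, Measurable (F x)) {J : ℕ} {y y' : Fin J → E}
    (h : ∀ η : Fin J → E, charFun P F η y = charFun P F η y') :
    P.map (fun ω k => F (y k) ω) = P.map (fun ω k => F (y' k) ω) := by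
  have hm : ∀ z : Fin J → E, Measurable fun ω k => F (z k) ω := fun z =>
    measurable_pi_lambda _ fun k => hF _
  have := Measure.isProbabilityMeasure_map (μ := P) (hm y).aemeasurable
  have := Measure.isProbabilityMeasure_map (μ := P) (hm y').aemeasurable
  refine Measure.ext_of_charFunDual (funext fun Λ => ?_)
  set η : Fin J → E := fun k => (InnerProductSpace.toDual ℝ E).symm
    (Λ.comp (ContinuousLinearMap.single ℝ (fun _ : Fin J => E) k))
  have hΛ : ∀ v : Fin J → E, Λ v = ∑ k, inner ℝ (η k) (v k) := by
    intro v
    conv_lhs => rw [← Finset.univ_sum_single v, map_sum]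
    refine Finset.sum_congr rfl fun k _ => ?_
    simp [η, InnerProductSpace.toDual_symm_apply]
  have hc : ∀ z : Fin J → E, charFunDual (P.map fun ω k => F (z k) ω) Λ = charFun P F η z := by
    intro z
    rw [charFunDual_apply, integral_map (hm z).aemeasurable (by fun_prop)]
    simp only [hΛ, charFun, mul_comm]
  rw [hc, hc, h]

/-- Characteristic functions determine the laws at finitely many points; countably many events
follow by continuity from above along finite intersections. -/
theorem translationInvariant_of_charFun {Ω : Type*} [MeasurableSpace Ω] {P : Measure Ω}
    [IsProbabilityMeasure P] {F : E → Ω → E} (hF : ∀ x, Measurable (F x))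
    (h : ∀ (J : ℕ) (η y : Fin J → E) (a : E),
      charFun P F η (fun k => y k + a) = charFun P F η y) : TranslationInvariant P F := by
  intro x S hS a
  have hfin : ∀ n : ℕ, P (⋂ k : Fin n, F (x k + a) ⁻¹' S k) = P (⋂ k : Fin n, F (x k) ⁻¹' S k) := by
    intro n
    have h1 := map_eq_of_charFun_eq hF (y := fun k : Fin n => x k + a) (y' := fun k : Fin n => x k)
      fun η => h n η _ a
    have hm : ∀ z : Fin n → E, Measurable fun ω k => F (z k) ω := fun z =>
      measurable_pi_lambda _ fun k => hF _
    have hT : MeasurableSet (univ.pi fun k : Fin n => S k) := .univ_pi fun k => hS _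
    have h2 := congrArg (fun m => m (univ.pi fun k : Fin n => S k)) h1
    simp only [Measure.map_apply (hm _) hT] at h2
    convert h2 using 2 <;> ext ω <;> simp
  have hlim : ∀ b : E, Tendsto (fun n : ℕ => P (⋂ k : Fin n, F (x k + b) ⁻¹' S k)) atTop
      (𝓝 (P (⋂ k, F (x k + b) ⁻¹' S k))) := by
    intro b
    have h1 : ⋂ k, F (x k + b) ⁻¹' S k = ⋂ n : ℕ, ⋂ k : Fin n, F (x k + b) ⁻¹' S k := by
      ext ω
      simp only [mem_iInter]
      exact ⟨fun h n k => h k, fun h k => h (k + 1) ⟨k, k.lt_succ_self⟩⟩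
    rw [h1]
    refine tendsto_measure_iInter_atTop (fun n => ?_) (fun n m hnm => ?_) ⟨0, measure_ne_top _ _⟩
    · exact (MeasurableSet.iInter fun k => (hF _) (hS _)).nullMeasurableSet
    · exact fun ω hω => mem_iInter.2 fun k => mem_iInter.1 hω ⟨k, k.2.trans_le hnm⟩
  refine tendsto_nhds_unique (hlim a) ?_
  have h2 := hlim 0
  simp only [add_zero] at h2
  exact h2.congr fun n => (hfin n).symm

/-! ### The field of a cloud as a sum over scatterers -/

theorem integral_eq_zero_of_odd {F : Type*} [NormedAddCommGroup F] [NormedSpace ℝ F] {f : E → F}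
    (h : ∀ u, f (-u) = -f u) : ∫ u, f u = 0 := by
  have h1 := integral_neg_eq_self f (volume : Measure E)
  simp_rw [h, integral_neg] at h1
  have h2 : (2 : ℝ) • ∫ u, f u = 0 := by
    rw [two_smul]
    nth_rw 1 [← h1]
    exact neg_add_cancel _
  exact (smul_eq_zero.1 h2).resolve_left two_ne_zero

theorem centralForce_radialProfile {Φ : E → ℝ} (hΦ : ∀ x y : E, ‖x‖ = ‖y‖ → Φ x = Φ y) (x : E)
    (p : E × I) : centralForce (radialProfile Φ) x p = -((p.2 : ℝ) • gradient Φ (x - p.1)) := by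
  rw [gradient_radial_eq hΦ, centralForce, mul_smul, smul_neg, neg_neg]

theorem truncatedField_eq_cloudSum {Φ : E → ℝ} (hΦ : ∀ x y : E, ‖x‖ = ‖y‖ → Φ x = Φ y)
    {D : ℝ → Set E} {R : ℝ} (hD : Bornology.IsBounded (D R)) (hDm : MeasurableSet (D R)) (x : E)
    (ω : ChargedConfiguration I) :
    truncatedField Φ D R x ω = cloudSum (D R) (centralForce (radialProfile Φ) x) ω := by
  rw [truncatedField, finsum_mem_eq_finite_toFinset_sum _ (ω.finite_of_isBounded hD), cloudSum,
    ω.integral_pointMeasure hD hDm, ← Finset.sum_neg_distrib]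
  exact Finset.sum_congr rfl fun p _ => (centralForce_radialProfile hΦ x p).symm

/-- The gradient of `Φ`, set equal to zero in the unit ball. -/
def farGradient (Φ : E → ℝ) : E → E := (Metric.ball (0 : E) 1)ᶜ.indicator (gradient Φ)

theorem measurable_farGradient (Φ : E → ℝ) : Measurable (farGradient Φ) :=
  (measurable_gradient Φ).indicator Metric.isOpen_ball.measurableSet.compl

theorem farForce_radialProfile {Φ : E → ℝ} (hΦ : ∀ x y : E, ‖x‖ = ‖y‖ → Φ x = Φ y) (x : E)
    (p : E × I) : farForce (radialProfile Φ) x p = -((p.2 : ℝ) • farGradient Φ (x - p.1)) := by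
  rw [farForce_eq, farGradient, ← smul_neg]
  congr 1
  by_cases hp : x - p.1 ∈ (Metric.ball (0 : E) 1)ᶜ
  · rw [indicator_of_mem hp, indicator_of_mem hp, gradient_radial_eq hΦ, neg_neg]
  · rw [indicator_of_notMem hp, indicator_of_notMem hp, neg_zero]

theorem IsInClass.locallyIntegrable_farGradient {s A : ℝ} {Φ : E → ℝ} (hΦ : IsInClass s A Φ)
    (hs : 1 / 2 < s) : LocallyIntegrable (farGradient Φ) := by
  rw [MeasureTheory.locallyIntegrable_iff]
  intro K hK
  have h1 : IntegrableOn (fun u => ‖farGradient Φ u‖ ^ 2) K := by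
    have h2 := (integrable_indicator_iff (Metric.isOpen_ball.measurableSet.compl)).2
      (hΦ.isForceProfile hs).integrable_sq
    refine (h2.congr (.of_forall fun u => ?_)).integrableOn
    by_cases hu : u ∈ (Metric.ball (0 : E) 1)ᶜ
    · simp only [farGradient, indicator_of_mem hu]
      rw [hΦ.gradient_eq, norm_neg]
    · simp only [farGradient, indicator_of_notMem hu]
      simp
  have : IsFiniteMeasure ((volume : Measure E).restrict K) :=
    ⟨by simpa using hK.measure_lt_top⟩
  have hm := measurable_farGradient Φ
  rw [IntegrableOn, ← integrable_norm_iff hm.aestronglyMeasurable]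
  exact integrable_of_integrable_sq hm.norm.aestronglyMeasurable h1

/-- The compensator sees the charges only through their mean, so neutrality removes it altogether.
-/
theorem IsInClass.setIntegral_farForce {s A : ℝ} {Φ : E → ℝ} (hΦ : IsInClass s A Φ)
    (hs : 1 / 2 < s) (μ : Measure I) [IsProbabilityMeasure μ] (x : E) {D : Set E}
    (hD : Bornology.IsBounded D) :
    ∫ p in D ×ˢ univ, farForce (radialProfile Φ) x p ∂(intensity μ) =
      -(meanCharge μ • ∫ z in D, farGradient Φ (x - z)) := by
  have hint : IntegrableOn (fun z => farGradient Φ (x - z)) D := by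
    have h1 : IntegrableOn (farGradient Φ) ((fun z => x - z) '' closure D) :=
      (hΦ.locallyIntegrable_farGradient hs).integrableOn_isCompact
        (hD.isCompact_closure.image (by fun_prop))
    have h2 := (Measure.measurePreserving_sub_left (volume : Measure E) x).integrableOn_image
      (MeasurableEquiv.subLeft x).measurableEmbedding (f := farGradient Φ) (s := closure D)
    exact (h2.1 h1).mono_set subset_closure
  simp_rw [farForce_radialProfile hΦ.radial]
  rw [intensity, setIntegral_prod_marks]
  · rw [meanCharge, Finset.sum_smul, ← Finset.sum_neg_distrib]
    refine Finset.sum_congr rfl fun q _ => ?_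
    simp only
    rw [integral_neg, integral_smul, smul_neg, smul_smul]
  · exact fun q => (hint.smul (q : ℝ)).neg

/-! ### Admissible cutoffs -/

/-- Replacing the sharp cutoff at radius one by any admissible `ξ` changes the compensator by an odd
integrable field. Its integral vanishes, so all admissible cutoffs give the same characteristic
functional. -/
theorem IsInClass.integrable_cutoff {s A : ℝ} {Φ : E → ℝ} (hΦ : IsInClass s A Φ) {ξ : E → ℝ}
    (hξ : IsAdmissible Φ ξ) :
    Integrable (fun u => ξ u • gradient Φ u - farGradient Φ u) ∧
      ∀ u, ξ (-u) • gradient Φ (-u) - farGradient Φ (-u) =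
        -(ξ u • gradient Φ u - farGradient Φ u) := by
  have hball : MeasurableSet (Metric.ball (0 : E) 1) := Metric.isOpen_ball.measurableSet
  have hfar : ∀ u, farGradient Φ (-u) = -farGradient Φ u := by
    intro u
    have hiff : -u ∈ (Metric.ball (0 : E) 1)ᶜ ↔ u ∈ (Metric.ball (0 : E) 1)ᶜ := by simp
    by_cases hu : u ∈ (Metric.ball (0 : E) 1)ᶜ
    · rw [farGradient, indicator_of_mem hu, indicator_of_mem (hiff.2 hu), hΦ.gradient_neg]
    · rw [farGradient, indicator_of_notMem hu, indicator_of_notMem (hiff.not.2 hu), neg_zero]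
  have hind : (∀ u, 1 ≤ ‖u‖ → ξ u = 1) → (fun u => ξ u • gradient Φ u - farGradient Φ u) =
      (Metric.ball (0 : E) 1).indicator fun u => ξ u • gradient Φ u := by
    intro h1
    ext1 u
    by_cases hu : u ∈ Metric.ball (0 : E) 1
    · rw [indicator_of_mem hu, farGradient, indicator_of_notMem (by simpa using hu), sub_zero]
    · rw [indicator_of_notMem hu, farGradient, indicator_of_mem hu, h1 u (by simpa using hu),
        one_smul, sub_self]
  rcases hξ with ⟨-, hξ⟩ | ⟨hint, rfl⟩
  · refine ⟨?_, fun u => ?_⟩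
    · rw [hind hξ.eq_one, integrable_indicator_iff hball]
      have h2 : ContinuousOn (fun u => ξ u • gradient Φ u)
          (Metric.closedBall 0 1 \ Metric.ball 0 (1 / 2)) := by
        refine hξ.contDiff.continuous.continuousOn.smul (hΦ.continuousOn_gradient.mono ?_)
        rintro u ⟨-, hu⟩ rfl
        simp at hu
      have h3 := h2.integrableOn_compact (μ := volume)
        ((isCompact_closedBall (0 : E) 1).diff Metric.isOpen_ball)
      have h4 : IntegrableOn (fun u => ξ u • gradient Φ u) (Metric.ball 0 (1 / 2)) := by
        refine integrableOn_zero.congr_fun (fun u hu => ?_) Metric.isOpen_ball.measurableSet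
        rw [hξ.eq_zero u (by simpa using (Metric.mem_ball.1 hu).le), zero_smul]
      refine (h3.union h4).mono_set fun u hu => ?_
      by_cases hu' : u ∈ Metric.ball (0 : E) (1 / 2)
      · exact .inr hu'
      · exact .inl ⟨Metric.ball_subset_closedBall hu, hu'⟩
    · rw [hξ.radial (-u) u (norm_neg u), hΦ.gradient_neg, hfar, smul_neg]
      abel
  · refine ⟨?_, fun u => ?_⟩
    · rw [hind fun _ _ => rfl, integrable_indicator_iff hball]
      simp only [one_smul]
      exact hint
    · rw [hΦ.gradient_neg, hfar, smul_neg]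
      abel

open ChargedConfiguration

/-! ### The limit field -/

section Class

variable {s A : ℝ} {Φ : E → ℝ} (hΦ : IsInClass s A Φ) (hs : 1 / 2 < s)
include hΦ

/-- The integrand of the characteristic functional, with a sharp cutoff. -/
def sharpIntegrand (Φ : E → ℝ) {J : ℕ} (η y : Fin J → E) (p : E × I) : ℂ :=
  Complex.exp (((∑ k, inner ℝ (η k) (centralForce (radialProfile Φ) (y k) p) : ℝ) : ℂ) *
    Complex.I) - 1 - ((∑ k, inner ℝ (η k) (farForce (radialProfile Φ) (y k) p) : ℝ) : ℂ) * Complex.I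

include hs in
theorem IsInClass.integrable_sharpIntegrand (μ : Measure I) [IsProbabilityMeasure μ] {J : ℕ}
    (η y : Fin J → E) : Integrable (sharpIntegrand Φ η y) (intensity μ) :=
  (integrable_exp_sum_sub_one_sub (K := fun x => Metric.ball x 1)
    (fun _ => Metric.isBounded_ball) (fun _ => Metric.isOpen_ball.measurableSet)
    (measurable_centralForce (measurable_radialProfile Φ))
    (fun x => (hΦ.isForceProfile hs).integrable_sq_farForce μ x) η y).2

include hs in
theorem IsInClass.integrable_sharpIntegrand_section {J : ℕ} (η y : Fin J → E) (q : I) :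
    Integrable fun z => sharpIntegrand Φ η y (z, q) := by
  have h1 := hΦ.integrable_sharpIntegrand hs (Measure.dirac q) η y
  rw [intensity, Measure.prod_dirac] at h1
  exact h1.comp_measurable (f := fun z : E => (z, q)) (by fun_prop)

theorem IsInClass.functionalIntegrand_eq (ξ : E → ℝ) {J : ℕ} (η y : Fin J → E) (q : I) (z : E) :
    functionalIntegrand Φ ξ (q : ℝ) η y z = sharpIntegrand Φ η y (z, q) +
      Complex.I * ((∑ k, inner ℝ (η k) ((q : ℝ) • (ξ (y k - z) • gradient Φ (y k - z) -
        farGradient Φ (y k - z))) : ℝ) : ℂ) := by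
  unfold functionalIntegrand sharpIntegrand
  simp_rw [centralForce_radialProfile hΦ.radial, farForce_radialProfile hΦ.radial, inner_neg_right,
    inner_smul_right, inner_sub_right, inner_smul_right, Finset.sum_neg_distrib, Finset.mul_sum,
    mul_sub, Finset.sum_sub_distrib]
  have h1 : ∀ k, (q : ℝ) * (inner ℝ (η k) (gradient Φ (y k - z)) * ξ (y k - z)) =
      (q : ℝ) * (ξ (y k - z) * inner ℝ (η k) (gradient Φ (y k - z))) := fun k => by ring
  simp_rw [h1]
  push_cast
  ring_nf

include hs in
theorem IsInClass.integral_functionalIntegrand {ξ : E → ℝ} (hξ : IsAdmissible Φ ξ) {J : ℕ}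
    (η y : Fin J → E) (q : I) :
    Integrable (functionalIntegrand Φ ξ (q : ℝ) η y) ∧
      ∫ z, functionalIntegrand Φ ξ (q : ℝ) η y z = ∫ z, sharpIntegrand Φ η y (z, q) := by
  obtain ⟨hw, hodd⟩ := hΦ.integrable_cutoff hξ
  set w : E → E := fun u => ξ u • gradient Φ u - farGradient Φ u
  have h1 := hΦ.integrable_sharpIntegrand_section hs η y q
  have h2 : ∀ k, Integrable (fun z => inner ℝ (η k) ((q : ℝ) • w (y k - z))) := fun k =>
    ((hw.comp_sub_left (y k)).smul (q : ℝ)).const_inner (η k)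
  have h3 : Integrable fun z => ∑ k, inner ℝ (η k) ((q : ℝ) • w (y k - z)) :=
    integrable_finsetSum _ fun k _ => h2 k
  have h4 : functionalIntegrand Φ ξ (q : ℝ) η y = fun z => sharpIntegrand Φ η y (z, q) +
      Complex.I * ((∑ k, inner ℝ (η k) ((q : ℝ) • w (y k - z)) : ℝ) : ℂ) :=
    funext fun z => hΦ.functionalIntegrand_eq ξ η y q z
  have h5 : Integrable fun z => Complex.I *
      ((∑ k, inner ℝ (η k) ((q : ℝ) • w (y k - z)) : ℝ) : ℂ) := (h3.ofReal).const_mul _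
  rw [h4]
  refine ⟨h1.add h5, ?_⟩
  rw [integral_add h1 h5, integral_const_mul, integral_complex_ofReal,
    integral_finsetSum _ fun k _ => h2 k]
  have h6 : ∀ k, ∫ z, inner ℝ (η k) ((q : ℝ) • w (y k - z)) = 0 := by
    intro k
    rw [integral_sub_left_eq_self (fun u => inner ℝ (η k) ((q : ℝ) • w u)) volume (y k)]
    refine integral_eq_zero_of_odd fun u => ?_
    rw [show w (-u) = -w u from hodd u, smul_neg, inner_neg_right]
  simp [h6]

include hs in
theorem IsInClass.integral_sharpIntegrand (μ : Measure I) [IsProbabilityMeasure μ] {J : ℕ}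
    (η y : Fin J → E) : ∫ p, sharpIntegrand Φ η y p ∂(intensity μ) =
      ∑ q : I, ((μ.real {q} : ℝ) : ℂ) * ∫ z, sharpIntegrand Φ η y (z, q) := by
  have h1 := setIntegral_prod_marks μ (B := univ) (f := sharpIntegrand Φ η y) fun q =>
    (hΦ.integrable_sharpIntegrand_section hs η y q).integrableOn
  simpa [intensity, univ_prod_univ] using h1

omit hΦ in
theorem integral_sharpIntegrand_translate (μ : Measure I) [IsProbabilityMeasure μ] {J : ℕ}
    (η y : Fin J → E) (a : E) :
    ∫ p, sharpIntegrand Φ η (fun k => y k + a) p ∂(intensity μ) =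
      ∫ p, sharpIntegrand Φ η y p ∂(intensity μ) := by
  have hmp : MeasurePreserving (Prod.map (fun z : E => z + a) (id : I → I))
      (intensity μ) (intensity μ) :=
    (measurePreserving_add_right volume a).prod (MeasurePreserving.id μ)
  have hemb : MeasurableEmbedding (Prod.map (fun z : E => z + a) (id : I → I)) :=
    (MeasurableEquiv.prodCongr (MeasurableEquiv.addRight a) (.refl I)).measurableEmbedding
  rw [← hmp.integral_comp hemb]
  refine integral_congr_ae (.of_forall fun p => ?_)
  simp only [sharpIntegrand, centralForce, farForce_eq, Prod.map_fst, Prod.map_snd, id,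
    add_sub_add_right_eq_sub]

include hs in
-- The far sums are centred by their own mean, which is an explicit integral over `D R`. After
-- adding a deterministic background `c R x`, convergence in law to `F₀ + M` needs only the
-- convergence of one vector for each `x`, and `F₀` does not depend on the regions.
theorem IsScattererDistribution.exists_holtsmarkField {μ : Measure I}
    [IsProbabilityMeasure μ] {P : Measure (ChargedConfiguration I)} [IsProbabilityMeasure P]
    (hP : IsScattererDistribution μ P) :
    ∃ F₀ : E → ChargedConfiguration I → E,
      (∀ x, Measurable (F₀ x)) ∧ TranslationInvariant P F₀ ∧
      (∀ M : E → E, IsHoltsmarkField μ P Φ M (fun x ω => F₀ x ω + M x)) ∧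
      ∀ (D : ℝ → Set E) (c : ℝ → E → E) (M : E → E), Exhausts D →
        (∀ x, Tendsto (fun R => -(meanCharge μ • ∫ z in D R, farGradient Φ (x - z)) + c R x) atTop
          (𝓝 (M x))) →
        (μ {q : I | (q : ℝ) ≠ 0} = 0 → ∀ R x, c R x = 0) →
        ConvergesInLaw P (fun R x ω => truncatedField Φ D R x ω + c R x)
          (fun x ω => F₀ x ω + M x) := by
  have hprof := hΦ.isForceProfile hs
  have hfm : ∀ x, Measurable (centralForce (I := I) (radialProfile Φ) x) :=
    measurable_centralForce (measurable_radialProfile Φ)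
  have hex : ∀ x, ∃ F : ChargedConfiguration I → E, Measurable F ∧
      (IntegrableOn (centralForce (radialProfile Φ) x) (Metric.ball x 1 ×ˢ univ) (intensity μ) →
        Integrable F P ∧ ∫ ω, F ω ∂P = ∫ p in Metric.ball x 1 ×ˢ univ,
          centralForce (radialProfile Φ) x p ∂(intensity μ)) ∧
      ∀ D : ℝ → Set E, Exhausts D →
        Tendsto (fun R => eLpNorm (fun ω => cloudSum (D R) (centralForce (radialProfile Φ) x) ω -
          ∫ p in D R ×ˢ univ, farForce (radialProfile Φ) x p ∂(intensity μ) - F ω) 1 P) atTop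
          (𝓝 0) := fun x =>
    hP.exists_totalSum Metric.isBounded_ball Metric.isOpen_ball.measurableSet (hfm x)
      (hprof.integrable_sq_farForce μ x)
  choose F₀ hF₀m hF₀i hF₀ using hex
  have hchar : ∀ (M : E → E) (J : ℕ) (η y : Fin J → E),
      charFun P (fun x ω => F₀ x ω + M x) η y =
      Complex.exp (Complex.I * ((∑ k, inner ℝ (η k) (M (y k)) : ℝ) : ℂ)) *
        Complex.exp (∫ p, sharpIntegrand Φ η y p ∂(intensity μ)) := fun M J η y =>
    hP.charFun_totalSum (K := fun x => Metric.ball x 1) (fun _ => Metric.isBounded_ball)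
      (fun _ => Metric.isOpen_ball.measurableSet) hfm (hprof.integrable_sq_farForce μ) hF₀m hF₀ M η y
  refine ⟨F₀, hF₀m, ?_, fun M => ?_, fun D c M hD hM hdeg => ?_⟩
  · refine translationInvariant_of_charFun hF₀m fun J η y a => ?_
    have h1 := hchar (fun _ => 0) J η
    simp only [add_zero, inner_zero_right, Finset.sum_const_zero] at h1
    rw [h1, h1, integral_sharpIntegrand_translate]
  · refine ⟨fun x => (hF₀m x).add_const _, fun ξ hξ q J η y =>
      (hΦ.integral_functionalIntegrand hs hξ η y q).1, fun ξ hξ J η y => ?_, fun hint x => ?_⟩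
    · rw [hchar, limitFunctional, hΦ.integral_sharpIntegrand hs]
      simp_rw [fun q => (hΦ.integral_functionalIntegrand hs hξ η y q).2]
    · have hsub : IntegrableOn (fun z => gradient Φ (x - z)) (Metric.ball x 1) := by
        have h2 := (Measure.measurePreserving_sub_left (volume : Measure E) x).integrableOn_image
          (MeasurableEquiv.subLeft x).measurableEmbedding (f := gradient Φ) (s := Metric.ball x 1)
        refine h2.1 (hint.mono_set ?_)
        rintro _ ⟨z, hz, rfl⟩
        simpa [dist_eq_norm, norm_sub_rev] using hz
      -- The scatterers within distance one are not centred, but their expected force vanishes by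
      -- oddness, so `F₀` has mean zero.
      have hzero : ∫ z in Metric.ball x 1, gradient Φ (x - z) = 0 := by
        rw [← integral_indicator Metric.isOpen_ball.measurableSet]
        have h3 : ((Metric.ball x 1).indicator fun z => gradient Φ (x - z)) =
            fun z => (Metric.ball (0 : E) 1).indicator (gradient Φ) (x - z) := by
          ext1 z
          have : z ∈ Metric.ball x 1 ↔ x - z ∈ Metric.ball (0 : E) 1 := by
            simp [dist_eq_norm, norm_sub_rev]
          by_cases hz : z ∈ Metric.ball x 1
          · rw [indicator_of_mem hz, indicator_of_mem (this.1 hz)]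
          · rw [indicator_of_notMem hz, indicator_of_notMem (this.not.1 hz)]
        rw [h3, integral_sub_left_eq_self (fun u => (Metric.ball (0 : E) 1).indicator (gradient Φ) u)
          volume x]
        refine integral_eq_zero_of_odd fun u => ?_
        have hiff : -u ∈ Metric.ball (0 : E) 1 ↔ u ∈ Metric.ball (0 : E) 1 := by simp
        by_cases hu : u ∈ Metric.ball (0 : E) 1
        · rw [indicator_of_mem hu, indicator_of_mem (hiff.2 hu), hΦ.gradient_neg]
        · rw [indicator_of_notMem hu, indicator_of_notMem (hiff.not.2 hu), neg_zero]
      have hsec : ∀ q : I, IntegrableOn (fun z => centralForce (radialProfile Φ) x (z, q))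
          (Metric.ball x 1) := by
        intro q
        simp_rw [centralForce_radialProfile hΦ.radial]
        exact (hsub.smul (q : ℝ)).neg
      have := isFiniteMeasure_intensity μ (Metric.isBounded_ball (x := x) (r := 1))
      have hprod : IntegrableOn (centralForce (radialProfile Φ) x) (Metric.ball x 1 ×ˢ univ)
          (intensity μ) := by
        have h : (volume.prod μ).restrict (Metric.ball x 1 ×ˢ (univ : Set I)) =
            (volume.restrict (Metric.ball x 1)).prod μ := by
          rw [← Measure.prod_restrict, Measure.restrict_univ]
        rw [IntegrableOn, intensity, h, integrable_prod_iff' (hfm x).aestronglyMeasurable]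
        exact ⟨.of_forall hsec, .of_finite⟩
      obtain ⟨h1, h2⟩ := hF₀i x hprod
      refine ⟨h1.add (integrable_const _), ?_⟩
      have h4 : ∫ p in Metric.ball x 1 ×ˢ univ, centralForce (radialProfile Φ) x p ∂(intensity μ)
          = 0 := by
        rw [intensity, setIntegral_prod_marks μ hsec]
        simp_rw [centralForce_radialProfile hΦ.radial, integral_neg, integral_smul, hzero]
        simp
      rw [integral_add h1 (integrable_const _), h2, h4]
      simp
  · have hcloud : ∀ R, 0 < R → ∀ x, (fun ω => truncatedField Φ D R x ω + c R x) =
        fun ω => cloudSum (D R) (centralForce (I := I) (radialProfile Φ) x) ω + c R x := by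
      intro R hR x
      ext1 ω
      rw [truncatedField_eq_cloudSum hΦ.radial (hD.isBounded R hR) (hD.measurableSet R hR)]
    have hmeas : ∀ R, 0 < R → ∀ x, Measurable fun ω : ChargedConfiguration I =>
        truncatedField Φ D R x ω + c R x := by
      intro R hR x
      rw [hcloud R hR x]
      exact (measurable_cloudSum (hD.isBounded R hR) (hD.measurableSet R hR) (hfm x)).add_const _
    have hmean : ∀ x, Tendsto (fun R => (∫ p in D R ×ˢ univ, farForce (radialProfile Φ) x p
        ∂(intensity μ)) + c R x) atTop (𝓝 (M x)) := by
      intro x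
      refine (hM x).congr' ?_
      filter_upwards [eventually_gt_atTop 0] with R hR
      rw [hΦ.setIntegral_farForce hs μ x (hD.isBounded R hR)]
    have hL1 : ∀ x, Tendsto (fun R => eLpNorm (fun ω =>
        cloudSum (D R) (centralForce (radialProfile Φ) x) ω + c R x - (F₀ x ω + M x)) 1 P) atTop
        (𝓝 0) := by
      intro x
      have h1 : Tendsto (fun R => eLpNorm (fun _ : ChargedConfiguration I =>
          (∫ p in D R ×ˢ univ, farForce (radialProfile Φ) x p ∂(intensity μ)) + c R x - M x) 1 P)
          atTop (𝓝 0) := by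
        simp only [eLpNorm_const _ one_ne_zero (IsProbabilityMeasure.ne_zero P), measure_univ,
          ENNReal.one_rpow, mul_one]
        simpa using ((hmean x).sub_const (M x)).enorm
      have h2 := (hF₀ x D hD).add h1
      rw [add_zero] at h2
      refine tendsto_of_tendsto_of_tendsto_of_le_of_le' tendsto_const_nhds h2
        (.of_forall fun _ => zero_le) ?_
      filter_upwards [eventually_gt_atTop 0] with R hR
      refine le_trans (le_of_eq ?_) (eLpNorm_add_le
        (((measurable_cloudSum (hD.isBounded R hR) (hD.measurableSet R hR)
          (hfm x)).sub_const _).sub (hF₀m x)).aestronglyMeasurable aestronglyMeasurable_const le_rfl)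
      congr 1
      ext1 ω
      simp only [Pi.add_apply]
      abel
    refine ⟨hmeas, fun x => (hF₀m x).add_const _, fun x S hS => ?_, fun J η y => ?_⟩
    · refine (hP.tendsto_measure_preimage_cloudSum hprof hD x ((hF₀m x).add_const _) (hL1 x)
        (hmean x) (fun h R => hdeg h R x) hS).congr' ?_
      filter_upwards [eventually_gt_atTop 0] with R hR
      rw [hcloud R hR x]
    · refine tendsto_charFun_of_eLpNorm (by
        filter_upwards [eventually_gt_atTop 0] with R hR using hmeas R hR)
        (fun x => (hF₀m x).add_const _) (fun x => (hL1 x).congr' ?_) η y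
      filter_upwards [eventually_gt_atTop 0] with R hR
      rw [hcloud R hR x]
      rfl

end Class

/-! ### A smooth kernel agreeing with the power force at large distances -/

/-- A smooth function equal to `-s t ^ (-(s + 2) / 2)` for `a ≤ t`. -/
def kernelProfile (s a t : ℝ) : ℝ :=
  -s * (Real.smoothTransition (2 * t / a - 1) * t ^ (-(s + 2) / 2))

theorem contDiff_kernelProfile (s : ℝ) {a : ℝ} (ha : 0 < a) :
    ContDiff ℝ 2 (kernelProfile s a) := by
  rw [contDiff_iff_contDiffAt]
  intro t
  -- For `t ≤ a / 2` the transition factor vanishes, which hides the singularity of the power at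
  -- zero; for larger `t` the power is smooth.
  rcases lt_or_ge t (a / 2) with ht | ht
  · have h : kernelProfile s a =ᶠ[𝓝 t] fun _ => 0 := by
      filter_upwards [Iio_mem_nhds ht] with r hr
      rw [kernelProfile, Real.smoothTransition.zero_of_nonpos, zero_mul, mul_zero]
      rw [sub_nonpos, div_le_one ha]
      linarith [mem_Iio.1 hr]
    exact contDiffAt_const.congr_of_eventuallyEq h
  · have ht0 : t ≠ 0 := by linarith
    unfold kernelProfile
    refine contDiffAt_const.mul (ContDiffAt.mul ?_ (Real.contDiffAt_rpow_const_of_ne ht0))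
    refine (Real.smoothTransition.contDiffAt (n := 2)).comp t ?_
    exact ((contDiffAt_const.mul contDiffAt_id).div_const a).sub contDiffAt_const

theorem kernelProfile_eq (s : ℝ) {a t : ℝ} (ha : 0 < a) (h : a ≤ t) :
    kernelProfile s a t = -s * t ^ (-(s + 2) / 2) := by
  rw [kernelProfile, Real.smoothTransition.one_of_one_le, one_mul]
  rw [le_sub_iff_add_le, le_div_iff₀ ha]
  linarith

/-- A continuously differentiable odd vector field equal to `∇(1 / |y| ^ s)` for `δ ≤ |y|`. -/
def kernel (s δ : ℝ) (y : E) : E := kernelProfile s (δ ^ 2) (‖y‖ ^ 2) • y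

theorem kernel_neg (s δ : ℝ) (y : E) : kernel s δ (-y) = -kernel s δ y := by
  rw [kernel, norm_neg, smul_neg, kernel]

theorem kernel_eq (s : ℝ) {δ : ℝ} (hδ : 0 < δ) {y : E} (hy : δ ≤ ‖y‖) :
    kernel s δ y = gradient (powerPotential s) y := by
  rw [kernel, kernelProfile_eq s (by positivity) (pow_le_pow_left₀ hδ.le hy 2),
    gradient_powerPotential, ← Real.rpow_natCast, ← Real.rpow_mul (norm_nonneg y)]
  congr 3
  push_cast
  ring

theorem contDiff_kernel (s : ℝ) {δ : ℝ} (hδ : 0 < δ) : ContDiff ℝ 2 (kernel s δ) :=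
  ((contDiff_kernelProfile s (by positivity)).comp (contDiff_norm_sq ℝ)).smul contDiff_id

/-- The derivative of `kernel s δ`. -/
def kernelDeriv (s δ : ℝ) (y : E) : E →L[ℝ] E := fderiv ℝ (kernel s δ) y

theorem kernelDeriv_apply (s : ℝ) {δ : ℝ} (hδ : 0 < δ) (y w : E) :
    kernelDeriv s δ y w = kernelProfile s (δ ^ 2) (‖y‖ ^ 2) • w +
      (2 * deriv (kernelProfile s (δ ^ 2)) (‖y‖ ^ 2) * inner ℝ y w) • y := by
  have h1 : HasDerivAt (kernelProfile s (δ ^ 2)) (deriv (kernelProfile s (δ ^ 2)) (‖y‖ ^ 2))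
      (‖y‖ ^ 2) :=
    (((contDiff_kernelProfile s (by positivity)).differentiable (by norm_num)) _).hasDerivAt
  have h2 := (h1.comp_hasFDerivAt y (hasStrictFDerivAt_norm_sq y).hasFDerivAt).smul
    (hasFDerivAt_id y)
  have h3 : kernelDeriv s δ y = _ := h2.fderiv
  rw [h3]
  simp
  ring_nf

/-- A radial multiple of the position is a gradient field, so its Jacobian is symmetric. This lets
the divergence theorem be applied to a derivative in the wrong argument. -/
theorem inner_kernelDeriv_comm (s : ℝ) {δ : ℝ} (hδ : 0 < δ) (y v w : E) :
    inner ℝ v (kernelDeriv s δ y w) = inner ℝ (kernelDeriv s δ y v) w := by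
  rw [kernelDeriv_apply s hδ, kernelDeriv_apply s hδ]
  simp only [inner_add_left, inner_add_right, inner_smul_left, inner_smul_right, conj_trivial]
  rw [real_inner_comm v y]
  ring

theorem continuous_kernelDeriv (s : ℝ) {δ : ℝ} (hδ : 0 < δ) : Continuous (kernelDeriv s δ) :=
  (contDiff_kernel s hδ).continuous_fderiv (by norm_num)

/-! ### The force of a bounded domain -/

/-- The force at `h` exerted by the domain `U`. -/
def domainForce (s δ : ℝ) (U : Set E) (h : E) : E := ∫ v in U, kernel s δ (h - v)

/-- The derivative of the force exerted by the domain `U`. -/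
def domainForceDeriv (s δ : ℝ) (U : Set E) (h : E) : E →L[ℝ] E :=
  ∫ v in U, kernelDeriv s δ (h - v)

theorem integrableOn_comp_sub_of_continuous {F : Type*} [NormedAddCommGroup F] {k : E → F}
    (hk : Continuous k) {U : Set E} (hU : Bornology.IsBounded U) (h : E) :
    IntegrableOn (fun v => k (h - v)) U :=
  ((hk.comp (by fun_prop : Continuous fun v : E => h - v)).continuousOn.integrableOn_compact
    hU.isCompact_closure).mono_set subset_closure

theorem hasFDerivAt_domainForce (s : ℝ) {δ : ℝ} (hδ : 0 < δ) {U : Set E}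
    (hU : Bornology.IsBounded U) (h : E) :
    HasFDerivAt (domainForce s δ U) (domainForceDeriv s δ U h) h := by
  have hc := continuous_kernelDeriv s hδ
  have hk := (contDiff_kernel s hδ).continuous
  have hK : IsCompact ((fun p : E × E => p.1 - p.2) '' (Metric.closedBall h 1 ×ˢ closure U)) :=
    ((isCompact_closedBall h 1).prod hU.isCompact_closure).image (by fun_prop)
  obtain ⟨C, hC⟩ := hK.exists_bound_of_continuousOn hc.continuousOn
  have : IsFiniteMeasure ((volume : Measure E).restrict U) := ⟨by simpa using hU.measure_lt_top⟩
  refine hasFDerivAt_integral_of_dominated_of_fderiv_le (bound := fun _ => C)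
    (F' := fun x v => kernelDeriv s δ (x - v))
    (Metric.closedBall_mem_nhds h one_pos)
    (.of_forall fun x => (integrableOn_comp_sub_of_continuous hk hU x).1)
    (integrableOn_comp_sub_of_continuous hk hU h)
    (integrableOn_comp_sub_of_continuous hc hU h).1 ?_ (integrable_const _) ?_
  · have h1 : ∀ᵐ v ∂(volume.restrict U), v ∈ closure U := by
      refine ae_restrict_of_ae_restrict_of_subset subset_closure ?_
      exact ae_restrict_mem isClosed_closure.measurableSet
    filter_upwards [h1] with v hv x hx
    exact hC _ ⟨(x, v), ⟨hx, hv⟩, rfl⟩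
  · refine .of_forall fun v x _ => ?_
    have h2 := ((contDiff_kernel s hδ).differentiable (by norm_num) (x - v)).hasFDerivAt
    exact h2.comp x ((hasFDerivAt_id x).sub_const v)

theorem domainForceDeriv_apply (s : ℝ) {δ : ℝ} (hδ : 0 < δ) {U : Set E}
    (hU : Bornology.IsBounded U) (h w : E) :
    domainForceDeriv s δ U h w = ∫ v in U, kernelDeriv s δ (h - v) w :=
  ContinuousLinearMap.integral_apply
    (integrableOn_comp_sub_of_continuous (continuous_kernelDeriv s hδ) hU h) w

theorem inner_domainForceDeriv (s : ℝ) {δ : ℝ} (hδ : 0 < δ) {U : Set E}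
    (hU : Bornology.IsBounded U) (h v w : E) :
    inner ℝ v (domainForceDeriv s δ U h w) = ∫ z in U, inner ℝ v (kernelDeriv s δ (h - z) w) := by
  rw [domainForceDeriv_apply s hδ hU]
  exact (integral_inner (integrableOn_comp_sub_of_continuous
    (k := fun y => kernelDeriv s δ y w) ((continuous_kernelDeriv s hδ).clm_apply continuous_const)
      hU h) v).symm

/-! ### The trace of the derivative of the force -/

/-- The trace is the integral over `U` of the divergence of the kernel, and `div (ψ(|v|²) v) = 3 ψ +
2 |v|² ψ'`. -/
theorem sum_inner_domainForceDeriv (s : ℝ) {δ : ℝ} (hδ : 0 < δ) {U : Set E}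
    (hU : Bornology.IsBounded U) :
    ∑ i, inner ℝ (EuclideanSpace.basisFun (Fin 3) ℝ i)
      (domainForceDeriv s δ U 0 (EuclideanSpace.basisFun (Fin 3) ℝ i)) =
    ∫ v in U, (3 * kernelProfile s (δ ^ 2) (‖v‖ ^ 2) +
      2 * deriv (kernelProfile s (δ ^ 2)) (‖v‖ ^ 2) * ‖v‖ ^ 2) := by
  set b := EuclideanSpace.basisFun (Fin 3) ℝ
  simp_rw [inner_domainForceDeriv s hδ hU]
  rw [← integral_finsetSum]
  · refine integral_congr_ae (.of_forall fun v => ?_)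
    simp only [zero_sub]
    have h1 : ∀ i, inner ℝ (b i) (kernelDeriv s δ (-v) (b i)) = kernelProfile s (δ ^ 2) (‖v‖ ^ 2) +
        2 * deriv (kernelProfile s (δ ^ 2)) (‖v‖ ^ 2) * ‖inner ℝ (b i) v‖ ^ 2 := by
      intro i
      rw [kernelDeriv_apply s hδ, inner_add_right, inner_smul_right, inner_smul_right,
        real_inner_self_eq_norm_sq, b.norm_eq_one, norm_neg, inner_neg_right, inner_neg_left,
        real_inner_comm, Real.norm_eq_abs, sq_abs]
      ring
    simp_rw [h1]
    rw [Finset.sum_add_distrib, ← Finset.mul_sum, b.sum_sq_norm_inner_right]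
    simp
  · intro i _
    exact integrableOn_comp_sub_of_continuous (k := fun y => inner ℝ (b i) (kernelDeriv s δ y (b i)))
      (continuous_const.inner ((continuous_kernelDeriv s hδ).clm_apply continuous_const)) hU 0

theorem deriv_kernelProfile (s : ℝ) {a t : ℝ} (ha : 0 < a) (h : a ≤ t) :
    deriv (kernelProfile s a) t = -s * (-(s + 2) / 2 * t ^ (-(s + 2) / 2 - 1)) := by
  have hd : DifferentiableAt ℝ (kernelProfile s a) t :=
    (contDiff_kernelProfile s ha).differentiable (by norm_num) t
  have hu : UniqueDiffWithinAt ℝ (Ici a) t := uniqueDiffOn_Ici a t h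
  have hc : derivWithin (kernelProfile s a) (Ici a) t =
      derivWithin (fun r => -s * r ^ (-(s + 2) / 2)) (Ici a) t :=
    derivWithin_congr (fun r hr => kernelProfile_eq s ha hr) (kernelProfile_eq s ha h)
  rw [← hd.derivWithin hu, hc]
  exact (((Real.hasDerivAt_rpow_const (.inl (by linarith))).const_mul (-s)).hasDerivWithinAt).derivWithin hu

/-- In polar coordinates `r²` times the divergence is the derivative of `r³ ψ(r²)`, so only the flux
through the outer sphere counts. There the kernel is the true attractive field, with `ψ < 0`. -/
theorem integral_ball_kernelDiv_neg {s : ℝ} (hs : 0 < s) {δ : ℝ} (hδ : 0 < δ) {T : ℝ}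
    (hT : δ ≤ T) :
    ∫ v in Metric.ball (0 : E) T, (3 * kernelProfile s (δ ^ 2) (‖v‖ ^ 2) +
      2 * deriv (kernelProfile s (δ ^ 2)) (‖v‖ ^ 2) * ‖v‖ ^ 2) < 0 := by
  set ψ := kernelProfile s (δ ^ 2)
  have hψ : ContDiff ℝ 2 ψ := contDiff_kernelProfile s (by positivity)
  have hT0 : 0 < T := hδ.trans_le hT
  set f : ℝ → ℝ := fun r => 3 * ψ (r ^ 2) + 2 * deriv ψ (r ^ 2) * r ^ 2
  have h1 : ∫ v in Metric.ball (0 : E) T, f ‖v‖ = ∫ v : E, (Iio T).indicator f ‖v‖ := by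
    rw [← integral_indicator Metric.isOpen_ball.measurableSet]
    refine integral_congr_ae (.of_forall fun v => ?_)
    by_cases hv : ‖v‖ < T
    · simp only
      rw [indicator_of_mem (by simpa using hv), indicator_of_mem (mem_Iio.2 hv)]
    · simp only
      rw [indicator_of_notMem (by simpa using hv), indicator_of_notMem (by simpa using hv)]
  have hG : ∀ r : ℝ, HasDerivAt (fun r : ℝ => r ^ 3 * ψ (r ^ 2)) (r ^ 2 * f r) r := by
    intro r
    have h2 : HasDerivAt ψ (deriv ψ (r ^ 2)) (r ^ 2) :=
      (hψ.differentiable (by norm_num) _).hasDerivAt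
    have h2' : HasDerivAt (fun r : ℝ => ψ (r ^ 2)) (deriv ψ (r ^ 2) * (2 * r)) r := by
      have h3 := hasDerivAt_pow 2 r
      simp only [Nat.cast_ofNat, Nat.add_one_sub_one, pow_one] at h3
      exact HasDerivAt.comp (h := fun r : ℝ => r ^ 2) r h2 h3
    refine ((hasDerivAt_pow 3 r).mul h2').congr_deriv ?_
    simp only [f]
    push_cast
    ring
  have hcont : Continuous fun r : ℝ => r ^ 2 * f r := by
    have := hψ.continuous
    have := hψ.continuous_deriv (by norm_num)
    fun_prop
  have h4 : ∫ r in Ioi (0 : ℝ), r ^ 2 • (Iio T).indicator f r = T ^ 3 * ψ (T ^ 2) := by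
    have h5 : ∀ r : ℝ, r ^ 2 • (Iio T).indicator f r = (Iio T).indicator (fun r => r ^ 2 * f r) r := by
      intro r
      by_cases hr : r ∈ Iio T <;> simp [hr]
    simp_rw [h5]
    rw [setIntegral_indicator measurableSet_Iio, Ioi_inter_Iio, ← integral_Ioc_eq_integral_Ioo,
      ← intervalIntegral.integral_of_le hT0.le,
      intervalIntegral.integral_eq_sub_of_hasDerivAt (fun r _ => hG r)
        (hcont.intervalIntegrable _ _)]
    simp
  have h6 : ψ (T ^ 2) < 0 := by
    simp only [ψ]
    rw [kernelProfile_eq s (by positivity) (pow_le_pow_left₀ hδ.le hT 2)]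
    have : 0 < (T ^ 2) ^ (-(s + 2) / 2) := by positivity
    nlinarith
  change ∫ v in Metric.ball (0 : E) T, f ‖v‖ < 0
  rw [h1, integral_fun_norm_addHaar]
  simp only [finrank_euclideanSpace, Fintype.card_fin, nsmul_eq_mul, Nat.add_one_sub_one]
  rw [h4]
  have h7 : 0 < volume.real (Metric.ball (0 : E) 1) :=
    ENNReal.toReal_pos (Metric.measure_ball_pos _ _ one_pos).ne' measure_ball_lt_top.ne
  have h8 : T ^ 3 * ψ (T ^ 2) < 0 := mul_neg_of_pos_of_neg (by positivity) h6
  rw [smul_eq_mul]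
  exact mul_neg_of_pos_of_neg (by norm_num) (mul_neg_of_pos_of_neg h7 h8)

/-- The trace is negative. Compare with a ball of radius `T` containing `U`: its integral is
negative, and the part removed lies outside the ball of radius `δ`, where the divergence is `s (s -
1) |v|^(-s-2)`, which is nonnegative since `s ≥ 1`. -/
theorem domainForceDeriv_ne_zero {s : ℝ} (hs : 1 ≤ s) {δ : ℝ} (hδ : 0 < δ) {U : Set E}
    (hU : Bornology.IsBounded U) (hUm : MeasurableSet U) (hball : Metric.ball 0 δ ⊆ U) :
    domainForceDeriv s δ U 0 ≠ 0 := by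
  intro h0
  have h1 := sum_inner_domainForceDeriv s hδ hU
  rw [h0] at h1
  simp only [_root_.zero_apply, inner_zero_right, Finset.sum_const_zero] at h1
  obtain ⟨T, hT⟩ := hU.subset_ball_lt δ (0 : E)
  obtain ⟨hTδ, hUT⟩ := hT
  have h2 := integral_ball_kernelDiv_neg (s := s) (by linarith) hδ hTδ.le
  set ψ := kernelProfile s (δ ^ 2)
  have hψ : ContDiff ℝ 2 ψ := contDiff_kernelProfile s (by positivity)
  have hcont : Continuous fun v : E => 3 * ψ (‖v‖ ^ 2) + 2 * deriv ψ (‖v‖ ^ 2) * ‖v‖ ^ 2 := by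
    have := hψ.continuous
    have := hψ.continuous_deriv (by norm_num)
    fun_prop
  have hint : IntegrableOn (fun v : E => 3 * ψ (‖v‖ ^ 2) + 2 * deriv ψ (‖v‖ ^ 2) * ‖v‖ ^ 2)
      (Metric.ball 0 T) :=
    (hcont.continuousOn.integrableOn_compact (isCompact_closedBall (0 : E) T)).mono_set
      Metric.ball_subset_closedBall
  have h3 := setIntegral_sdiff hUm hint hUT
  have h4 : 0 ≤ ∫ v in Metric.ball (0 : E) T \ U,
      (3 * ψ (‖v‖ ^ 2) + 2 * deriv ψ (‖v‖ ^ 2) * ‖v‖ ^ 2) := by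
    refine setIntegral_nonneg (Metric.isOpen_ball.measurableSet.diff hUm) fun v hv => ?_
    have hv1 : δ ≤ ‖v‖ := by
      by_contra h
      exact hv.2 (hball (by simpa using h))
    have hv2 : δ ^ 2 ≤ ‖v‖ ^ 2 := pow_le_pow_left₀ hδ.le hv1 2
    have hv0 : 0 < ‖v‖ := hδ.trans_le hv1
    have hv3 : 0 < ‖v‖ ^ 2 := by positivity
    simp only [ψ]
    rw [kernelProfile_eq s (by positivity) hv2, deriv_kernelProfile s (by positivity) hv2,
      Real.rpow_sub_one hv3.ne']
    have h5 : 3 * (-s * (‖v‖ ^ 2) ^ (-(s + 2) / 2)) +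
        2 * (-s * (-(s + 2) / 2 * ((‖v‖ ^ 2) ^ (-(s + 2) / 2) / ‖v‖ ^ 2))) * ‖v‖ ^ 2 =
        s * (s - 1) * (‖v‖ ^ 2) ^ (-(s + 2) / 2) := by
      field_simp
      ring
    rw [h5]
    exact mul_nonneg (mul_nonneg (by linarith) (by linarith)) (by positivity)
  linarith

/-! ### Forces of large domains -/

theorem integrableOn_comp_sub_of_locallyIntegrable {k : E → E} (hk : LocallyIntegrable k) {D : Set E}
    (hD : Bornology.IsBounded D) (x : E) : IntegrableOn (fun z => k (x - z)) D := by
  have h1 : IntegrableOn k ((fun z => x - z) '' closure D) :=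
    hk.integrableOn_isCompact (hD.isCompact_closure.image (by fun_prop))
  have h2 := (Measure.measurePreserving_sub_left (volume : Measure E) x).integrableOn_image
    (MeasurableEquiv.subLeft x).measurableEmbedding (f := k) (s := closure D)
  exact (h2.1 h1).mono_set subset_closure

/-- The difference of the fields is odd about `x` and supported in a ball contained in `D`, so it
integrates to zero. This allows the singular force to be replaced by a smooth kernel. -/
theorem setIntegral_comp_sub_congr_of_odd {f g : E → E} (hf : LocallyIntegrable f)
    (hg : LocallyIntegrable g) (hfo : ∀ u, f (-u) = -f u) (hgo : ∀ u, g (-u) = -g u) {ρ : ℝ}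
    (hfg : ∀ u, ρ ≤ ‖u‖ → f u = g u) {x : E} {D : Set E} (hD : Bornology.IsBounded D)
    (hball : Metric.ball x ρ ⊆ D) : ∫ y in D, f (x - y) = ∫ y in D, g (x - y) := by
  rw [← sub_eq_zero, ← integral_sub (integrableOn_comp_sub_of_locallyIntegrable hf hD x)
    (integrableOn_comp_sub_of_locallyIntegrable hg hD x)]
  rw [setIntegral_eq_integral_of_forall_compl_eq_zero,
    integral_sub_left_eq_self (fun u => f u - g u) volume x]
  · refine integral_eq_zero_of_odd fun u => ?_
    rw [hfo, hgo]
    abel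
  · intro y hy
    rw [hfg, sub_self]
    by_contra h
    refine hy (hball ?_)
    rw [Metric.mem_ball, dist_comm, dist_eq_norm]
    exact not_le.1 h

theorem setIntegral_shifted_kernel (s : ℝ) {δ R : ℝ} (hR : 0 < R) (U : Set E) (c x : E) :
    ∫ y in (fun y => y - c) '' (R • U), R ^ (-s - 1) • kernel s δ (R⁻¹ • (x - y)) =
      R ^ (2 - s) • domainForce s δ U (R⁻¹ • (x + c)) := by
  have h1 := (measurePreserving_sub_right (volume : Measure E) c).setIntegral_image_emb
    (MeasurableEquiv.subRight c).measurableEmbedding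
    (fun y => R ^ (-s - 1) • kernel s δ (R⁻¹ • (x - y))) (R • U)
  have h2 := Measure.setIntegral_comp_smul_of_pos (volume : Measure E)
    (fun y => R ^ (-s - 1) • kernel s δ (R⁻¹ • (x - (y - c)))) U hR
  rw [finrank_euclideanSpace, Fintype.card_fin] at h2
  have h3 : ∫ y in R • U, R ^ (-s - 1) • kernel s δ (R⁻¹ • (x - (y - c))) =
      R ^ 3 • ∫ v in U, R ^ (-s - 1) • kernel s δ (R⁻¹ • (x - (R • v - c))) := by
    rw [h2, smul_smul, mul_inv_cancel₀ (by positivity), one_smul]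
  rw [h1, h3, integral_smul, smul_smul, domainForce]
  congr 1
  · rw [← Real.rpow_natCast, ← Real.rpow_add hR]
    congr 1
    push_cast
    ring
  · refine integral_congr_ae (.of_forall fun v => ?_)
    simp only
    congr 1
    rw [← sub_add, smul_add, smul_sub, smul_add, smul_smul, inv_mul_cancel₀ hR.ne', one_smul]
    abel

/-- The vector fields which are odd, locally integrable and equal to `∇(1 / |u| ^ s)` for
`|u| ≥ 1`. -/
structure IsPowerForce (s : ℝ) (f : E → E) : Prop where
  odd : ∀ u, f (-u) = -f u
  locallyIntegrable : LocallyIntegrable f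
  eq : ∀ u, 1 ≤ ‖u‖ → f u = gradient (powerPotential s) u

/-- The force is homogeneous of degree `-s - 1`, so the smooth kernel rescaled by `R` still equals
it beyond distance `R δ`. The discrepancy inside is odd and invisible. The change of variables
contributes `R³`, whence the exponent `2 - s`. -/
theorem IsPowerForce.setIntegral_eq {s : ℝ} {f : E → E} (hf : IsPowerForce s f) {δ R : ℝ}
    (hδ : 0 < δ) (hR : 0 < R) (hRδ : 1 ≤ R * δ) {U : Set E} (hU : Bornology.IsBounded U) {c x : E}
    (hball : Metric.ball x (R * δ) ⊆ (fun y => y - c) '' (R • U)) :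
    ∫ y in (fun y => y - c) '' (R • U), f (x - y) =
      R ^ (2 - s) • domainForce s δ U (R⁻¹ • (x + c)) := by
  rw [← setIntegral_shifted_kernel s hR]
  have hbdd : Bornology.IsBounded ((fun y => y - c) '' (R • U)) := by
    have h1 := (hU.smul₀ R).isCompact_closure.image (f := fun y : E => y - c) (by fun_prop)
    exact h1.isBounded.subset (image_mono subset_closure)
  have hcont : Continuous fun u : E => R ^ (-s - 1) • kernel s δ (R⁻¹ • u) :=
    by have := (contDiff_kernel s hδ).continuous; fun_prop
  refine setIntegral_comp_sub_congr_of_odd (g := fun u => R ^ (-s - 1) • kernel s δ (R⁻¹ • u))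
    hf.locallyIntegrable hcont.locallyIntegrable hf.odd (fun u => ?_) (fun u hu => ?_) hbdd hball
  · rw [smul_neg, kernel_neg, smul_neg]
  · have h1 : δ ≤ ‖R⁻¹ • u‖ := by
      rw [norm_smul, norm_inv, Real.norm_of_nonneg hR.le, le_inv_mul_iff₀ hR]
      exact hu
    rw [hf.eq u (hRδ.trans hu), kernel_eq s hδ h1, gradient_powerPotential, gradient_powerPotential,
      norm_smul, norm_inv, Real.norm_of_nonneg hR.le, Real.mul_rpow (by positivity) (by positivity),
      Real.inv_rpow hR.le, ← Real.rpow_neg hR.le, smul_smul, smul_smul]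
    congr 1
    have h2 : R ^ (-(-s - 2)) = R * R ^ (s + 1) := by
      rw [mul_comm R, ← Real.rpow_add_one hR.ne']
      congr 1
      ring
    have h3 : R ^ (-s - 1) * R ^ (s + 1) = 1 := by
      rw [← Real.rpow_add hR]
      simp
    rw [h2]
    have h4 : R * R⁻¹ = 1 := mul_inv_cancel₀ hR.ne'
    linear_combination (s * ‖u‖ ^ (-s - 2)) * (R * R⁻¹ * h3 + h4)

/-! ### Vector fields equal to the power force at large distances -/

theorem continuousOn_gradient_powerPotential (s : ℝ) :
    ContinuousOn (gradient (powerPotential s)) {0}ᶜ := by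
  simp_rw [funext (gradient_powerPotential s)]
  have h : ContinuousOn (fun u : E => ‖u‖ ^ (-s - 2)) {0}ᶜ :=
    continuous_norm.continuousOn.rpow_const fun u hu => .inl (norm_ne_zero_iff.2 hu)
  exact (continuousOn_const.mul h).smul continuousOn_id

theorem gradient_powerPotential_neg (s : ℝ) (u : E) :
    gradient (powerPotential s) (-u) = -gradient (powerPotential s) u :=
  gradient_radial_neg (powerPotential_radial s) u

theorem indicator_compl_ball_odd {k : E → E} (hk : ∀ u, k (-u) = -k u) (ρ : ℝ) (u : E) :
    (Metric.ball (0 : E) ρ)ᶜ.indicator k (-u) = -(Metric.ball (0 : E) ρ)ᶜ.indicator k u := by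
  have hiff : -u ∈ (Metric.ball (0 : E) ρ)ᶜ ↔ u ∈ (Metric.ball (0 : E) ρ)ᶜ := by simp
  by_cases hu : u ∈ (Metric.ball (0 : E) ρ)ᶜ
  · rw [indicator_of_mem hu, indicator_of_mem (hiff.2 hu), hk]
  · rw [indicator_of_notMem hu, indicator_of_notMem (hiff.not.2 hu), neg_zero]

theorem locallyIntegrable_indicator_compl_ball {k : E → E} (hk : ContinuousOn k {0}ᶜ) {ρ : ℝ}
    (hρ : 0 < ρ) : LocallyIntegrable ((Metric.ball (0 : E) ρ)ᶜ.indicator k) := by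
  rw [MeasureTheory.locallyIntegrable_iff]
  intro K hK
  rw [IntegrableOn, integrable_indicator_iff Metric.isOpen_ball.measurableSet.compl, IntegrableOn,
    Measure.restrict_restrict Metric.isOpen_ball.measurableSet.compl, inter_comm]
  refine (hk.mono ?_).integrableOn_compact (hK.inter_right Metric.isOpen_ball.isClosed_compl)
  rintro u ⟨-, hu⟩ rfl
  exact hu (Metric.mem_ball_self hρ)

theorem isPowerForce_farGradient (s : ℝ) : IsPowerForce s (farGradient (powerPotential s)) where
  odd := indicator_compl_ball_odd (gradient_powerPotential_neg s) 1
  locallyIntegrable :=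
    locallyIntegrable_indicator_compl_ball (continuousOn_gradient_powerPotential s) one_pos
  eq u hu := indicator_of_mem (by simpa using hu) _

theorem IsCutoff.isPowerForce (s : ℝ) {ξ : E → ℝ} (hξ : IsCutoff ξ) :
    IsPowerForce s fun u => ξ u • gradient (powerPotential s) u where
  odd u := by rw [hξ.radial (-u) u (norm_neg u), gradient_powerPotential_neg, smul_neg]
  locallyIntegrable := by
    refine Continuous.locallyIntegrable (continuous_iff_continuousAt.2 fun u => ?_)
    rcases eq_or_ne u 0 with rfl | hu
    · have h : (fun u => ξ u • gradient (powerPotential s) u) =ᶠ[𝓝 0] fun _ => 0 := by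
        filter_upwards [Metric.ball_mem_nhds (0 : E) (by norm_num : (0 : ℝ) < 1 / 2)] with u hu
        rw [hξ.eq_zero u (by simpa using (Metric.mem_ball.1 hu).le), zero_smul]
      exact continuousAt_const.congr h.symm
    · exact hξ.contDiff.continuous.continuousAt.smul
        ((continuousOn_gradient_powerPotential s).continuousAt (isOpen_compl_singleton.mem_nhds hu))
  eq u hu := by rw [hξ.eq_one u hu, one_smul]

/-- In polar coordinates the singularity at the origin is `r^(1-s)`, integrable for `s < 2`. -/
theorem isPowerForce_gradient {s : ℝ} (hs : s < 2) :
    IsPowerForce s (gradient (powerPotential s)) where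
  odd := gradient_powerPotential_neg s
  locallyIntegrable := by
    rw [MeasureTheory.locallyIntegrable_iff]
    intro K hK
    obtain ⟨T, hT0, hT⟩ := hK.isBounded.subset_ball_lt 0 (0 : E)
    have h1 : IntegrableOn (fun u : E => ‖u‖ ^ (-s - 1)) (Metric.ball 0 T) := by
      rw [integrableOn_fun_norm_addHaar volume (f := fun r : ℝ => r ^ (-s - 1))]
      have h2 : IntegrableOn (fun r : ℝ => r ^ (1 - s)) (Ioo 0 T) :=
        (intervalIntegral.integrableOn_Ioo_rpow_iff hT0).2 (by linarith)
      refine h2.congr_fun (fun r hr => ?_) measurableSet_Ioo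
      simp only [finrank_euclideanSpace, Fintype.card_fin, Nat.add_one_sub_one, smul_eq_mul]
      rw [← Real.rpow_natCast, ← Real.rpow_add hr.1]
      congr 1
      push_cast
      ring
    have h3 : ∀ᵐ u : E, u ≠ 0 := by simp [ae_iff]
    have h4 : IntegrableOn (gradient (powerPotential s)) (Metric.ball 0 T) :=
      (h1.const_mul |s|).mono' (measurable_gradient _).aestronglyMeasurable
        (ae_restrict_of_ae (h3.mono fun u hu => (norm_gradient_powerPotential s hu).le))
    exact h4.mono_set hT
  eq _ _ := rfl

/-- The forces in the domains `D R` converge to `m`, whatever the force at small distances. -/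
def HasMeanForce (s : ℝ) (D : ℝ → Set E) (m : E → E) : Prop :=
  ∀ f, IsPowerForce s f → ∀ x, Tendsto (fun R => ∫ y in D R, f (x - y)) atTop (𝓝 (m x))

theorem HasMeanForce.isLimitMeanForce {s : ℝ} {D : ℝ → Set E} {m : E → E}
    (h : HasMeanForce s D m) {I : Finset ℝ} (A : ℝ) (μ : Measure I) :
    IsLimitMeanForce s A μ D (fun x => (-A * meanCharge μ) • m x) := by
  rintro ξ (hξ | ⟨hs, rfl⟩) x
  · exact (h _ (hξ.isPowerForce s) x).const_smul _
  · simp_rw [one_smul]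
    exact (h _ (isPowerForce_gradient hs) x).const_smul _

theorem isLimitMeanForce_of_meanCharge_eq_zero {I : Finset ℝ} {μ : Measure I}
    (h : meanCharge μ = 0) (s A : ℝ) (D : ℝ → Set E) :
    IsLimitMeanForce s A μ D (fun _ => 0) := by
  intro ξ _ x
  simp [h]

theorem Exhausts.tendsto_setIntegral {D : ℝ → Set E} (hD : Exhausts D) {w : E → E}
    (hw : Integrable w) (x : E) :
    Tendsto (fun R => ∫ y in D R, w (x - y)) atTop (𝓝 (∫ u, w u)) := by
  rw [← integral_sub_left_eq_self w volume x]
  have hwx := hw.comp_sub_left x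
  have h1 : Tendsto (fun R => ∫ y, (D R).indicator (fun y => w (x - y)) y) atTop
      (𝓝 (∫ y, w (x - y))) := by
    refine tendsto_integral_filter_of_dominated_convergence (fun y => ‖w (x - y)‖) ?_ ?_ hwx.norm ?_
    · filter_upwards [eventually_gt_atTop 0] with R hR
      exact hwx.1.indicator (hD.measurableSet R hR)
    · exact .of_forall fun R => .of_forall fun y => norm_indicator_le_norm_self _ _
    · refine .of_forall fun y => tendsto_const_nhds.congr' ?_
      filter_upwards [hD.ball_subset (‖y‖ + 1)] with R hR
      rw [indicator_of_mem (hR (by simp))]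
  refine h1.congr' ?_
  filter_upwards [eventually_gt_atTop 0] with R hR
  rw [integral_indicator (hD.measurableSet R hR)]

theorem Exhausts.hasMeanForce_of_two_lt {D : ℝ → Set E} (hD : Exhausts D) {s : ℝ} (hs : 2 < s) :
    HasMeanForce s D (fun _ => 0) := by
  intro f hf x
  have hint : Integrable f := by
    rw [← integrableOn_univ, ← union_compl_self (Metric.ball (0 : E) 1)]
    refine IntegrableOn.union ?_ ?_
    · exact (hf.locallyIntegrable.integrableOn_isCompact (isCompact_closedBall (0 : E) 1)).mono_set
        Metric.ball_subset_closedBall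
    · have h3 : (3 : ℝ) < s + 1 := by linarith
      have h1 : IntegrableOn (gradient (powerPotential s)) (Metric.ball (0 : E) 1)ᶜ := by
        refine ((integrableOn_norm_rpow h3).const_mul |s|).mono'
          (measurable_gradient _).aestronglyMeasurable
          ((ae_restrict_iff' Metric.isOpen_ball.measurableSet.compl).2 (.of_forall fun u hu => ?_))
        have hu1 : 1 ≤ ‖u‖ := by simpa using hu
        rw [norm_gradient_powerPotential s (norm_ne_zero_iff.1 (by linarith)), neg_add,
          ← sub_eq_add_neg]
      exact h1.congr_fun (fun u hu => (hf.eq u (by simpa using hu)).symm)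
        Metric.isOpen_ball.measurableSet.compl
  rw [← integral_eq_zero_of_odd hf.odd]
  exact hD.tendsto_setIntegral hint x

/-- The difference from the pure power force is odd and integrable, so its integrals over exhausting
regions tend to zero. -/
theorem IsInClass.tendsto_setIntegral_farGradient {s A : ℝ} {Φ : E → ℝ} (hΦ : IsInClass s A Φ)
    {D : ℝ → Set E} (hD : Exhausts D) {m : E → E} (h : HasMeanForce s D m) (x : E) :
    Tendsto (fun R => ∫ y in D R, farGradient Φ (x - y)) atTop (𝓝 (A • m x)) := by
  set p := farGradient (powerPotential s)
  have hp := isPowerForce_farGradient s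
  have hball : MeasurableSet (Metric.ball (0 : E) 1)ᶜ := Metric.isOpen_ball.measurableSet.compl
  have hw : Integrable fun u => farGradient Φ u - A • p u := by
    have h1 := (integrable_indicator_iff hball).2 hΦ.integrableOn_gradient_sub
    refine h1.congr (.of_forall fun u => ?_)
    by_cases hu : u ∈ (Metric.ball (0 : E) 1)ᶜ
    · simp only [p, farGradient, indicator_of_mem hu]
    · simp only [p, farGradient, indicator_of_notMem hu, smul_zero, sub_zero]
  have h2 := (hD.tendsto_setIntegral hw x).add ((h p hp x).const_smul A)
  rw [integral_eq_zero_of_odd, zero_add] at h2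
  · refine h2.congr' ?_
    filter_upwards [eventually_gt_atTop 0] with R hR
    have h3 : IntegrableOn (fun y => A • p (x - y)) (D R) :=
      (integrableOn_comp_sub_of_locallyIntegrable hp.locallyIntegrable (hD.isBounded R hR) x).smul A
    rw [← integral_smul, ← integral_add (hw.comp_sub_left x).integrableOn h3]
    simp
  · intro u
    rw [show p (-u) = -p u from hp.odd u, show farGradient Φ (-u) = -farGradient Φ u from
      indicator_compl_ball_odd hΦ.gradient_neg 1 u, smul_neg]
    abel

/-! ### Dilated and displaced domains -/

theorem dilates_eq (U : Set E) (R : ℝ) : dilates U R = (fun y => y - (0 : E)) '' (R • U) := by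
  simp [dilates]

/-- The radius `2 δ` leaves room for both a displacement and a ball of size `R δ` after dilation. -/
theorem ball_subset_shifted {U : Set E} {δ : ℝ} (hU : Metric.ball 0 (2 * δ) ⊆ U) {R : ℝ}
    (hR : 0 < R) {x c : E} {ρ : ℝ} (hρ : ‖x + c‖ + ρ ≤ R * (2 * δ)) :
    Metric.ball x ρ ⊆ (fun y => y - c) '' (R • U) := by
  intro y hy
  refine ⟨y + c, ?_, by simp⟩
  refine (mem_smul_set_iff_inv_smul_mem₀ hR.ne' _ _).2 (hU ?_)
  rw [mem_ball_zero_iff, norm_smul, norm_inv, Real.norm_of_nonneg hR.le, inv_mul_lt_iff₀ hR]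
  refine lt_of_lt_of_le ?_ hρ
  have h1 : y + c = (x + c) + (y - x) := by abel
  rw [h1]
  refine (norm_add_le _ _).trans_lt ?_
  have h2 : ‖y - x‖ < ρ := by rwa [← dist_eq_norm]
  linarith

theorem exhausts_shifted {U : Set E} (hUo : IsOpen U) (hU : Bornology.IsBounded U) {δ : ℝ}
    (hδ : 0 < δ) (hball : Metric.ball 0 (2 * δ) ⊆ U) {c : ℝ → E}
    (hc : ∀ᶠ R in atTop, ‖c R‖ ≤ R * δ) : Exhausts fun R => (fun y => y - c R) '' (R • U) where
  isBounded R _ := by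
    have h1 := (hU.smul₀ R).isCompact_closure.image (f := fun y : E => y - c R) (by fun_prop)
    exact h1.isBounded.subset (image_mono subset_closure)
  measurableSet R hR :=
    ((Homeomorph.subRight (c R)).isOpenMap _ (hUo.smul₀ hR.ne')).measurableSet
  ball_subset ρ := by
    filter_upwards [hc, eventually_gt_atTop 0, eventually_ge_atTop (ρ / δ)] with R hR hR0 hRρ
    refine ball_subset_shifted hball hR0 ?_
    rw [zero_add]
    rw [div_le_iff₀ hδ] at hRρ
    linarith

theorem IsPowerForce.eventually_setIntegral_eq {s : ℝ} {f : E → E} (hf : IsPowerForce s f) {δ : ℝ}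
    (hδ : 0 < δ) {U : Set E} (hU : Bornology.IsBounded U) (hball : Metric.ball 0 (2 * δ) ⊆ U)
    {c : ℝ → E} {x : E} (hc : ∀ᶠ R in atTop, ‖x + c R‖ ≤ R * δ) :
    ∀ᶠ R in atTop, ∫ y in (fun y => y - c R) '' (R • U), f (x - y) =
      R ^ (2 - s) • domainForce s δ U (R⁻¹ • (x + c R)) := by
  filter_upwards [hc, eventually_gt_atTop 0, eventually_ge_atTop δ⁻¹] with R hR hR0 hRδ
  refine hf.setIntegral_eq hδ hR0 ?_ hU (ball_subset_shifted hball hR0 ?_)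
  · rw [← inv_mul_cancel₀ hδ.ne']
    exact mul_le_mul_of_nonneg_right hRδ hδ.le
  · linarith

/-- Balance is stated for a singular or sharply cut field; oddness transfers it to the smooth
kernel, since both fields agree outside a ball contained in `U`. -/
theorem domainForce_zero_of_odd {s δ : ℝ} (hδ : 0 < δ) {U : Set E}
    (hU : Bornology.IsBounded U) (hball : Metric.ball 0 δ ⊆ U) {f : E → E} {ρ : ℝ}
    (hρ : Metric.ball 0 ρ ⊆ U) (hfo : ∀ u, f (-u) = -f u) (hfl : LocallyIntegrable f)
    (hf : ∀ u, ρ ≤ ‖u‖ → f u = gradient (powerPotential s) u) (h0 : ∫ y in U, f y = 0) :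
    domainForce s δ U 0 = 0 := by
  have h1 := setIntegral_comp_sub_congr_of_odd (contDiff_kernel s hδ).continuous.locallyIntegrable
    hfl (kernel_neg s δ) hfo (ρ := max δ ρ) (x := 0) (D := U) (fun u hu => by
      rw [kernel_eq s hδ ((le_max_left _ _).trans hu), hf u ((le_max_right _ _).trans hu)]) hU (by
      rcases max_choice δ ρ with h | h <;> rw [h] <;> assumption)
  rw [domainForce, h1]
  simp_rw [zero_sub, hfo]
  rw [integral_neg, h0, neg_zero]

theorem IsBalanced.domainForce_zero {s δ : ℝ} (hδ : 0 < δ) {U : Set E}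
    (hU : Bornology.IsBounded U) (hball : Metric.ball 0 δ ⊆ U)
    (h : IsBalanced s U) : domainForce s δ U 0 = 0 := by
  obtain ⟨ρ, hρ, hρU, h0⟩ := h
  refine domainForce_zero_of_odd hδ hU hball hρU
    (indicator_compl_ball_odd (gradient_powerPotential_neg s) ρ)
    (locallyIntegrable_indicator_compl_ball (continuousOn_gradient_powerPotential s) hρ)
    (fun u hu => indicator_of_mem (by simpa using hu) _) ?_
  rw [setIntegral_indicator Metric.isOpen_ball.measurableSet.compl, ← Set.sdiff_eq, h0]

theorem IsCoulombBalanced.domainForce_zero {δ : ℝ} (hδ : 0 < δ) {U : Set E}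
    (hU : Bornology.IsBounded U) (hball : Metric.ball 0 δ ⊆ U)
    (h : IsCoulombBalanced U) : domainForce 1 δ U 0 = 0 :=
  have hp := isPowerForce_gradient (s := 1) (by norm_num)
  domainForce_zero_of_odd hδ hU hball hball hp.odd hp.locallyIntegrable (fun _ _ => rfl) h

/-- The limit force of the displaced domains `RU - R ^ (s - 1) e`. -/
def displacementForce (s δ : ℝ) (U : Set E) (e : E) : E :=
  if s < 2 then domainForceDeriv s δ U 0 e else domainForce s δ U e

theorem tendsto_inv_smul (x : E) : Tendsto (fun R : ℝ => R⁻¹ • x) atTop (𝓝 0) := by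
  simpa using (tendsto_inv_atTop_zero (𝕜 := ℝ)).smul_const x

theorem eventually_norm_add_shift_le {s : ℝ} (hs : s ≤ 2) {δ : ℝ} {e : E} (he : ‖e‖ < δ) (x : E) :
    ∀ᶠ R : ℝ in atTop, ‖x + R ^ (s - 1) • e‖ ≤ R * δ := by
  filter_upwards [eventually_ge_atTop 1, eventually_ge_atTop (‖x‖ / (δ - ‖e‖))] with R hR hRx
  have h1 : R ^ (s - 1) ≤ R := by
    calc R ^ (s - 1) ≤ R ^ (1 : ℝ) := Real.rpow_le_rpow_of_exponent_le hR (by linarith)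
      _ = R := Real.rpow_one R
  rw [div_le_iff₀ (by linarith)] at hRx
  refine (norm_add_le _ _).trans ?_
  rw [norm_smul, Real.norm_of_nonneg (by positivity)]
  nlinarith [norm_nonneg e]

/-- With `G = domainForce s δ U`, the integral is `R^(2-s) G(R⁻¹ x + R^(s-2) e)`. For `s < 2` the
argument tends to zero, and multiplied by `R^(2-s)` it tends to `e` because `s > 1`;
differentiability at zero and `G(0) = 0` give the limit. For `s = 2` the argument tends to `e`, and
continuity is enough. -/
theorem hasMeanForce_shiftedDilates {s : ℝ} (h1 : 1 < s) (h2 : s ≤ 2) {δ : ℝ} (hδ : 0 < δ)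
    {U : Set E} (hU : Bornology.IsBounded U) (hball : Metric.ball 0 (2 * δ) ⊆ U)
    (h0 : domainForce s δ U 0 = 0) {e : E} (he : ‖e‖ < δ) :
    HasMeanForce s (shiftedDilates U s e) fun _ => displacementForce s δ U e := by
  intro f hf x
  have hev := hf.eventually_setIntegral_eq hδ hU hball (eventually_norm_add_shift_le h2 he x)
  refine Tendsto.congr' (hev.mono fun R hR => hR.symm) ?_
  have hexp : ∀ᶠ R : ℝ in atTop, R⁻¹ • (x + R ^ (s - 1) • e) = R⁻¹ • x + R ^ (s - 2) • e := by
    filter_upwards [eventually_gt_atTop 0] with R hR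
    rw [smul_add, smul_smul]
    congr 2
    rw [inv_mul_eq_div, ← Real.rpow_sub_one hR.ne']
    congr 1
    ring
  rw [displacementForce]
  split_ifs with hs
  · have hd := (hasFDerivAt_domainForce s hδ hU 0).hasFDerivWithinAt (s := univ)
    have h3 := hd.lim (l := atTop) (c := fun R : ℝ => R ^ (2 - s))
      (d := fun R : ℝ => R⁻¹ • x + R ^ (s - 2) • e) (v := e) ?_ (.of_forall fun _ => mem_univ _) ?_
    · refine h3.congr' (hexp.mono fun R hR => ?_)
      simp only
      rw [hR, h0, sub_zero, zero_add]
    · have h4 : Tendsto (fun R : ℝ => R ^ (s - 2) • e) atTop (𝓝 0) := by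
        have := (tendsto_rpow_neg_atTop (y := 2 - s) (by linarith)).smul_const e
        simpa using this
      simpa using (tendsto_inv_smul x).add h4
    · have h5 : Tendsto (fun R : ℝ => R ^ (-(s - 1)) • x + e) atTop (𝓝 e) := by
        simpa using ((tendsto_rpow_neg_atTop (y := s - 1) (by linarith)).smul_const x).add_const e
      refine h5.congr' ?_
      filter_upwards [eventually_gt_atTop 0] with R hR
      rw [smul_add, smul_smul, smul_smul, ← Real.rpow_add hR, ← div_eq_mul_inv,
        ← Real.rpow_sub_one hR.ne']
      congr 2
      · congr 1
        ring
      · simp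
  · have hs2 : s = 2 := le_antisymm h2 (not_lt.1 hs)
    subst hs2
    have hc := (hasFDerivAt_domainForce 2 hδ hU e).continuousAt
    have h3 : Tendsto (fun R : ℝ => R⁻¹ • x + e) atTop (𝓝 e) := by
      simpa using (tendsto_inv_smul x).add_const e
    refine (hc.tendsto.comp h3).congr' (hexp.mono fun R hR => ?_)
    simp only
    rw [hR]
    simp

theorem displacementForce_zero {s δ : ℝ} {U : Set E} (h0 : domainForce s δ U 0 = 0) :
    displacementForce s δ U 0 = 0 := by
  rw [displacementForce, map_zero, h0, ite_self]

theorem shiftedDilates_zero (U : Set E) (s : ℝ) : shiftedDilates U s 0 = dilates U := by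
  ext1 R
  simp [shiftedDilates, dilates]

/-- In both regimes the displacement force has the nonzero derivative `domainForceDeriv s δ U 0` at
the origin, so it cannot vanish on a neighbourhood. -/
theorem exists_displacementForce_ne_zero {s : ℝ} (hs : 1 ≤ s) {δ : ℝ} (hδ : 0 < δ)
    {U : Set E} (hU : Bornology.IsBounded U) (hUm : MeasurableSet U) (hball : Metric.ball 0 δ ⊆ U)
    {ε : ℝ} (hε : 0 < ε) : ∃ e : E, ‖e‖ < ε ∧ displacementForce s δ U e ≠ 0 := by
  have hne := domainForceDeriv_ne_zero hs hδ hU hUm hball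
  have hd := hasFDerivAt_domainForce s hδ hU 0
  by_contra! hcon
  have h1 : displacementForce s δ U =ᶠ[𝓝 0] fun _ => 0 := by
    filter_upwards [Metric.ball_mem_nhds (0 : E) hε] with e he
    exact hcon e (by simpa using he)
  have h2 : HasFDerivAt (displacementForce s δ U) (domainForceDeriv s δ U 0) 0 := by
    by_cases h : s < 2
    · have h3 : displacementForce s δ U = domainForceDeriv s δ U 0 := by
        ext1 e
        rw [displacementForce, if_pos h]
      rw [h3]
      exact (domainForceDeriv s δ U 0).hasFDerivAt
    · have h3 : displacementForce s δ U = domainForce s δ U := by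
        ext1 e
        rw [displacementForce, if_neg h]
      rwa [h3]
  exact hne (h2.unique ((hasFDerivAt_const (0 : E) (0 : E)).congr_of_eventuallyEq h1))

/-- For `s = 1` the integral is `R G(x / R)` with `G(0) = 0`, a difference quotient: the one case in
which the limit depends on `x`. -/
theorem hasMeanForce_dilates_coulomb {δ : ℝ} (hδ : 0 < δ)
    {U : Set E} (hU : Bornology.IsBounded U) (hball : Metric.ball 0 (2 * δ) ⊆ U)
    (h0 : domainForce 1 δ U 0 = 0) :
    HasMeanForce 1 (dilates U) (domainForceDeriv 1 δ U 0) := by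
  intro f hf x
  have hc : ∀ᶠ R : ℝ in atTop, ‖x + (0 : E)‖ ≤ R * δ := by
    filter_upwards [eventually_ge_atTop (‖x‖ / δ)] with R hR
    rwa [add_zero, ← div_le_iff₀ hδ]
  have hev := hf.eventually_setIntegral_eq hδ hU hball (c := fun _ => 0) hc
  have h1 := (hasFDerivAt_domainForce 1 hδ hU 0).lim_real x
  refine h1.congr' ?_
  filter_upwards [hev] with R hR
  rw [dilates_eq, hR, h0]
  norm_num

/-! ### Boundary points and outer normals -/

/-- In `W`, the set `U` is `{g < 0}`, and `g` is `η`-close to a linear function with gradient `n`. -/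
structure IsNearlyFlat (U W : Set E) (n : E) (η : ℝ) (g : E → ℝ) : Prop where
  isOpen : IsOpen W
  mem_iff : ∀ y ∈ W, y ∈ U ↔ g y < 0
  approx : ∀ y ∈ W, ∀ z ∈ W, |g y - g z - inner ℝ n (y - z)| ≤ η * ‖y - z‖

namespace IsNearlyFlat

variable {U W : Set E} {n : E} {η : ℝ} {g : E → ℝ}

theorem mono (h : IsNearlyFlat U W n η g) {W' : Set E} (hW' : IsOpen W') (hs : W' ⊆ W) :
    IsNearlyFlat U W' n η g where
  isOpen := hW'
  mem_iff y hy := h.mem_iff y (hs hy)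
  approx y hy z hz := h.approx y (hs hy) z (hs hz)

theorem abs_sub_le (h : IsNearlyFlat U W n η g) {y z : E} (hy : y ∈ W) (hz : z ∈ W) :
    |g y - g z| ≤ (‖n‖ + η) * ‖y - z‖ := by
  have h1 := h.approx y hy z hz
  have h2 := abs_real_inner_le_norm n (y - z)
  have h3 : g y - g z = (g y - g z - inner ℝ n (y - z)) + inner ℝ n (y - z) := by ring
  rw [h3]
  refine (abs_add_le _ _).trans ?_
  linarith

theorem continuousOn (h : IsNearlyFlat U W n η g) : ContinuousOn g W := by
  intro z hz
  rw [ContinuousWithinAt, tendsto_iff_norm_sub_tendsto_zero]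
  refine squeeze_zero' (.of_forall fun _ => norm_nonneg _)
    (eventually_mem_nhdsWithin.mono fun y hy => h.abs_sub_le hy hz) ?_
  have h1 : Continuous fun y : E => (‖n‖ + η) * ‖y - z‖ := by fun_prop
  have h2 := h1.tendsto z
  simp only [sub_self, norm_zero, mul_zero] at h2
  exact h2.mono_left nhdsWithin_le_nhds

/-- `g` increases along directions close to `n`. -/
theorem lt_add_smul (h : IsNearlyFlat U W n η g) {v : E} (hv : η * ‖v‖ < inner ℝ n v) {y : E}
    {t t' : ℝ} (ht : t < t') (hy : y + t • v ∈ W) (hy' : y + t' • v ∈ W) :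
    g (y + t • v) < g (y + t' • v) := by
  have h1 := h.approx _ hy' _ hy
  rw [show y + t' • v - (y + t • v) = (t' - t) • v by module, inner_smul_right, norm_smul,
    Real.norm_of_nonneg (by linarith)] at h1
  have h2 := (abs_le.1 h1).1
  nlinarith

/-- Since `g` increases along `n`, a zero of `g` is approached from inside `U` by moving in the
direction `-n`; continuity of `g` gives the converse. -/
theorem mem_frontier_iff (h : IsNearlyFlat U W n η g) (hU : IsOpen U) (hn : ‖n‖ = 1)
    (hη : η < 1) {y : E} (hy : y ∈ W) : y ∈ frontier U ↔ g y = 0 := by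
  have hWy := h.isOpen.mem_nhds hy
  have hcont : ContinuousAt g y := h.continuousOn.continuousAt hWy
  rw [hU.frontier_eq]
  constructor
  · rintro ⟨hcl, hnot⟩
    rw [h.mem_iff y hy, not_lt] at hnot
    refine le_antisymm (not_lt.1 fun hpos => ?_) hnot
    obtain ⟨z, ⟨hz, hzW⟩, hzU⟩ :=
      mem_closure_iff_nhds.1 hcl _ (inter_mem (hcont.eventually (lt_mem_nhds hpos)) hWy)
    rw [h.mem_iff z hzW] at hzU
    exact hzU.not_gt hz
  · intro h0
    refine ⟨?_, by rw [h.mem_iff y hy, h0]; exact lt_irrefl 0⟩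
    have hcurve : Tendsto (fun t : ℝ => y + t • n) (𝓝[<] 0) (𝓝 y) := by
      have : Continuous fun t : ℝ => y + t • n := by fun_prop
      simpa using (this.tendsto 0).mono_left nhdsWithin_le_nhds
    refine mem_closure_of_tendsto hcurve ?_
    filter_upwards [hcurve.eventually hWy, self_mem_nhdsWithin] with t ht ht0
    rw [h.mem_iff _ ht, ← h0]
    have h1 := h.lt_add_smul (v := n) (y := y) (t := t) (t' := 0)
      (by rw [real_inner_self_eq_norm_sq, hn]; linarith) ht0 ht (by simpa using hy)
    simpa using h1

end IsNearlyFlat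

/-- A `C¹` function is strictly differentiable, which controls its differences between any two
nearby points. Dividing by `‖∇g‖` makes the linear part the unit normal. -/
theorem IsLocalDefiningFunction.exists_isNearlyFlat {U : Set E} {p : E} {g : E → ℝ}
    (h : IsLocalDefiningFunction U p g) {η : ℝ} (hη : 0 < η) :
    ∃ r > 0, IsNearlyFlat U (Metric.ball p r) (‖gradient g p‖⁻¹ • gradient g p) η
      fun y => ‖gradient g p‖⁻¹ * g y := by
  obtain ⟨hne, V, hVo, hpV, hg, hUV⟩ := h
  set a := ‖gradient g p‖
  have ha : 0 < a := norm_pos_iff.2 hne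
  have hs : HasStrictFDerivAt g (fderiv ℝ g p) p :=
    (hg.contDiffAt (hVo.mem_nhds hpV)).hasStrictFDerivAt one_ne_zero
  obtain ⟨N, hN, happ⟩ := hs.approximates_deriv_on_nhds (c := (a * η).toNNReal)
    (.inr (Real.toNNReal_pos.2 (mul_pos ha hη)))
  obtain ⟨r, hr, hsub⟩ := Metric.mem_nhds_iff.1 (inter_mem hN (hVo.mem_nhds hpV))
  refine ⟨r, hr, Metric.isOpen_ball, fun y hy => ?_, fun y hy z hz => ?_⟩
  · have hyV := (hsub hy).2
    have h1 : y ∈ U ∩ V ↔ y ∈ {x ∈ V | g x < 0} := by rw [hUV]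
    have h2 : a⁻¹ * g y < 0 ↔ g y < 0 := by
      rw [mul_neg_iff]
      simp [ha, ha.not_gt]
    rw [h2]
    exact ⟨fun hU => (h1.1 ⟨hU, hyV⟩).2, fun hlt => (h1.2 ⟨hyV, hlt⟩).1⟩
  · have h1 := happ _ (hsub hy).1 _ (hsub hz).1
    have h2 : fderiv ℝ g p (y - z) = inner ℝ (gradient g p) (y - z) := by
      rw [gradient, InnerProductSpace.toDual_symm_apply]
    rw [h2, Real.coe_toNNReal _ (mul_pos ha hη).le, Real.norm_eq_abs] at h1
    rw [inner_smul_left, RCLike.conj_to_real, ← mul_sub, ← mul_sub, abs_mul,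
      abs_of_pos (inv_pos.2 ha), inv_mul_le_iff₀ ha, ← mul_assoc]
    exact h1

/-- If the unit normals differ, move a small way along `n₂ - n₁`. Its inner products with `n₁` and
`n₂` are `∓‖n₂ - n₁‖² / 2`, so the first function becomes negative and the second positive, placing
the point both inside and outside `U`. The tolerance `‖n₂ - n₁‖ / 4` is half of that margin. -/
theorem IsLocalDefiningFunction.normal_unique {U : Set E} (hU : IsOpen U) {p : E}
    (hp : p ∈ frontier U) {g₁ g₂ : E → ℝ} (h₁ : IsLocalDefiningFunction U p g₁)
    (h₂ : IsLocalDefiningFunction U p g₂) :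
    ‖gradient g₁ p‖⁻¹ • gradient g₁ p = ‖gradient g₂ p‖⁻¹ • gradient g₂ p := by
  set n₁ := ‖gradient g₁ p‖⁻¹ • gradient g₁ p
  set n₂ := ‖gradient g₂ p‖⁻¹ • gradient g₂ p
  have hn₁ : ‖n₁‖ = 1 := norm_smul_inv_norm h₁.1
  have hn₂ : ‖n₂‖ = 1 := norm_smul_inv_norm h₂.1
  by_contra hne
  have hw : 0 < ‖n₂ - n₁‖ := norm_pos_iff.2 (sub_ne_zero.2 (Ne.symm hne))
  have hsq : ‖n₂ - n₁‖ ^ 2 = 2 - 2 * inner ℝ n₁ n₂ := by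
    rw [norm_sub_sq_real, hn₁, hn₂, real_inner_comm]
    ring
  have hw2 : ‖n₂ - n₁‖ ≤ 2 := (norm_sub_le _ _).trans (by rw [hn₁, hn₂]; norm_num)
  obtain ⟨r₁, hr₁, f₁⟩ := h₁.exists_isNearlyFlat (η := ‖n₂ - n₁‖ / 4) (by positivity)
  obtain ⟨r₂, hr₂, f₂⟩ := h₂.exists_isNearlyFlat (η := ‖n₂ - n₁‖ / 4) (by positivity)
  have hp₁ := Metric.mem_ball_self (x := p) hr₁
  have hp₂ := Metric.mem_ball_self (x := p) hr₂
  have e₁ := (f₁.mem_frontier_iff hU hn₁ (by linarith) hp₁).1 hp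
  have e₂ := (f₂.mem_frontier_iff hU hn₂ (by linarith) hp₂).1 hp
  have hcurve : Tendsto (fun t : ℝ => p + t • (n₂ - n₁)) (𝓝[>] 0) (𝓝 p) := by
    have : Continuous fun t : ℝ => p + t • (n₂ - n₁) := by fun_prop
    simpa using (this.tendsto 0).mono_left nhdsWithin_le_nhds
  obtain ⟨t, ⟨ht₁, ht₂⟩, ht⟩ := ((hcurve.eventually (inter_mem (Metric.ball_mem_nhds p hr₁)
    (Metric.ball_mem_nhds p hr₂))).and self_mem_nhdsWithin).exists
  have ht : 0 < t := ht
  have a₁ := f₁.approx _ ht₁ _ hp₁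
  have a₂ := f₂.approx _ ht₂ _ hp₂
  rw [e₁, add_sub_cancel_left, inner_smul_right, norm_smul, Real.norm_of_nonneg ht.le, inner_sub_right,
    real_inner_self_eq_norm_sq, hn₁] at a₁
  rw [e₂, add_sub_cancel_left, inner_smul_right, norm_smul, Real.norm_of_nonneg ht.le, inner_sub_right,
    real_inner_self_eq_norm_sq, hn₂, real_inner_comm] at a₂
  have hpos : 0 < t * ‖n₂ - n₁‖ ^ 2 := by positivity
  have h1 : p + t • (n₂ - n₁) ∈ U := by
    rw [f₁.mem_iff _ ht₁]
    have := (abs_le.1 a₁).2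
    nlinarith
  rw [f₂.mem_iff _ ht₂] at h1
  have := (abs_le.1 a₂).1
  nlinarith

theorem IsLocalDefiningFunction.outerNormal_eq {U : Set E} (hU : IsOpen U) {p : E}
    (hp : p ∈ frontier U) {g : E → ℝ} (h : IsLocalDefiningFunction U p g) :
    outerNormal U p = ‖gradient g p‖⁻¹ • gradient g p := by
  have h1 : IsOuterNormal U p (outerNormal U p) := Classical.epsilon_spec ⟨_, g, h, rfl⟩
  obtain ⟨g', hg', h2⟩ := h1
  rw [h2]
  exact hg'.normal_unique hU hp h

theorem IsC1Domain.norm_outerNormal {U : Set E} (hU : IsC1Domain U) {p : E}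
    (hp : p ∈ frontier U) : ‖outerNormal U p‖ = 1 := by
  obtain ⟨g, hg⟩ := hU.boundary p hp
  rw [hg.outerNormal_eq hU.isOpen hp]
  exact norm_smul_inv_norm hg.1

/-- One defining function also serves at all nearby boundary points, so by uniqueness the normal
there is its normalized gradient. -/
theorem IsC1Domain.continuousOn_outerNormal {U : Set E} (hU : IsC1Domain U) :
    ContinuousOn (outerNormal U) (frontier U) := by
  intro p hp
  obtain ⟨g, hg⟩ := hU.boundary p hp
  obtain ⟨hne, V, hVo, hpV, hgV, hUV⟩ := id hg
  have hgrad : ContinuousAt (gradient g) p :=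
    (InnerProductSpace.toDual ℝ E).symm.continuous.continuousAt.comp
      ((hgV.continuousOn_fderiv_of_isOpen hVo le_rfl).continuousAt (hVo.mem_nhds hpV))
  have h1 : ContinuousAt (fun y => ‖gradient g y‖⁻¹ • gradient g y) p :=
    (hgrad.norm.inv₀ (norm_ne_zero_iff.2 hne)).smul hgrad
  refine h1.continuousWithinAt.congr_of_eventuallyEq ?_ (hg.outerNormal_eq hU.isOpen hp)
  filter_upwards [mem_nhdsWithin_of_mem_nhds (hVo.mem_nhds hpV),
    mem_nhdsWithin_of_mem_nhds (hgrad.eventually_ne hne), self_mem_nhdsWithin] with y hyV hy hyU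
  exact IsLocalDefiningFunction.outerNormal_eq hU.isOpen hyU ⟨hy, V, hVo, hyV, hgV, hUV⟩

theorem IsC1Domain.exists_isNearlyFlat {U : Set E} (hU : IsC1Domain U) {p : E}
    (hp : p ∈ frontier U) {η : ℝ} (hη : 0 < η) :
    ∃ r > 0, ∃ g, IsNearlyFlat U (Metric.ball p r) (outerNormal U p) η g := by
  obtain ⟨g, hg⟩ := hU.boundary p hp
  obtain ⟨r, hr, h⟩ := hg.exists_isNearlyFlat hη
  rw [← hg.outerNormal_eq hU.isOpen hp] at h
  exact ⟨r, hr, _, h⟩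

/-! ### Oblique coordinates -/

/-- The projection onto the plane orthogonal to `n`, along `v`. -/
def obliqueProj (n v y : E) : (ℝ ∙ n)ᗮ :=
  (ℝ ∙ n)ᗮ.orthogonalProjectionOnto (y - (inner ℝ n y : ℝ) • v)

section ObliqueProj

variable {n v : E}

theorem coe_obliqueProj (hnv : inner ℝ n v = (1 : ℝ)) (y : E) :
    (obliqueProj n v y : E) = y - (inner ℝ n y : ℝ) • v := by
  rw [obliqueProj, Submodule.coe_orthogonalProjectionOnto_apply,
    Submodule.starProjection_eq_self_iff, Submodule.mem_orthogonal_singleton_iff_inner_right,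
    inner_sub_right, inner_smul_right, hnv, mul_one, sub_self]

theorem obliqueProj_add_smul (hnv : inner ℝ n v = (1 : ℝ)) (w : (ℝ ∙ n)ᗮ) (t : ℝ) :
    obliqueProj n v (w + t • v) = w := by
  have hw : inner ℝ n (w : E) = (0 : ℝ) := Submodule.mem_orthogonal_singleton_iff_inner_right.1 w.2
  ext1
  rw [coe_obliqueProj hnv, inner_add_right, inner_smul_right, hw, hnv, mul_one, zero_add,
    add_sub_cancel_right]

theorem obliqueProj_add_inner_smul (hnv : inner ℝ n v = (1 : ℝ)) (y : E) :
    (obliqueProj n v y : E) + (inner ℝ n y : ℝ) • v = y := by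
  rw [coe_obliqueProj hnv, sub_add_cancel]

@[fun_prop]
theorem continuous_obliqueProj (n v : E) : Continuous (obliqueProj n v) := by
  unfold obliqueProj
  fun_prop

/-- Orthogonal coordinates composed with a shear: since `⟨n, v⟩ = 1`, replacing `n` by `v` only adds
a displacement within the plane. -/
theorem measurePreserving_oblique (hn : ‖n‖ = 1) (hnv : inner ℝ n v = (1 : ℝ)) :
    MeasurePreserving fun q : ℝ × (ℝ ∙ n)ᗮ => (q.2 : E) + q.1 • v := by
  have h1 : MeasurePreserving fun q : ℝ × (ℝ ∙ n)ᗮ => (q.2 : E) + q.1 • n := by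
    have h2 := (LinearIsometryEquiv.toSpanUnitSingleton (𝕜 := ℝ) n hn).measurePreserving.prod
      (MeasurePreserving.id (volume : Measure (ℝ ∙ n)ᗮ))
    have h3 := (ℝ ∙ n).orthogonalDecomposition.symm.measurePreserving.comp
      ((WithLp.volume_preserving_toLp (ℝ ∙ n) (ℝ ∙ n)ᗮ).comp h2)
    rw [Measure.volume_eq_prod]
    convert h3 using 2 with q
    simp [add_comm]
  have h4 : MeasurePreserving fun q : ℝ × (ℝ ∙ n)ᗮ => (q.1, q.2 + q.1 • obliqueProj n n v) := by
    refine (MeasurePreserving.id (volume : Measure ℝ)).skew_product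
      (g := fun t w => w + t • obliqueProj n n v) (by fun_prop) (.of_forall fun t => ?_)
    exact (measurePreserving_add_right volume (t • obliqueProj n n v)).map_eq
  convert h1.comp h4 using 2 with q
  have hnn : inner ℝ n n = (1 : ℝ) := by rw [real_inner_self_eq_norm_sq, hn, one_pow]
  simp only [Function.comp_apply, Submodule.coe_add, Submodule.coe_smul, coe_obliqueProj hnn, hnv]
  module

theorem integral_eq_integral_oblique (hn : ‖n‖ = 1) (hnv : inner ℝ n v = (1 : ℝ)) {f : E → ℝ}
    (hf : Integrable f) : ∫ y, f y = ∫ w : (ℝ ∙ n)ᗮ, ∫ t : ℝ, f (w + t • v) := by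
  have hmp := measurePreserving_oblique hn hnv
  have hinv : ∀ q : ℝ × (ℝ ∙ n)ᗮ, (inner ℝ n ((q.2 : E) + q.1 • v) : ℝ) = q.1 := by
    intro q
    have hw : inner ℝ n (q.2 : E) = (0 : ℝ) :=
      Submodule.mem_orthogonal_singleton_iff_inner_right.1 q.2.2
    rw [inner_add_right, inner_smul_right, hw, hnv, mul_one, zero_add]
  have hemb : MeasurableEmbedding fun q : ℝ × (ℝ ∙ n)ᗮ => (q.2 : E) + q.1 • v := by
    refine MeasurableEquiv.measurableEmbedding
      { toFun := fun q : ℝ × (ℝ ∙ n)ᗮ => (q.2 : E) + q.1 • v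
        invFun := fun y => (inner ℝ n y, obliqueProj n v y)
        left_inv := fun q => Prod.ext (hinv q) (obliqueProj_add_smul hnv q.2 q.1)
        right_inv := obliqueProj_add_inner_smul hnv
        measurable_toFun := hmp.measurable
        measurable_invFun := by
          have : Continuous fun y : E => ((inner ℝ n y : ℝ), obliqueProj n v y) := by fun_prop
          exact this.measurable }
  rw [← hmp.integral_comp hemb f, Measure.volume_eq_prod, integral_prod_symm]
  exact (hmp.integrable_comp_emb hemb).2 hf

end ObliqueProj

/-! ### The divergence theorem on a line -/

theorem integral_deriv_eq_zero {f : ℝ → ℝ} (hf : ContDiff ℝ 1 f) (hc : HasCompactSupport f) :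
    ∫ t, deriv f t = 0 := by
  have hi : Integrable (deriv f) :=
    (hf.continuous_deriv le_rfl).integrable_of_hasCompactSupport hc.deriv
  rw [← intervalIntegral.integral_Iic_add_Ioi (b := 0) hi.integrableOn hi.integrableOn,
    hc.integral_Iic_deriv_eq hf, hc.integral_Ioi_deriv_eq hf, add_neg_cancel]

theorem integral_indicator_deriv_of_root {f γ : ℝ → ℝ} {J A : Set ℝ} (hf : ContDiff ℝ 1 f)
    (hc : HasCompactSupport f) (hfJ : tsupport f ⊆ J) (hγ : StrictMonoOn γ J)
    (hA : ∀ t ∈ J, t ∈ A ↔ γ t < 0) {t₀ : ℝ} (ht₀ : t₀ ∈ J) (h0 : γ t₀ = 0) :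
    ∫ t, A.indicator (deriv f) t = f t₀ := by
  have h1 : A.indicator (deriv f) = (Iio t₀).indicator (deriv f) := by
    ext1 t
    by_cases ht : t ∈ J
    · have h2 : t ∈ A ↔ t ∈ Iio t₀ := by
        rw [hA t ht, ← h0, hγ.lt_iff_lt ht ht₀, mem_Iio]
      by_cases h3 : t ∈ A
      · rw [indicator_of_mem h3, indicator_of_mem (h2.1 h3)]
      · rw [indicator_of_notMem h3, indicator_of_notMem (h2.not.1 h3)]
    · have h2 : deriv f t = 0 := by
        by_contra h3
        exact ht (hfJ (support_deriv_subset h3))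
      simp [indicator, h2]
  rw [h1, integral_indicator measurableSet_Iio, ← integral_Iic_eq_integral_Iio,
    hc.integral_Iic_deriv_eq hf]

theorem integral_indicator_deriv_of_no_root {f γ : ℝ → ℝ} {J A : Set ℝ} (hJ : J.OrdConnected)
    (hf : ContDiff ℝ 1 f) (hc : HasCompactSupport f) (hfJ : tsupport f ⊆ J)
    (hγ : ContinuousOn γ J) (hA : ∀ t ∈ J, t ∈ A ↔ γ t < 0) (h0 : ∀ t ∈ J, γ t ≠ 0) :
    ∫ t, A.indicator (deriv f) t = 0 := by
  have hout : ∀ t, t ∉ J → deriv f t = 0 := by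
    intro t ht
    by_contra h3
    exact ht (hfJ (support_deriv_subset h3))
  by_cases hneg : ∃ t ∈ J, γ t < 0
  · obtain ⟨t₁, ht₁, hγ₁⟩ := hneg
    have hall : ∀ t ∈ J, γ t < 0 := by
      intro t ht
      by_contra! hcon
      obtain ⟨u, hu, hu0⟩ := hJ.isPreconnected.intermediate_value ht₁ ht hγ ⟨hγ₁.le, hcon⟩
      exact h0 u hu hu0
    rw [← integral_deriv_eq_zero hf hc]
    congr 1
    ext1 t
    by_cases ht : t ∈ J
    · exact indicator_of_mem ((hA t ht).2 (hall t ht)) _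
    · simp [indicator, hout t ht]
  · push Not at hneg
    have h1 : A.indicator (deriv f) = fun _ => 0 := by
      ext1 t
      by_cases ht : t ∈ J
      · exact indicator_of_notMem (fun h => (hneg t ht).not_gt ((hA t ht).1 h)) _
      · simp [indicator, hout t ht]
    rw [h1, integral_zero]

/-! ### The flux through a nearly flat surface -/

theorem hasDerivAt_comp_add_smul {φ : E → ℝ} (hφ : ContDiff ℝ 1 φ) (w v : E) (t : ℝ) :
    HasDerivAt (fun t : ℝ => φ (w + t • v)) (fderiv ℝ φ (w + t • v) v) t := by
  have h1 : HasDerivAt (fun t : ℝ => w + t • v) v t := by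
    simpa using ((hasDerivAt_id t).smul_const v).const_add w
  exact ((hφ.differentiable one_ne_zero _).hasFDerivAt).comp_hasDerivAt t h1

theorem hasCompactSupport_comp_add_smul {φ : E → ℝ} (hc : HasCompactSupport φ) (w : E) {v : E}
    (hv : v ≠ 0) : HasCompactSupport fun t : ℝ => φ (w + t • v) := by
  have h1 : Topology.IsClosedEmbedding fun t : ℝ => w + t • v :=
    (Homeomorph.addLeft w).isClosedEmbedding.comp
      (isClosedEmbedding_smul_left hv)
  exact hc.comp_isClosedEmbedding h1

theorem integrable_fderiv_apply {φ : E → ℝ} (hφ : ContDiff ℝ 1 φ) (hc : HasCompactSupport φ)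
    (v : E) : Integrable fun y => fderiv ℝ φ y v :=
  ((hφ.continuous_fderiv one_ne_zero).clm_apply continuous_const).integrable_of_hasCompactSupport
    (hc.fderiv_apply ℝ v)

/-- Fubini along the lines parallel to `v`. Within `W` such a line meets the surface at most once,
because `g` increases along it. The integral of the derivative over the part in `U` is then the
value of `φ` at the crossing, or zero if there is none. -/
theorem IsNearlyFlat.setIntegral_fderiv {U W : Set E} {n v : E} {η : ℝ} {g : E → ℝ}
    (h : IsNearlyFlat U W n η g) (hU : MeasurableSet U) (hW : Convex ℝ W) (hn : ‖n‖ = 1)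
    (hnv : inner ℝ n v = (1 : ℝ)) (hη : η * ‖v‖ < 1) {φ : E → ℝ} (hφ : ContDiff ℝ 1 φ)
    (hc : HasCompactSupport φ) (hφW : tsupport φ ⊆ W) {F : (ℝ ∙ n)ᗮ → ℝ}
    (hF : ∀ y ∈ W, g y = 0 → F (obliqueProj n v y) = φ y)
    (hF0 : ∀ w, (∀ y ∈ W, g y = 0 → obliqueProj n v y ≠ w) → F w = 0) :
    ∫ y in U, fderiv ℝ φ y v = ∫ w, F w := by
  have hv : v ≠ 0 := by
    rintro rfl
    simp at hnv
  rw [← integral_indicator hU,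
    integral_eq_integral_oblique hn hnv ((integrable_fderiv_apply hφ hc v).indicator hU)]
  congr 1
  ext1 w
  set f : ℝ → ℝ := fun t => φ (w + t • v)
  set ℓ : ℝ → E := fun t => w + t • v
  have hℓ : Continuous ℓ := by fun_prop
  have hf : ContDiff ℝ 1 f := hφ.comp (by fun_prop)
  have hcf : HasCompactSupport f := hasCompactSupport_comp_add_smul hc w hv
  have hfJ : tsupport f ⊆ ℓ ⁻¹' W :=
    (tsupport_comp_subset_preimage φ hℓ).trans (preimage_mono hφW)
  have hA : ∀ t ∈ ℓ ⁻¹' W, t ∈ ℓ ⁻¹' U ↔ g (ℓ t) < 0 := fun t ht => h.mem_iff _ ht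
  have hint : ∀ t, U.indicator (fun y => fderiv ℝ φ y v) (w + t • v) =
      (ℓ ⁻¹' U).indicator (deriv f) t := by
    intro t
    have h1 : deriv f = fun t => fderiv ℝ φ (ℓ t) v :=
      funext fun t => (hasDerivAt_comp_add_smul hφ w v t).deriv
    rw [h1]
    rfl
  simp_rw [hint]
  have hmono : StrictMonoOn (fun t => g (ℓ t)) (ℓ ⁻¹' W) := fun t ht t' ht' hlt =>
    h.lt_add_smul (by rwa [hnv]) hlt ht ht'
  by_cases hroot : ∃ t ∈ ℓ ⁻¹' W, g (ℓ t) = 0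
  · obtain ⟨t₀, ht₀, h0⟩ := hroot
    rw [integral_indicator_deriv_of_root hf hcf hfJ hmono hA ht₀ h0, ← obliqueProj_add_smul hnv w t₀,
      hF _ ht₀ h0]
  · push Not at hroot
    rw [hF0 w, integral_indicator_deriv_of_no_root ?_ hf hcf hfJ
      (h.continuousOn.comp hℓ.continuousOn (mapsTo_preimage _ _)) hA hroot]
    · refine Convex.ordConnected ?_
      have h1 := (hW.translate_preimage_right (w : E)).linear_preimage
        (LinearMap.toSpanSingleton ℝ E v)
      exact h1
    · rintro y hy hgy rfl
      refine hroot (inner ℝ n y) ?_ ?_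
      · simpa only [ℓ, mem_preimage, obliqueProj_add_inner_smul hnv] using hy
      · simpa only [ℓ, obliqueProj_add_inner_smul hnv] using hgy

/-! ### Comparison of surface measures -/

/-- For nonnegative integrands the two-sided comparison gives the bound at once; in general the
positive and negative parts are treated separately. -/
theorem abs_integral_sub_integral_le {α : Type*} [MeasurableSpace α] {μ ν : Measure α}
    [IsFiniteMeasure μ] [IsFiniteMeasure ν] {C : NNReal} (hC : 1 ≤ C) (h1 : μ ≤ C • ν)
    (h2 : ν ≤ C • μ) {f : α → ℝ} (hf : Integrable f ν) :
    |∫ x, f x ∂μ - ∫ x, f x ∂ν| ≤ (C - 1) * ∫ x, |f x| ∂ν := by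
  have hC' : (1 : ℝ) ≤ C := by exact_mod_cast hC
  have hμ : Integrable f μ := (hf.smul_measure_nnreal (c := C)).mono_measure h1
  have key : ∀ g : α → ℝ, (∀ x, 0 ≤ g x) → Integrable g ν → Integrable g μ →
      |∫ x, g x ∂μ - ∫ x, g x ∂ν| ≤ (C - 1) * ∫ x, g x ∂ν := by
    intro g hg hgν hgμ
    have a1 : ∫ x, g x ∂μ ≤ C * ∫ x, g x ∂ν := by
      have := integral_mono_measure h1 (.of_forall hg) (hgν.smul_measure_nnreal (c := C))
      rwa [integral_smul_nnreal_measure, NNReal.smul_def, smul_eq_mul] at this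
    have a2 : ∫ x, g x ∂ν ≤ C * ∫ x, g x ∂μ := by
      have := integral_mono_measure h2 (.of_forall hg) (hgμ.smul_measure_nnreal (c := C))
      rwa [integral_smul_nnreal_measure, NNReal.smul_def, smul_eq_mul] at this
    have a3 : 0 ≤ ∫ x, g x ∂ν := integral_nonneg hg
    have a4 : 0 ≤ ∫ x, g x ∂μ := integral_nonneg hg
    rw [abs_le]
    constructor
    · by_cases hle : ∫ x, g x ∂ν ≤ ∫ x, g x ∂μ
      · nlinarith
      · nlinarith
    · linarith
  have hp := key (fun x => max (f x) 0) (fun x => le_max_right _ _) hf.pos_part hμ.pos_part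
  have hn := key (fun x => max (-f x) 0) (fun x => le_max_right _ _) hf.neg_part hμ.neg_part
  have hdec : ∀ x, f x = max (f x) 0 - max (-f x) 0 := fun x => by
    rcases le_total 0 (f x) with h | h <;> simp [h]
  have habs : ∀ x, |f x| = max (f x) 0 + max (-f x) 0 := fun x => by
    rcases le_total 0 (f x) with h | h <;> simp [h, abs_of_nonneg, abs_of_nonpos]
  have e1 : ∫ x, f x ∂μ = ∫ x, max (f x) 0 ∂μ - ∫ x, max (-f x) 0 ∂μ := by
    rw [← integral_sub hμ.pos_part hμ.neg_part]
    exact integral_congr_ae (.of_forall hdec)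
  have e2 : ∫ x, f x ∂ν = ∫ x, max (f x) 0 ∂ν - ∫ x, max (-f x) 0 ∂ν := by
    rw [← integral_sub hf.pos_part hf.neg_part]
    exact integral_congr_ae (.of_forall hdec)
  have e3 : ∫ x, |f x| ∂ν = ∫ x, max (f x) 0 ∂ν + ∫ x, max (-f x) 0 ∂ν := by
    rw [← integral_add hf.pos_part hf.neg_part]
    exact integral_congr_ae (.of_forall habs)
  rw [e1, e2, e3]
  rw [abs_le] at hp hn ⊢
  constructor <;> linarith [hp.1, hp.2, hn.1, hn.2]

theorem LipschitzWith.euclideanHausdorffMeasure_image_le {X Y : Type*} [EMetricSpace X]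
    [MeasurableSpace X] [BorelSpace X] [EMetricSpace Y] [MeasurableSpace Y] [BorelSpace Y]
    {f : X → Y} {K : NNReal} (hf : LipschitzWith K f) (d : ℕ) (s : Set X) :
    (Measure.euclideanHausdorffMeasure d : Measure Y) (f '' s) ≤
      (K : ENNReal) ^ d * (Measure.euclideanHausdorffMeasure d : Measure X) s := by
  simp only [Measure.euclideanHausdorffMeasure_def, Measure.smul_apply, ENNReal.smul_def,
    smul_eq_mul]
  rw [mul_left_comm]
  gcongr
  simpa using hf.hausdorffMeasure_image_le (Nat.cast_nonneg d) s

theorem AntilipschitzWith.le_euclideanHausdorffMeasure_image {X Y : Type*} [EMetricSpace X]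
    [MeasurableSpace X] [BorelSpace X] [EMetricSpace Y] [MeasurableSpace Y] [BorelSpace Y]
    {f : X → Y} {K : NNReal} (hf : AntilipschitzWith K f) (d : ℕ) (s : Set X) :
    (Measure.euclideanHausdorffMeasure d : Measure X) s ≤
      (K : ENNReal) ^ d * (Measure.euclideanHausdorffMeasure d : Measure Y) (f '' s) := by
  simp only [Measure.euclideanHausdorffMeasure_def, Measure.smul_apply, ENNReal.smul_def,
    smul_eq_mul]
  rw [mul_left_comm]
  gcongr
  simpa using hf.le_hausdorffMeasure_image (Nat.cast_nonneg d) s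

theorem norm_obliqueProj_sub {n v : E} (hnv : inner ℝ n v = (1 : ℝ)) (y z : E) :
    |‖obliqueProj n v y - obliqueProj n v z‖ - ‖y - z‖| ≤ |inner ℝ n (y - z)| * ‖v‖ := by
  have h0 : ‖obliqueProj n v y - obliqueProj n v z‖ =
    ‖((obliqueProj n v y - obliqueProj n v z : (ℝ ∙ n)ᗮ) : E)‖ := rfl
  rw [h0, Submodule.coe_sub, coe_obliqueProj hnv, coe_obliqueProj hnv,
    show y - (inner ℝ n y : ℝ) • v - (z - (inner ℝ n z : ℝ) • v) =
      (y - z) - (inner ℝ n (y - z) : ℝ) • v by rw [inner_sub_right]; module]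
  refine (abs_norm_sub_norm_le _ _).trans (le_of_eq ?_)
  rw [sub_sub_cancel_left, norm_neg, norm_smul, Real.norm_eq_abs]

/-- The surface measure. -/
abbrev surfaceMeasure : Measure E := Measure.euclideanHausdorffMeasure 2

namespace IsNearlyFlat

variable {U W : Set E} {n v : E} {η : ℝ} {g : E → ℝ}

theorem measurableSet_zeros (h : IsNearlyFlat U W n η g) : MeasurableSet {y ∈ W | g y = 0} := by
  have h1 : {y ∈ W | g y = 0} = W ∩ closure {y ∈ W | g y = 0} := by
    refine Subset.antisymm (fun y hy => ⟨hy.1, subset_closure hy⟩) ?_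
    rintro y ⟨hyW, hy⟩
    refine ⟨hyW, ?_⟩
    have hc : ContinuousAt g y := h.continuousOn.continuousAt (h.isOpen.mem_nhds hyW)
    by_contra hne
    obtain ⟨z, hz, hz'⟩ := mem_closure_iff_nhds.1 hy _ (hc.eventually_ne hne)
    exact hz hz'.2
  rw [h1]
  exact h.isOpen.measurableSet.inter isClosed_closure.measurableSet

/-- Oblique projection sends the surface into the tangent plane with bi-Lipschitz constant `K`, so
Hausdorff area and Lebesgue measure of the projection differ by a factor of at most `K²`. The flux
is exactly an integral over the projection. -/
theorem abs_flux_sub_le (h : IsNearlyFlat U W n η g) (hU : MeasurableSet U) (hW : Convex ℝ W)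
    (hWb : Bornology.IsBounded W) (hn : ‖n‖ = 1)
    (hnv : inner ℝ n v = (1 : ℝ)) {K : NNReal} (hK1 : 1 + η * ‖v‖ ≤ K)
    (hK2 : 1 ≤ K * (1 - η * ‖v‖)) (hK : 1 ≤ K) :
    surfaceMeasure {y ∈ W | g y = 0} < ⊤ ∧
    ∀ φ : E → ℝ, ContDiff ℝ 1 φ → HasCompactSupport φ → tsupport φ ⊆ W →
      |(∫ y in U, fderiv ℝ φ y v) - ∫ y in {y ∈ W | g y = 0}, φ y ∂surfaceMeasure| ≤
        (K ^ 2 - 1) * ∫ y in {y ∈ W | g y = 0}, |φ y| ∂surfaceMeasure := by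
  set S := {y ∈ W | g y = 0}
  have hS : MeasurableSet S := h.measurableSet_zeros
  have hη : η * ‖v‖ < 1 := by
    by_contra! hcon
    have : (K : ℝ) * (1 - η * ‖v‖) ≤ 0 := mul_nonpos_of_nonneg_of_nonpos K.2 (by linarith)
    linarith
  set e : S → (ℝ ∙ n)ᗮ := fun y => obliqueProj n v y
  have hdist : ∀ y z : S, |dist (e y) (e z) - dist y z| ≤ η * ‖v‖ * dist y z := by
    intro y z
    -- Both points are zeros of `g`, so near flatness bounds the normal component of their
    -- difference by `η` times its length.
    have h1 := h.approx y y.2.1 z z.2.1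
    rw [y.2.2, z.2.2, sub_zero, zero_sub, abs_neg] at h1
    rw [dist_eq_norm, Subtype.dist_eq, dist_eq_norm]
    refine (norm_obliqueProj_sub hnv y z).trans ?_
    calc |inner ℝ n ((y : E) - z)| * ‖v‖ ≤ η * ‖(y : E) - z‖ * ‖v‖ := by gcongr
      _ = _ := by ring
  have hlip : LipschitzWith K e := LipschitzWith.of_dist_le_mul fun y z => by
    have h1 := (abs_le.1 (hdist y z)).2
    nlinarith [dist_nonneg (x := y) (y := z)]
  have hanti : AntilipschitzWith K e := AntilipschitzWith.of_le_mul_dist fun y z => by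
    have h1 := (abs_le.1 (hdist y z)).1
    have h2 : (1 - η * ‖v‖) * dist y z ≤ dist (e y) (e z) := by linarith
    calc dist y z ≤ K * (1 - η * ‖v‖) * dist y z := by
          nlinarith [dist_nonneg (x := y) (y := z)]
      _ = K * ((1 - η * ‖v‖) * dist y z) := by ring
      _ ≤ K * dist (e y) (e z) := by gcongr
  have hemb : MeasurableEmbedding e :=
    (continuous_obliqueProj n v).continuousOn.measurableEmbedding hS
      (injOn_iff_injective.2 hanti.injective)
  set lam : Measure S := Measure.comap e volume
  set sig : Measure S := Measure.comap Subtype.val surfaceMeasure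
  have hfin : Module.finrank ℝ (ℝ ∙ n)ᗮ = 2 := by
    have : Fact (Module.finrank ℝ E = 2 + 1) := ⟨by simp⟩
    exact Submodule.finrank_orthogonal_span_singleton (norm_ne_zero_iff.1 (by rw [hn]; simp))
  have hvol : (volume : Measure (ℝ ∙ n)ᗮ) = Measure.euclideanHausdorffMeasure 2 := by
    rw [← InnerProductSpace.euclideanHausdorffMeasure_eq_volume, hfin]
  have hlam : ∀ A, lam A = Measure.euclideanHausdorffMeasure 2 (e '' A) := fun A => by
    rw [← hvol]
    exact hemb.comap_apply _ _
  have hsig : ∀ A, sig A = (Measure.euclideanHausdorffMeasure 2 : Measure S) A := fun A => by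
    rw [← isometry_subtype_coe.euclideanHausdorffMeasure_image]
    exact (MeasurableEmbedding.subtype_coe hS).comap_apply _ _
  have hle1 : lam ≤ (K ^ 2) • sig := Measure.le_iff.2 fun A _ => by
    rw [Measure.smul_apply, ENNReal.smul_def, smul_eq_mul, hlam, hsig, ENNReal.coe_pow]
    exact LipschitzWith.euclideanHausdorffMeasure_image_le hlip 2 A
  have hle2 : sig ≤ (K ^ 2) • lam := Measure.le_iff.2 fun A _ => by
    rw [Measure.smul_apply, ENNReal.smul_def, smul_eq_mul, hlam, hsig, ENNReal.coe_pow]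
    exact AntilipschitzWith.le_euclideanHausdorffMeasure_image hanti 2 A
  have hlamfin : IsFiniteMeasure lam := by
    refine ⟨?_⟩
    rw [hlam, ← hvol, image_univ]
    have h1 : Bornology.IsBounded (obliqueProj n v '' W) :=
      ((hWb.isCompact_closure.image (continuous_obliqueProj n v)).isBounded).subset
        (image_mono subset_closure)
    refine (measure_mono ?_).trans_lt h1.measure_lt_top
    rintro _ ⟨y, rfl⟩
    exact ⟨y, y.2.1, rfl⟩
  have hsigfin : IsFiniteMeasure sig := isFiniteMeasure_of_le _ hle2
  have hsigS : sig univ = surfaceMeasure S := by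
    have h1 := (MeasurableEmbedding.subtype_coe hS).comap_apply surfaceMeasure univ
    rwa [image_univ, Subtype.range_coe] at h1
  refine ⟨by rw [← hsigS]; exact measure_lt_top _ _, fun φ hφ hc hφW => ?_⟩
  have hφi : Integrable (fun y : S => φ y) sig := by
    obtain ⟨B, hB⟩ := hc.exists_bound_of_continuous hφ.continuous
    exact Integrable.of_bound (hφ.continuous.comp continuous_subtype_val).aestronglyMeasurable B
      (.of_forall fun y => hB y)
  have hflux : ∫ y in U, fderiv ℝ φ y v = ∫ y : S, φ y ∂lam := by
    have hext : ∀ y : S, Function.extend e (fun y : S => φ y) 0 (e y) = φ y :=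
      fun y => hanti.injective.extend_apply _ _ _
    have hext0 : ∀ w, w ∉ range e → Function.extend e (fun y : S => φ y) 0 w = 0 := fun w hw =>
      Function.extend_apply' _ _ _ hw
    rw [h.setIntegral_fderiv hU hW hn hnv hη hφ hc hφW
      (F := Function.extend e (fun y : S => φ y) 0)
      (fun y hy hgy => hext ⟨y, hy, hgy⟩)
      (fun w hw => hext0 w fun ⟨y, hy⟩ => hw y y.2.1 y.2.2 hy),
      ← setIntegral_eq_integral_of_forall_compl_eq_zero (s := range e) hext0,
      ← hemb.map_comap, hemb.integral_map]
    simp_rw [hext]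
    rfl
  have hs1 : ∫ y in S, φ y ∂surfaceMeasure = ∫ y : S, φ y ∂sig :=
    (integral_subtype_comap hS _).symm
  have hs2 : ∫ y in S, |φ y| ∂surfaceMeasure = ∫ y : S, |φ y| ∂sig :=
    (integral_subtype_comap hS _).symm
  rw [hflux, hs1, hs2]
  have := abs_integral_sub_integral_le (one_le_pow₀ hK) hle1 hle2 hφi
  simpa using this

end IsNearlyFlat

/-! ### The divergence theorem for `C¹` domains -/

/-- For functions supported in `W`, the divergence theorem in direction `b` holds up to a relative
error `ε`. -/
def HasFluxBound (U : Set E) (b : E) (ε : ℝ) (W : Set E) : Prop :=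
  ∀ φ : E → ℝ, ContDiff ℝ 1 φ → HasCompactSupport φ → tsupport φ ⊆ W →
    |(∫ y in U, fderiv ℝ φ y b) -
        ∫ y in frontier U, φ y * inner ℝ (outerNormal U y) b ∂surfaceMeasure| ≤
      ε * ∫ y in frontier U, |φ y| ∂surfaceMeasure

theorem hasFluxBound_of_subset {U : Set E} (hU : IsOpen U) (b : E) {ε : ℝ} (hε : 0 ≤ ε)
    {W : Set E} (hW : W ⊆ U) : HasFluxBound U b ε W := by
  intro φ hφ hc hφW
  have h1 : ∫ y in U, fderiv ℝ φ y b = 0 := by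
    rw [setIntegral_eq_integral_of_forall_compl_eq_zero]
    · have h2 := integral_mul_fderiv_eq_neg_fderiv_mul_of_integrable (μ := volume) (𝕜 := ℝ)
        (f := fun _ : E => (1 : ℝ)) (g := φ) (v := b)
      simp only [one_mul, fderiv_fun_const, Pi.zero_apply, _root_.zero_apply, zero_mul,
        integral_zero, neg_zero] at h2
      exact h2 (integrable_zero _ _ _) (integrable_fderiv_apply hφ hc b)
        (hφ.continuous.integrable_of_hasCompactSupport hc) (by fun_prop)
        (fun y _ => hφ.differentiable one_ne_zero y)
    · intro y hy
      have h2 : y ∉ tsupport (fderiv ℝ φ) := fun h => hy (hW (hφW (tsupport_fderiv_subset ℝ h)))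
      rw [image_eq_zero_of_notMem_tsupport h2, _root_.zero_apply]
  have h2 : ∀ y ∈ frontier U, φ y = 0 := fun y hy =>
    image_eq_zero_of_notMem_tsupport fun h => by
      rw [hU.frontier_eq] at hy
      exact hy.2 (hW (hφW h))
  have h3 : ∫ y in frontier U, φ y * inner ℝ (outerNormal U y) b ∂surfaceMeasure = 0 :=
    setIntegral_eq_zero_of_forall_eq_zero fun y hy => by rw [h2 y hy, zero_mul]
  rw [h1, h3, sub_zero, abs_zero]
  exact mul_nonneg hε (integral_nonneg fun _ => abs_nonneg _)

namespace IsC1Domain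

variable {U : Set E}

/-- The local formula covers directions with normal component one. An arbitrary `b` is a combination
of two of them, `n` and `v`, and near `p` the normal is almost constant, so `⟨n, b⟩` may replace the
varying factor. -/
theorem exists_hasFluxBound_of_mem_frontier (hU : IsC1Domain U) (b : E) {ε : ℝ} (hε : 0 < ε)
    {p : E} (hp : p ∈ frontier U) :
    ∃ r > 0, surfaceMeasure (frontier U ∩ Metric.ball p r) < ⊤ ∧
      HasFluxBound U b ε (Metric.ball p r) := by
  set n := outerNormal U p
  have hn : ‖n‖ = 1 := hU.norm_outerNormal hp
  have hnn : inner ℝ n n = (1 : ℝ) := by rw [real_inner_self_eq_norm_sq, hn, one_pow]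
  set β : ℝ := inner ℝ n b
  set v : E := b - (β - 1) • n
  have hnv : inner ℝ n v = (1 : ℝ) := by
    rw [inner_sub_right, inner_smul_right, hnn]
    change β - _ = 1
    ring
  have hbv : b = (β - 1) • n + v := by simp [v]
  -- The fluxes along `n` and `v` enter with weights `|β - 1|` and `1`, so they use half of `ε`; the
  -- other half pays for the variation of the normal.
  set ε₁ := ε / (2 * (|β - 1| + 1))
  have hε₁ : 0 < ε₁ := by positivity
  set κ := min 1 (ε₁ / 3)
  have hκ : 0 < κ := by positivity
  have hκ1 : κ ≤ 1 := min_le_left _ _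
  have hκε : 3 * κ ≤ ε₁ := by
    have : κ ≤ ε₁ / 3 := min_le_right _ _
    linarith
  set K : NNReal := ⟨1 + κ, by positivity⟩
  have hKc : (K : ℝ) = 1 + κ := rfl
  have hK : 1 ≤ K := by rw [← NNReal.coe_le_coe, hKc, NNReal.coe_one]; linarith
  have hKε : (K : ℝ) ^ 2 - 1 ≤ ε₁ := by rw [hKc]; nlinarith
  -- With `η ‖v‖` and `η ‖n‖` at most `κ / 2`, the constant `K = 1 + κ` satisfies both Lipschitz
  -- conditions, and `K² - 1 ≤ 3 κ ≤ ε₁`.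
  set η := κ / (2 * (‖v‖ + 1))
  have hη : 0 < η := by positivity
  have hηmul : ∀ x : ℝ, 0 ≤ x → x ≤ ‖v‖ + 1 → η * x ≤ κ / 2 := by
    intro x hx hxv
    calc η * x ≤ η * (‖v‖ + 1) := by gcongr
      _ = κ / 2 := by simp only [η]; field_simp
  have hηv := hηmul ‖v‖ (norm_nonneg _) (by linarith)
  have hηn := hηmul ‖n‖ (norm_nonneg _) (by rw [hn]; linarith [norm_nonneg v])
  have hη1 : η < 1 := by rw [hn, mul_one] at hηn; linarith
  obtain ⟨r₁, hr₁, g, hflat⟩ := hU.exists_isNearlyFlat hp hη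
  obtain ⟨r₂, hr₂, hcont⟩ := Metric.continuousOn_iff.1 hU.continuousOn_outerNormal p hp
    (ε / (2 * (‖b‖ + 1))) (by positivity)
  set W := Metric.ball p (min r₁ r₂)
  have hfl := hflat.mono (W' := W) Metric.isOpen_ball (Metric.ball_subset_ball (min_le_left _ _))
  have hSeq : {y ∈ W | g y = 0} = frontier U ∩ W := by
    ext y
    constructor
    · rintro ⟨hy, h0⟩
      exact ⟨(hfl.mem_frontier_iff hU.isOpen hn hη1 hy).2 h0, hy⟩
    · rintro ⟨hyU, hy⟩
      exact ⟨hy, (hfl.mem_frontier_iff hU.isOpen hn hη1 hy).1 hyU⟩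
  have hKcond : ∀ x : ℝ, 0 ≤ x → x ≤ κ / 2 → 1 + x ≤ K ∧ 1 ≤ K * (1 - x) := by
    intro x hx hxκ
    rw [hKc]
    constructor <;> nlinarith
  have hcv := hKcond _ (by positivity) hηv
  have hcn := hKcond _ (by positivity) hηn
  obtain ⟨hfin, hfv⟩ := hfl.abs_flux_sub_le hU.isOpen.measurableSet (convex_ball _ _)
    Metric.isBounded_ball hn hnv hcv.1 hcv.2 hK
  obtain ⟨-, hfn⟩ := hfl.abs_flux_sub_le hU.isOpen.measurableSet (convex_ball _ _)
    Metric.isBounded_ball hn hnn hcn.1 hcn.2 hK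
  rw [hSeq] at hfin hfv hfn
  refine ⟨min r₁ r₂, lt_min hr₁ hr₂, hfin, fun φ hφ hc hφW => ?_⟩
  have hv1 := hfv φ hφ hc hφW
  have hn1 := hfn φ hφ hc hφW
  set S := frontier U ∩ W
  have hSm : MeasurableSet S := isClosed_frontier.measurableSet.inter Metric.isOpen_ball.measurableSet
  have hout : ∀ y ∈ frontier U \ S, φ y = 0 := fun y hy =>
    image_eq_zero_of_notMem_tsupport fun h => hy.2 ⟨hy.1, hφW h⟩
  have hrestr : ∀ f : E → ℝ, (∀ y ∈ frontier U \ S, f y = 0) →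
      ∫ y in frontier U, f y ∂surfaceMeasure = ∫ y in S, f y ∂surfaceMeasure := fun f hf =>
    setIntegral_eq_of_subset_of_forall_sdiff_eq_zero isClosed_frontier.measurableSet
      inter_subset_left hf
  rw [hrestr _ fun y hy => by rw [hout y hy, zero_mul], hrestr _ fun y hy => by rw [hout y hy, abs_zero]]
  have hfinS : IsFiniteMeasure (surfaceMeasure.restrict S) := ⟨by simpa using hfin⟩
  obtain ⟨B, hB⟩ := hc.exists_bound_of_continuous hφ.continuous
  have hφi : IntegrableOn φ S surfaceMeasure :=
    Integrable.of_bound hφ.continuous.aestronglyMeasurable B (.of_forall hB)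
  have hνm : AEStronglyMeasurable (fun y => inner ℝ (outerNormal U y) b)
      (surfaceMeasure.restrict S) :=
    ((hU.continuousOn_outerNormal.mono inter_subset_left).inner continuousOn_const).aestronglyMeasurable
      hSm
  have hφν : IntegrableOn (fun y => φ y * inner ℝ (outerNormal U y) b) S surfaceMeasure := by
    refine Integrable.mul_bdd hφi (c := ‖b‖) hνm
      ((ae_restrict_iff' hSm).2 (.of_forall fun y hy => ?_))
    refine (norm_inner_le_norm _ _).trans ?_
    rw [hU.norm_outerNormal hy.1, one_mul]
  have hN : 0 ≤ ∫ y in S, |φ y| ∂surfaceMeasure := integral_nonneg fun _ => abs_nonneg _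
  have hsplit : ∫ y in U, fderiv ℝ φ y b =
      (β - 1) * (∫ y in U, fderiv ℝ φ y n) + ∫ y in U, fderiv ℝ φ y v := by
    rw [← integral_const_mul, ← integral_add
      ((integrable_fderiv_apply hφ hc n).integrableOn.const_mul _)
      (integrable_fderiv_apply hφ hc v).integrableOn]
    congr 1
    ext1 y
    conv_lhs => rw [hbv, map_add, map_smul, smul_eq_mul]
  have hbdry : |(∫ y in S, φ y * inner ℝ (outerNormal U y) b ∂surfaceMeasure) -
      β * ∫ y in S, φ y ∂surfaceMeasure| ≤ ε / 2 * ∫ y in S, |φ y| ∂surfaceMeasure := by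
    rw [← integral_const_mul, ← integral_sub hφν (hφi.const_mul β), ← integral_const_mul,
      ← Real.norm_eq_abs]
    refine norm_integral_le_of_norm_le (hφi.abs.const_mul _)
      ((ae_restrict_iff' hSm).2 (.of_forall fun y hy => ?_))
    have h1 : φ y * inner ℝ (outerNormal U y) b - β * φ y =
        φ y * inner ℝ (outerNormal U y - n) b := by
      rw [inner_sub_left]
      change _ - _ = φ y * (_ - β)
      ring
    have h2 : ‖outerNormal U y - n‖ ≤ ε / (2 * (‖b‖ + 1)) := by
      rw [← dist_eq_norm]
      exact (hcont y hy.1 ((Metric.mem_ball.1 hy.2).trans_le (min_le_right _ _))).le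
    rw [h1, norm_mul, Real.norm_eq_abs, mul_comm]
    refine mul_le_mul_of_nonneg_right ?_ (abs_nonneg _)
    calc ‖(inner ℝ (outerNormal U y - n) b : ℝ)‖ ≤ ‖outerNormal U y - n‖ * ‖b‖ :=
          norm_inner_le_norm _ _
      _ ≤ ε / (2 * (‖b‖ + 1)) * (‖b‖ + 1) := by gcongr; linarith
      _ = ε / 2 := by field_simp
  rw [hsplit]
  set X := ∫ y in S, φ y ∂surfaceMeasure
  set N := ∫ y in S, |φ y| ∂surfaceMeasure
  set Iv := ∫ y in U, fderiv ℝ φ y v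
  set In := ∫ y in U, fderiv ℝ φ y n
  set Y := ∫ y in S, φ y * inner ℝ (outerNormal U y) b ∂surfaceMeasure
  have hv2 : |Iv - X| ≤ ε₁ * N := hv1.trans (mul_le_mul_of_nonneg_right hKε hN)
  have hn2 : |In - X| ≤ ε₁ * N := hn1.trans (mul_le_mul_of_nonneg_right hKε hN)
  have hε₁eq : (|β - 1| + 1) * ε₁ = ε / 2 := by simp only [ε₁]; field_simp
  calc |(β - 1) * In + Iv - Y| = |(β - 1) * (In - X) + (Iv - X) - (Y - β * X)| := by
        congr 1
        ring
    _ ≤ |β - 1| * |In - X| + |Iv - X| + |Y - β * X| := by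
        rw [← abs_mul]
        exact (abs_sub _ _).trans (add_le_add_left (abs_add_le _ _) _)
    _ ≤ |β - 1| * (ε₁ * N) + ε₁ * N + ε / 2 * N := by gcongr
    _ = ((|β - 1| + 1) * ε₁) * N + ε / 2 * N := by ring
    _ = ε * N := by rw [hε₁eq]; ring

theorem surfaceMeasure_frontier_lt_top (hU : IsC1Domain U) : surfaceMeasure (frontier U) < ⊤ := by
  have hcomp : IsCompact (frontier U) :=
    Metric.isCompact_of_isClosed_isBounded isClosed_frontier
      (hU.isBounded.closure.subset frontier_subset_closure)
  refine hcomp.measure_lt_top_of_nhdsWithin fun p hp => ?_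
  obtain ⟨r, hr, hfin, -⟩ := hU.exists_hasFluxBound_of_mem_frontier 0 one_pos hp
  exact ⟨_, inter_mem self_mem_nhdsWithin (mem_nhdsWithin_of_mem_nhds (Metric.ball_mem_nhds p hr)),
    hfin⟩

theorem exists_hasFluxBound (hU : IsC1Domain U) (b : E) {ε : ℝ} (hε : 0 < ε) {p : E}
    (hp : p ∈ closure U) : ∃ r > 0, HasFluxBound U b ε (Metric.ball p r) := by
  by_cases hpU : p ∈ U
  · obtain ⟨r, hr, hsub⟩ := Metric.isOpen_iff.1 hU.isOpen p hpU
    exact ⟨r, hr, hasFluxBound_of_subset hU.isOpen b hε.le hsub⟩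
  · obtain ⟨r, hr, -, h⟩ := hU.exists_hasFluxBound_of_mem_frontier b hε
      (by rw [hU.isOpen.frontier_eq]; exact ⟨hp, hpU⟩)
    exact ⟨r, hr, h⟩

theorem integrableOn_frontier (hU : IsC1Domain U) {F : Type*} [NormedAddCommGroup F]
    {f : E → F} (hf : ContinuousOn f (frontier U)) :
    IntegrableOn f (frontier U) surfaceMeasure := by
  have hcomp : IsCompact (frontier U) :=
    Metric.isCompact_of_isClosed_isBounded isClosed_frontier
      (hU.isBounded.closure.subset frontier_subset_closure)
  obtain ⟨B, hB⟩ := hcomp.exists_bound_of_continuousOn hf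
  exact IntegrableOn.of_bound hU.surfaceMeasure_frontier_lt_top
    (hf.aestronglyMeasurable_of_isCompact hcomp isClosed_frontier.measurableSet) B
    ((ae_restrict_iff' isClosed_frontier.measurableSet).2 (.of_forall hB))

theorem integrableOn_mul_inner_outerNormal (hU : IsC1Domain U) (b : E) {u : E → ℝ}
    (hu : Continuous u) : IntegrableOn u (frontier U) surfaceMeasure ∧
      IntegrableOn (fun y => u y * inner ℝ (outerNormal U y) b) (frontier U) surfaceMeasure :=
  ⟨hU.integrableOn_frontier hu.continuousOn, hU.integrableOn_frontier
    (hu.continuousOn.mul (hU.continuousOn_outerNormal.inner continuousOn_const))⟩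

/-- A partition of unity localizes `u`. The errors are relative to `∫ |φ i|`, and since the
partition functions are nonnegative these integrals add up to `∫ |u|`, however many pieces a small
`ε` requires. Then `ε` tends to zero. -/
theorem setIntegral_fderiv (hU : IsC1Domain U) (b : E) {u : E → ℝ} (hu : ContDiff ℝ 1 u) :
    ∫ y in U, fderiv ℝ u y b =
      ∫ y in frontier U, u y * inner ℝ (outerNormal U y) b ∂surfaceMeasure := by
  have hbound : ∀ ε > 0, |(∫ y in U, fderiv ℝ u y b) -
      ∫ y in frontier U, u y * inner ℝ (outerNormal U y) b ∂surfaceMeasure| ≤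
      ε * ∫ y in frontier U, |u y| ∂surfaceMeasure := by
    intro ε hε
    choose! r hr hflux using fun p (hp : p ∈ closure U) => hU.exists_hasFluxBound b hε hp
    obtain ⟨t, htU, ht⟩ := hU.isBounded.isCompact_closure.elim_nhds_subcover
      (fun p => Metric.ball p (r p)) fun p hp => Metric.ball_mem_nhds p (hr p hp)
    obtain ⟨f, hf⟩ := SmoothPartitionOfUnity.exists_isSubordinate (modelWithCornersSelf ℝ E)
      isClosed_closure (fun p : t => Metric.ball (p : E) (r p)) (fun _ => Metric.isOpen_ball)
      (s := closure U) (fun y hy => by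
        obtain ⟨p, hp, hyp⟩ := mem_iUnion₂.1 (ht hy)
        exact mem_iUnion.2 ⟨⟨p, hp⟩, hyp⟩)
    set φ : t → E → ℝ := fun i y => f i y * u y
    have hfs : ∀ i, ContDiff ℝ 1 (f i) := fun i =>
      ((f i).contMDiff.contDiff).of_le (by exact_mod_cast le_top)
    have hφ : ∀ i, ContDiff ℝ 1 (φ i) := fun i => (hfs i).mul hu
    have hsupp : ∀ i, tsupport (φ i) ⊆ Metric.ball (i : E) (r i) := fun i =>
      (tsupport_mul_subset_left).trans (hf i)
    have hc : ∀ i, HasCompactSupport (φ i) := fun i =>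
      Metric.isCompact_of_isClosed_isBounded (isClosed_tsupport _)
        (Metric.isBounded_ball.subset (hsupp i))
    have hone : ∀ y ∈ closure U, ∑ i, f i y = 1 := fun y hy => by
      rw [← f.sum_eq_one hy, finsum_eq_sum_of_fintype]
    have hsum : ∀ y ∈ closure U, ∑ i, φ i y = u y := fun y hy => by
      simp only [φ]
      rw [← Finset.sum_mul, hone y hy, one_mul]
    have hsumabs : ∀ y ∈ closure U, ∑ i, |φ i y| = |u y| := fun y hy => by
      simp only [φ, abs_mul]
      rw [← Finset.sum_mul, Finset.sum_congr rfl fun i _ => abs_of_nonneg (f.nonneg i y), hone y hy,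
        one_mul]
    have hfd : ∀ y ∈ U, fderiv ℝ u y b = ∑ i, fderiv ℝ (φ i) y b := by
      intro y hy
      have h1 : u =ᶠ[𝓝 y] fun z => ∑ i, φ i z := by
        filter_upwards [hU.isOpen.mem_nhds hy] with z hz
        exact (hsum z (subset_closure hz)).symm
      rw [h1.fderiv_eq, fderiv_fun_sum fun i _ => (hφ i).differentiable one_ne_zero y,
        sum_apply]
    have e1 : ∫ y in U, fderiv ℝ u y b = ∑ i, ∫ y in U, fderiv ℝ (φ i) y b := by
      rw [setIntegral_congr_fun hU.isOpen.measurableSet hfd, integral_finsetSum]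
      exact fun i _ => (integrable_fderiv_apply (hφ i) (hc i) b).integrableOn
    have e2 : ∫ y in frontier U, u y * inner ℝ (outerNormal U y) b ∂surfaceMeasure =
        ∑ i, ∫ y in frontier U, φ i y * inner ℝ (outerNormal U y) b ∂surfaceMeasure := by
      rw [← integral_finsetSum _ fun i _ =>
        (hU.integrableOn_mul_inner_outerNormal b (hφ i).continuous).2]
      refine setIntegral_congr_fun isClosed_frontier.measurableSet fun y hy => ?_
      rw [← hsum y (frontier_subset_closure hy), Finset.sum_mul]
    have e3 : ∫ y in frontier U, |u y| ∂surfaceMeasure =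
        ∑ i, ∫ y in frontier U, |φ i y| ∂surfaceMeasure := by
      rw [← integral_finsetSum _ fun i _ =>
        (hU.integrableOn_mul_inner_outerNormal b (hφ i).continuous).1.abs]
      refine setIntegral_congr_fun isClosed_frontier.measurableSet fun y hy => ?_
      exact (hsumabs y (frontier_subset_closure hy)).symm
    rw [e1, e2, e3, ← Finset.sum_sub_distrib, Finset.mul_sum]
    refine (Finset.abs_sum_le_sum_abs _ _).trans (Finset.sum_le_sum fun i _ => ?_)
    exact hflux i (htU i i.2) (φ i) (hφ i) (hc i) (hsupp i)
  rw [← sub_eq_zero, ← abs_eq_zero]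
  set N := ∫ y in frontier U, |u y| ∂surfaceMeasure
  have hN : 0 ≤ N := integral_nonneg fun _ => abs_nonneg _
  refine le_antisymm (le_of_forall_pos_le_add fun ε hε => ?_) (abs_nonneg _)
  refine (hbound (ε / (N + 1)) (by positivity)).trans ?_
  rw [zero_add, div_mul_eq_mul_div, div_le_iff₀ (by positivity)]
  nlinarith

end IsC1Domain

/-! ### The mean force in the Coulomb case -/

theorem gradient_powerPotential_one_neg (y : E) :
    gradient (powerPotential 1) (-y) = (‖y‖ ^ 3)⁻¹ • y := by
  rw [gradient_powerPotential_neg, gradient_powerPotential, ← neg_smul]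
  congr 1
  rw [show (-1 - 2 : ℝ) = -((3 : ℕ) : ℝ) by norm_num, Real.rpow_neg (norm_nonneg _),
    Real.rpow_natCast]
  ring

/-- The divergence theorem is applied to `y ↦ ⟨x, kernel(-y)⟩` in the direction `b`; symmetry of the
Jacobian exchanges `x` and `b`. The boundary avoids the ball of radius `δ`, so the smooth kernel
equals the Coulomb field there. -/
theorem IsC1Domain.inner_domainForceDeriv_one {U : Set E} (hU : IsC1Domain U) {δ : ℝ} (hδ : 0 < δ)
    (hball : Metric.ball 0 δ ⊆ U) (x b : E) :
    inner ℝ b (domainForceDeriv 1 δ U 0 x) =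
      -∫ y in frontier U, inner ℝ x y / ‖y‖ ^ 3 * inner ℝ (outerNormal U y) b ∂surfaceMeasure := by
  have hk := contDiff_kernel 1 hδ
  set u : E → ℝ := fun y => inner ℝ x (kernel 1 δ (-y))
  have hu : ContDiff ℝ 1 u :=
    contDiff_const.inner ℝ ((hk.of_le (by norm_num)).comp contDiff_neg)
  have hfd : ∀ y, fderiv ℝ u y b = -inner ℝ b (kernelDeriv 1 δ (0 - y) x) := by
    intro y
    have h1 : HasFDerivAt (kernel 1 δ) (kernelDeriv 1 δ (-y)) (-y) :=
      (hk.differentiable (by norm_num) _).hasFDerivAt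
    have h2 : HasFDerivAt (fun y : E => kernel 1 δ (-y))
        ((kernelDeriv 1 δ (-y)).comp (-ContinuousLinearMap.id ℝ E)) y :=
      h1.comp y (hasFDerivAt_id y).neg
    have h3 := ((hasFDerivAt_const x y).inner ℝ h2).fderiv
    rw [h3, zero_sub, real_inner_comm, ← inner_kernelDeriv_comm 1 hδ]
    simp
  have h1 := hU.setIntegral_fderiv b hu
  simp_rw [hfd] at h1
  rw [integral_neg] at h1
  rw [inner_domainForceDeriv 1 hδ hU.isBounded, neg_eq_iff_eq_neg.1 h1]
  congr 1
  refine setIntegral_congr_fun isClosed_frontier.measurableSet fun y hy => ?_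
  have hy1 : δ ≤ ‖-y‖ := by
    rw [hU.isOpen.frontier_eq] at hy
    by_contra! h
    exact hy.2 (hball (by simpa using h))
  simp only [u]
  rw [kernel_eq 1 hδ hy1, gradient_powerPotential_one_neg, inner_smul_right, inv_mul_eq_div]

theorem coulombMeanForce_eq {I : Finset ℝ} (A : ℝ) (μ : Measure I) {U : Set E} (hU : IsC1Domain U)
    {δ : ℝ} (hδ : 0 < δ) (hball : Metric.ball 0 δ ⊆ U) (x : E) :
    coulombMeanForce A μ U x = (-A * meanCharge μ) • domainForceDeriv 1 δ U 0 x := by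
  have hint : IntegrableOn (fun y => (inner ℝ x y / ‖y‖ ^ 3) • outerNormal U y) (frontier U)
      surfaceMeasure := by
    have h1 : Continuous fun y : E => (inner ℝ x y : ℝ) := by fun_prop
    have h2 : Continuous fun y : E => ‖y‖ ^ 3 := by fun_prop
    refine hU.integrableOn_frontier (ContinuousOn.smul (h1.continuousOn.div
      h2.continuousOn fun y hy => ?_) hU.continuousOn_outerNormal)
    rw [hU.isOpen.frontier_eq] at hy
    have : y ≠ 0 := by
      rintro rfl
      exact hy.2 hU.zero_mem
    positivity
  rw [coulombMeanForce, neg_mul, neg_smul, ← smul_neg]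
  congr 1
  refine ext_inner_left ℝ fun b => ?_
  rw [inner_neg_right, hU.inner_domainForceDeriv_one hδ hball, neg_neg, ← integral_inner hint]
  congr 1
  ext1 y
  rw [inner_smul_right, real_inner_comm b]

/-! ### Fields with different means have different laws -/

theorem exists_isCutoff : ∃ ξ : E → ℝ, IsCutoff ξ := by
  refine ⟨fun y => Real.smoothTransition ((‖y‖ ^ 2 - 1 / 4) / (3 / 4)), ?_, ?_, ?_, ?_⟩
  · exact Real.smoothTransition.contDiff.comp
      (((contDiff_norm_sq ℝ).sub contDiff_const).div_const _)
  · intro x y h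
    rw [h]
  · intro y hy
    refine Real.smoothTransition.one_of_one_le ?_
    rw [le_div_iff₀ (by norm_num)]
    nlinarith
  · intro y hy
    refine Real.smoothTransition.zero_of_nonpos (div_nonpos_of_nonpos_of_nonneg ?_ (by norm_num))
    nlinarith [norm_nonneg y]

theorem exists_isAdmissible (Φ : E → ℝ) : ∃ ξ, IsAdmissible Φ ξ := by
  by_cases h : GradIntegrableAtOrigin Φ
  · exact ⟨_, .inr ⟨h, rfl⟩⟩
  · obtain ⟨ξ, hξ⟩ := exists_isCutoff
    exact ⟨ξ, .inl ⟨h, hξ⟩⟩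

theorem exists_cexp_inner_ne {a b : E} (h : a ≠ b) : ∃ η : E,
    Complex.exp (Complex.I * ((inner ℝ η a : ℝ) : ℂ)) ≠
      Complex.exp (Complex.I * ((inner ℝ η b : ℝ) : ℂ)) := by
  have hd : 0 < ‖a - b‖ := norm_pos_iff.2 (sub_ne_zero.2 h)
  -- The vector is scaled so that the two phases differ by exactly `π`.
  refine ⟨(Real.pi / ‖a - b‖ ^ 2) • (a - b), fun heq => ?_⟩
  have h1 : inner ℝ ((Real.pi / ‖a - b‖ ^ 2) • (a - b)) a =
      inner ℝ ((Real.pi / ‖a - b‖ ^ 2) • (a - b)) b + Real.pi := by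
    rw [← sub_eq_iff_eq_add', ← inner_sub_right, real_inner_smul_left, real_inner_self_eq_norm_sq]
    field_simp
  rw [h1, Complex.ofReal_add, mul_add, Complex.exp_add, mul_comm Complex.I (Real.pi : ℂ),
    Complex.exp_pi_mul_I] at heq
  have h2 := Complex.exp_ne_zero
    (Complex.I * ((inner ℝ ((Real.pi / ‖a - b‖ ^ 2) • (a - b)) b : ℝ) : ℂ))
  rw [mul_neg_one] at heq
  exact h2 (self_eq_neg.1 heq.symm)

/-- The two characteristic functions share a nonvanishing factor, an exponential, and differ in the
phase given by the mean. Integrability of the fields is not needed. -/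
theorem IsHoltsmarkField.map_ne {I : Finset ℝ} {μ : Measure I}
    {P : Measure (ChargedConfiguration I)} {Φ : E → ℝ} {M₁ M₂ : E → E}
    {F₁ F₂ : E → ChargedConfiguration I → E} (h₁ : IsHoltsmarkField μ P Φ M₁ F₁)
    (h₂ : IsHoltsmarkField μ P Φ M₂ F₂) {x : E} (hne : M₁ x ≠ M₂ x) :
    P.map (F₁ x) ≠ P.map (F₂ x) := by
  intro heq
  obtain ⟨ξ, hξ⟩ := exists_isAdmissible Φ
  obtain ⟨η, hη⟩ := exists_cexp_inner_ne hne
  have hchar : ∀ {F : E → ChargedConfiguration I → E}, Measurable (F x) →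
      charFun P F (fun _ : Fin 1 => η) (fun _ => x) =
        ∫ z, Complex.exp (Complex.I * ((inner ℝ η z : ℝ) : ℂ)) ∂(P.map (F x)) := by
    intro F hF
    rw [integral_map hF.aemeasurable]
    · simp [charFun]
    · have : Continuous fun z : E => Complex.exp (Complex.I * ((inner ℝ η z : ℝ) : ℂ)) := by fun_prop
      exact this.aestronglyMeasurable
  have e₁ := h₁.charFun_eq ξ hξ 1 (fun _ => η) fun _ => x
  have e₂ := h₂.charFun_eq ξ hξ 1 (fun _ => η) fun _ => x
  rw [hchar (h₁.measurable x)] at e₁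
  rw [hchar (h₂.measurable x), ← heq, e₁] at e₂
  have h3 := mul_right_cancel₀ (Complex.exp_ne_zero _) e₂
  simp only [Fin.sum_univ_one] at h3
  exact hη h3

theorem ConvergesInLaw.map_eq {Ω : Type*} [MeasurableSpace Ω] {P : Measure Ω} {G : ℝ → E → Ω → E}
    {F F' : E → Ω → E} (h : ConvergesInLaw P G F) (h' : ConvergesInLaw P G F') (x : E) :
    P.map (F x) = P.map (F' x) := by
  ext S hS
  rw [Measure.map_apply (h.measurable x) hS, Measure.map_apply (h'.measurable x) hS]
  exact tendsto_nhds_unique (h.tendsto x S hS) (h'.tendsto x S hS)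

theorem TranslationInvariant.map_eq {Ω : Type*} [MeasurableSpace Ω] {P : Measure Ω}
    {F : E → Ω → E} (h : TranslationInvariant P F) (hF : ∀ x, Measurable (F x)) (x : E) :
    P.map (F x) = P.map (F 0) := by
  ext S hS
  rw [Measure.map_apply (hF x) hS, Measure.map_apply (hF 0) hS]
  simpa [iInter_const] using h (fun _ => 0) (fun _ => S) (fun _ => hS) x

/-! ### Two domains with different mean forces -/

theorem isLocalDefiningFunction_sphere {U V : Set E} {c p : E} (hV : IsOpen V) (hp : p ∈ V)
    (hpc : p ≠ c) (h : U ∩ V = Metric.ball c 1 ∩ V) :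
    IsLocalDefiningFunction U p fun y => ‖y - c‖ ^ 2 - 1 := by
  have hg : ContDiff ℝ 1 fun y : E => ‖y - c‖ ^ 2 - 1 :=
    ((contDiff_norm_sq ℝ).comp (contDiff_id.sub contDiff_const)).sub contDiff_const
  refine ⟨fun h0 => ?_, V, hV, hp, hg.contDiffOn, ?_⟩
  · have h1 : HasFDerivAt (fun y : E => ‖y - c‖ ^ 2 - 1) (2 • innerSL ℝ (p - c)) p := by
      have := ((hasFDerivAt_id p).sub_const c).norm_sq.sub_const 1
      simpa using this
    have h2 := inner_gradient (fun y : E => ‖y - c‖ ^ 2 - 1) p (p - c)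
    have h3 : (2 • innerSL ℝ (p - c)) (p - c) = 2 * ‖p - c‖ ^ 2 := by
      rw [← real_inner_self_eq_norm_sq, two_mul, two_smul]
      rfl
    rw [h0, h1.fderiv, inner_zero_left, h3] at h2
    have h4 : 0 < ‖p - c‖ := norm_pos_iff.2 (sub_ne_zero.2 hpc)
    have h5 : 0 < ‖p - c‖ ^ 2 := by positivity
    linarith
  · rw [h]
    ext y
    simp only [mem_inter_iff, mem_ball_iff_norm, mem_ofPred_eq, sub_neg,
      sq_lt_one_iff₀ (norm_nonneg _), and_comm]

/-- Centres at distance at least four keep the ball of radius two around one centre disjoint from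
the other unit balls, so near each boundary point the union coincides with one ball. -/
theorem isC1Domain_biUnion_ball {T : Set E} (hT : T.Finite) (h0 : 0 ∈ T)
    (hsep : T.Pairwise fun a b => 4 ≤ dist a b) : IsC1Domain (⋃ c ∈ T, Metric.ball c 1) where
  isOpen := isOpen_biUnion fun _ _ => Metric.isOpen_ball
  isBounded := (Bornology.isBounded_biUnion hT).2 fun _ _ => Metric.isBounded_ball
  zero_mem := mem_biUnion h0 (Metric.mem_ball_self one_pos)
  boundary p hp := by
    rw [(isOpen_biUnion fun _ _ => Metric.isOpen_ball).frontier_eq, hT.closure_biUnion] at hp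
    obtain ⟨hp1, hp2⟩ := hp
    obtain ⟨c, hc, hpc⟩ := mem_iUnion₂.1 hp1
    have hpc1 : dist p c ≤ 1 := Metric.closure_ball_subset_closedBall hpc
    refine ⟨_, isLocalDefiningFunction_sphere (V := Metric.ball c 2) (c := c) Metric.isOpen_ball
      (Metric.mem_ball.2 (by linarith)) ?_ ?_⟩
    · rintro rfl
      exact hp2 (mem_biUnion hc (Metric.mem_ball_self one_pos))
    · ext y
      constructor
      · rintro ⟨hy, hyV⟩
        obtain ⟨c', hc', hyc⟩ := mem_iUnion₂.1 hy
        rcases eq_or_ne c c' with rfl | hne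
        · exact ⟨hyc, hyV⟩
        · have h1 := hsep hc hc' hne
          have h2 := dist_triangle_left c c' y
          have h3 := Metric.mem_ball.1 hyV
          have h4 := Metric.mem_ball.1 hyc
          linarith
      · rintro ⟨hy, hyV⟩
        exact ⟨mem_biUnion hc hy, hyV⟩

theorem isCoulombBalanced_of_symm {U : Set E} (hU : MeasurableSet U) (h : ∀ y ∈ U, -y ∈ U) :
    IsCoulombBalanced U := by
  rw [IsCoulombBalanced, ← integral_indicator hU]
  refine integral_eq_zero_of_odd fun u => ?_
  by_cases hu : u ∈ U
  · rw [indicator_of_mem hu, indicator_of_mem (h u hu), gradient_powerPotential_neg]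
  · rw [indicator_of_notMem hu, indicator_of_notMem fun h' => hu (by simpa using h _ h'), neg_zero]

/-- Away from the smoothing region this is `(3 ⟨y, e⟩² - ‖y‖²) / ‖y‖⁵`, positive in a double cone
around `e`. -/
theorem inner_kernelDeriv_pos {δ : ℝ} (hδ : 0 < δ) {e y : E} (he : ‖e‖ = 1) (hy : δ ≤ ‖y‖)
    (h : ‖y‖ ^ 2 < 3 * inner ℝ y e ^ 2) : 0 < inner ℝ e (kernelDeriv 1 δ y e) := by
  have h2 : δ ^ 2 ≤ ‖y‖ ^ 2 := pow_le_pow_left₀ hδ.le hy 2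
  have h3 : 0 < ‖y‖ := hδ.trans_le hy
  have h4 : 0 < ‖y‖ ^ 2 := by positivity
  rw [kernelDeriv_apply 1 hδ, inner_add_right, inner_smul_right, inner_smul_right,
    real_inner_self_eq_norm_sq, he, kernelProfile_eq 1 (by positivity) h2,
    deriv_kernelProfile 1 (by positivity) h2, Real.rpow_sub_one h4.ne', real_inner_comm]
  have h5 : 0 < (‖y‖ ^ 2) ^ (-(1 + 2 : ℝ) / 2) / ‖y‖ ^ 2 := by positivity
  have h6 := mul_pos h5 (sub_pos.2 h)
  refine h6.trans_eq ?_
  rw [real_inner_comm]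
  field_simp
  ring

/-- The second domain adds to the unit ball two unit balls centred at `±4 e`. They lie in the cone
where the integrand is positive, since there `‖z‖² ≤ 25 < 27 ≤ 3 ⟨z, e⟩²`. Both domains are
symmetric about the origin, hence balanced. -/
theorem exists_domains_domainForceDeriv_ne : ∃ U₁ U₂ : Set E,
    IsC1Domain U₁ ∧ IsCoulombBalanced U₁ ∧ IsC1Domain U₂ ∧ IsCoulombBalanced U₂ ∧
    Metric.ball 0 1 ⊆ U₁ ∧ Metric.ball 0 1 ⊆ U₂ ∧
    ∃ x, domainForceDeriv 1 (1 / 2) U₁ 0 x ≠ domainForceDeriv 1 (1 / 2) U₂ 0 x := by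
  set e : E := EuclideanSpace.single 0 1
  have he : ‖e‖ = 1 := by simp [e]
  set c : E := (4 : ℝ) • e
  have hc : ‖c‖ = 4 := by rw [norm_smul, he]; norm_num
  have hce : inner ℝ c e = (4 : ℝ) := by
    rw [real_inner_smul_left, real_inner_self_eq_norm_sq, he]
    norm_num
  have hcc : ‖c + c‖ = 8 := by
    rw [← two_smul ℝ c, norm_smul, hc]
    norm_num
  have hcc' : ‖-c - c‖ = 8 := by rw [← hcc, ← norm_neg, neg_sub, sub_neg_eq_add]
  have hC : ∀ {T : Set E}, T.Finite → 0 ∈ T → (T.Pairwise fun a b => 4 ≤ dist a b) →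
      (∀ a ∈ T, -a ∈ T) → IsC1Domain (⋃ a ∈ T, Metric.ball a 1) ∧
        IsCoulombBalanced (⋃ a ∈ T, Metric.ball a 1) := by
    intro T h1 h2 h3 h4
    have h5 := isC1Domain_biUnion_ball h1 h2 h3
    refine ⟨h5, isCoulombBalanced_of_symm h5.isOpen.measurableSet fun y hy => ?_⟩
    obtain ⟨a, ha, hya⟩ := mem_iUnion₂.1 hy
    refine mem_biUnion (h4 a ha) ?_
    rwa [Metric.mem_ball, dist_neg_neg]
  have hT₁ := hC (T := {0}) (by simp) (by simp) (by simp) (by simp)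
  have hT₂ := hC (T := {0, c, -c}) (by simp) (by simp) (by
    rintro a (rfl | rfl | rfl) b (rfl | rfl | rfl) hab <;>
      simp only [dist_eq_norm, zero_sub, sub_zero, norm_neg, hc, hcc, hcc',
        sub_neg_eq_add, zero_add, ne_eq, not_true_eq_false] at hab ⊢ <;> linarith)
    (by simp)
  set U₁ : Set E := ⋃ a ∈ ({0} : Set E), Metric.ball a 1
  set U₂ : Set E := ⋃ a ∈ ({0, c, -c} : Set E), Metric.ball a 1
  have hU₁ : U₁ = Metric.ball 0 1 := by simp [U₁]
  have hsub : U₁ ⊆ U₂ := by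
    rw [hU₁]
    exact subset_biUnion_of_mem (u := fun a : E => Metric.ball a 1) (by simp)
  refine ⟨U₁, U₂, hT₁.1, hT₁.2, hT₂.1, hT₂.2, hU₁.ge, hU₁.ge.trans hsub, e, fun heq => ?_⟩
  have h1 := congrArg (inner ℝ e) heq
  rw [inner_domainForceDeriv 1 (by norm_num) hT₁.1.isBounded,
    inner_domainForceDeriv 1 (by norm_num) hT₂.1.isBounded] at h1
  have hint : IntegrableOn (fun z => inner ℝ e (kernelDeriv 1 (1 / 2) (0 - z) e)) U₂ := by
    have hk : Continuous fun y => (inner ℝ e (kernelDeriv 1 (1 / 2) y e) : ℝ) :=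
      continuous_const.inner ((continuous_kernelDeriv 1 (by norm_num)).clm_apply continuous_const)
    exact integrableOn_comp_sub_of_continuous hk hT₂.1.isBounded 0
  have hm₁ := hT₁.1.isOpen.measurableSet
  have hm₂ := hT₂.1.isOpen.measurableSet
  have h2 := setIntegral_sdiff hm₁ hint hsub
  rw [h1, sub_self] at h2
  have hpos : ∀ z ∈ U₂ \ U₁, 0 < inner ℝ e (kernelDeriv 1 (1 / 2) (0 - z) e) := by
    have key : ∀ z ∈ Metric.ball c 1, ∀ σ : ℝ, σ ^ 2 = 1 →
        0 < inner ℝ e (kernelDeriv 1 (1 / 2) (σ • z) e) := by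
      intro z hz σ hσ
      have hzc : ‖z - c‖ < 1 := by rwa [← dist_eq_norm]
      have hn : ‖σ • z‖ = ‖z‖ := by
        rw [norm_smul, Real.norm_eq_abs,           (pow_eq_one_iff_of_nonneg (abs_nonneg σ) two_ne_zero).1 (by rw [sq_abs, hσ]), one_mul]
      have a1 : ‖z‖ ≤ 5 := by
        have := norm_add_le (z - c) c
        rw [sub_add_cancel, hc] at this
        linarith
      have a2 : 3 ≤ ‖z‖ := by
        have := norm_sub_norm_le c z
        rw [hc, norm_sub_rev] at this
        linarith
      have a3 : 3 ≤ inner ℝ z e := by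
        have h3 := (abs_le.1 (abs_real_inner_le_norm (z - c) e)).1
        rw [inner_sub_left, hce, he] at h3
        linarith
      refine inner_kernelDeriv_pos (by norm_num) he (by rw [hn]; linarith) ?_
      rw [hn, real_inner_smul_left, mul_pow, hσ]
      nlinarith
    rintro z ⟨hz₂, hz₁⟩
    obtain ⟨a, ha, hza⟩ := mem_iUnion₂.1 hz₂
    rcases ha with rfl | rfl | rfl
    · exact absurd (hU₁ ▸ hza) hz₁
    · simpa using key z hza (-1) (by norm_num)
    · have := key (-z) (by rwa [← neg_neg c, Metric.mem_ball, dist_neg_neg]) 1 (by norm_num)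
      simpa using this
  have h3 := (setIntegral_pos_iff_support_of_nonneg_ae
    ((ae_restrict_iff' (hm₂.diff hm₁)).2 (.of_forall fun z hz => (hpos z hz).le))
    (hint.mono_set sdiff_subset)).2 ?_
  · exact h3.ne' h2
  · refine (Metric.measure_ball_pos volume c one_pos).trans_le (measure_mono fun z hz => ?_)
    have hz2 : z ∈ U₂ \ U₁ := by
      refine ⟨mem_biUnion (by simp : c ∈ ({0, c, -c} : Set E)) hz, ?_⟩
      rw [hU₁, mem_ball_zero_iff, not_lt]
      have hzc : ‖z - c‖ < 1 := by rwa [← dist_eq_norm]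
      have := norm_sub_norm_le c z
      rw [hc, norm_sub_rev] at this
      linarith
    exact ⟨(hpos z hz2).ne', hz2⟩

/-! ### The limit fields -/

theorem IsC1Domain.exists_ball_subset {U : Set E} (hU : IsC1Domain U) :
    ∃ δ > 0, Metric.ball 0 (2 * δ) ⊆ U := by
  obtain ⟨r, hr, hsub⟩ := Metric.isOpen_iff.1 hU.isOpen 0 hU.zero_mem
  exact ⟨r / 2, by positivity, by rwa [mul_div_cancel₀ r two_ne_zero]⟩

theorem IsC1Domain.exhausts_dilates {U : Set E} (hU : IsC1Domain U) : Exhausts (dilates U) := by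
  obtain ⟨δ, hδ, hball⟩ := hU.exists_ball_subset
  have h := exhausts_shifted hU.isOpen hU.isBounded hδ hball (c := fun _ => 0) (by
    filter_upwards [eventually_ge_atTop 0] with R hR
    rw [norm_zero]
    positivity)
  simpa only [← dilates_eq] using h

theorem IsC1Domain.exhausts_shiftedDilates {U : Set E} (hU : IsC1Domain U) {s : ℝ} (hs : s ≤ 2)
    {δ : ℝ} (hδ : 0 < δ) (hball : Metric.ball 0 (2 * δ) ⊆ U) {e : E} (he : ‖e‖ < δ) :
    Exhausts (shiftedDilates U s e) :=
  exhausts_shifted hU.isOpen hU.isBounded hδ hball (by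
    simpa using eventually_norm_add_shift_le hs he 0)

theorem meanCharge_singleton_one (hI : I = {1}) (μ : Measure I) [IsProbabilityMeasure μ] :
    meanCharge μ = 1 := by
  subst hI
  rw [meanCharge, Fintype.sum_unique]
  have h1 : ({default} : Set ({1} : Finset ℝ)) = univ := by
    ext q
    simp [Subsingleton.elim q default]
  rw [h1, probReal_univ, one_mul]
  rfl

/-- One field `F₀` serves all cases; they differ only in the mean that remains in the limit. -/
theorem IsInClass.exists_limitField {s A : ℝ} {Φ : E → ℝ} (hΦ : IsInClass s A Φ) (hs : 1 / 2 < s)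
    {μ : Measure I} [IsProbabilityMeasure μ] {P : Measure (ChargedConfiguration I)}
    [IsProbabilityMeasure P] (hP : IsScattererDistribution μ P) :
    ∃ F₀ : E → ChargedConfiguration I → E, (∀ x, Measurable (F₀ x)) ∧ TranslationInvariant P F₀ ∧
      IsHoltsmarkField μ P Φ (fun _ => 0) F₀ ∧
      (∀ M : E → E, IsHoltsmarkField μ P Φ M (fun x ω => F₀ x ω + M x)) ∧
      (∀ D m, Exhausts D → HasMeanForce s D m → ConvergesInLaw P (truncatedField Φ D)
        fun x ω => F₀ x ω + (-A * meanCharge μ) • m x) ∧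
      (meanCharge μ = 0 → ∀ D, Exhausts D → ConvergesInLaw P (truncatedField Φ D) F₀) ∧
      (I = {1} ∧ GradIntegrableAtOrigin Φ → ∀ D, Exhausts D →
        ConvergesInLaw P (backgroundField Φ D) F₀) := by
  obtain ⟨F₀, hm, hinv, hfield, hconv⟩ := IsScattererDistribution.exists_holtsmarkField hΦ hs hP
  refine ⟨F₀, hm, hinv, by simpa using hfield fun _ => 0, hfield, ?_, ?_, ?_⟩
  · intro D m hD hDm
    have h1 := hconv D (fun _ _ => 0) (fun x => (-A * meanCharge μ) • m x) hD (fun x => by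
      have h2 := ((hΦ.tendsto_setIntegral_farGradient hD hDm x).const_smul (meanCharge μ)).neg
      simp only [add_zero]
      convert h2 using 2
      module) (fun _ _ _ => rfl)
    simpa using h1
  · intro hq D hD
    have h1 := hconv D (fun _ _ => 0) (fun _ => 0) hD (fun x => by simp [hq]) (fun _ _ _ => rfl)
    simpa using h1
  · rintro ⟨hI, hint⟩ D hD
    have hcut := hΦ.integrable_cutoff (ξ := fun _ => 1) (.inr ⟨hint, rfl⟩)
    -- The background cancels the compensator up to the integral of `∇Φ` minus its far part, an odd
    -- integrable field. Since the only charge is one, the degenerate case of no charge cannot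
    -- occur.
    have h1 := hconv D (fun R x => ∫ y in D R, gradient Φ (x - y)) (fun _ => 0) hD (fun x => by
      have h2 := hD.tendsto_setIntegral hcut.1 x
      rw [integral_eq_zero_of_odd hcut.2] at h2
      refine h2.congr' ?_
      filter_upwards [eventually_gt_atTop 0] with R hR
      have h3 : IntegrableOn (fun y => farGradient Φ (x - y)) (D R) :=
        integrableOn_comp_sub_of_locallyIntegrable (hΦ.locallyIntegrable_farGradient hs)
          (hD.isBounded R hR) x
      have h4 : IntegrableOn (fun y => gradient Φ (x - y)) (D R) := by
        refine (((hcut.1.comp_sub_left x).integrableOn).add h3).congr (.of_forall fun y => ?_)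
        simp
      rw [meanCharge_singleton_one hI, one_smul, neg_add_eq_sub, ← integral_sub h4 h3]
      simp) (fun h0 => by
      exfalso
      have h2 : {q : I | (q : ℝ) ≠ 0} = univ := by
        ext q
        have h3 : (q : ℝ) = 1 := by
          exact Finset.mem_singleton.1 ((Finset.ext_iff.1 hI q).1 q.2)
        simp [h3]
      rw [h2, measure_univ] at h0
      exact one_ne_zero h0)
    simp only [add_zero] at h1
    exact h1

end

end Holtsmark

/-! ### The theorem. -/

theorem mainTheorem1 (s A : ℝ) (hs : 1 / 2 < s) (Φ : Holtsmark.E → ℝ)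
    (hΦ : Holtsmark.IsInClass s A Φ) (I : Finset ℝ) (μ : Measure I) [IsProbabilityMeasure μ]
    (P : Measure (Holtsmark.ChargedConfiguration I)) [IsProbabilityMeasure P]
    (hP : Holtsmark.IsScattererDistribution μ P) :
    -- a.1 and a.2: fast decay, or neutrality
    ((2 < s ∨ Holtsmark.meanCharge μ = 0) →
      ∃ F : Holtsmark.E → Holtsmark.ChargedConfiguration I → Holtsmark.E,
        Holtsmark.IsHoltsmarkField μ P Φ (fun _ => 0) F ∧
        Holtsmark.TranslationInvariant P F ∧
        ∀ U : Set Holtsmark.E, Holtsmark.IsC1Domain U →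
          Holtsmark.ConvergesInLaw P
            (Holtsmark.truncatedField Φ (Holtsmark.dilates U)) F ∧
          Holtsmark.IsLimitMeanForce s A μ (Holtsmark.dilates U) (fun _ => 0)) ∧
    -- a.3: one charge equal to one, with uniform background
    ((I = {1} ∧ Holtsmark.GradIntegrableAtOrigin Φ) →
      ∃ F : Holtsmark.E → Holtsmark.ChargedConfiguration I → Holtsmark.E,
        Holtsmark.IsHoltsmarkField μ P Φ (fun _ => 0) F ∧
        Holtsmark.TranslationInvariant P F ∧
        ∀ U : Set Holtsmark.E, Holtsmark.IsC1Domain U →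
          Holtsmark.ConvergesInLaw P
            (Holtsmark.backgroundField Φ (Holtsmark.dilates U)) F) ∧
    -- b: symmetric domains
    ((1 < s ∧ s ≤ 2) →
      (∃ F : Holtsmark.E → Holtsmark.ChargedConfiguration I → Holtsmark.E,
        Holtsmark.IsHoltsmarkField μ P Φ (fun _ => 0) F ∧
        Holtsmark.TranslationInvariant P F ∧
        ∀ U : Set Holtsmark.E, Holtsmark.IsC1Domain U → Holtsmark.IsBalanced s U →
          Holtsmark.ConvergesInLaw P
            (Holtsmark.truncatedField Φ (Holtsmark.dilates U)) F ∧
          Holtsmark.IsLimitMeanForce s A μ (Holtsmark.dilates U) (fun _ => 0)) ∧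
      -- small displacements of the domains may create a nonzero mean force
      (Holtsmark.meanCharge μ ≠ 0 →
        ∀ U : Set Holtsmark.E, Holtsmark.IsC1Domain U → Holtsmark.IsBalanced s U →
          ∃ (ε₀ : ℝ) (M : Holtsmark.E → Holtsmark.E → Holtsmark.E), 0 < ε₀ ∧
            (∀ e : Holtsmark.E, ‖e‖ < ε₀ →
              ∃ F : Holtsmark.E → Holtsmark.ChargedConfiguration I → Holtsmark.E,
                Holtsmark.IsHoltsmarkField μ P Φ (M e) F ∧
                Holtsmark.ConvergesInLaw P
                  (Holtsmark.truncatedField Φ (Holtsmark.shiftedDilates U s e)) F ∧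
                Holtsmark.IsLimitMeanForce s A μ (Holtsmark.shiftedDilates U s e) (M e)) ∧
            ∀ ε : ℝ, 0 < ε → ∃ e : Holtsmark.E, ‖e‖ < ε ∧ ∃ x, M e x ≠ 0)) ∧
    -- c: the Coulomb case
    (s = 1 →
      (∀ U : Set Holtsmark.E, Holtsmark.IsC1Domain U → Holtsmark.IsCoulombBalanced U →
        ∃ F : Holtsmark.E → Holtsmark.ChargedConfiguration I → Holtsmark.E,
          Holtsmark.IsHoltsmarkField μ P Φ (Holtsmark.coulombMeanForce A μ U) F ∧
          Holtsmark.ConvergesInLaw P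
            (Holtsmark.truncatedField Φ (Holtsmark.dilates U)) F ∧
          Holtsmark.IsLimitMeanForce s A μ (Holtsmark.dilates U)
            (Holtsmark.coulombMeanForce A μ U) ∧
          (Holtsmark.meanCharge μ ≠ 0 → ¬ Holtsmark.TranslationInvariant P F)) ∧
      -- the law of the limit field depends on the domain
      (Holtsmark.meanCharge μ ≠ 0 →
        ∃ U₁ U₂ : Set Holtsmark.E,
          Holtsmark.IsC1Domain U₁ ∧ Holtsmark.IsCoulombBalanced U₁ ∧
          Holtsmark.IsC1Domain U₂ ∧ Holtsmark.IsCoulombBalanced U₂ ∧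
          ∀ F₁ F₂ : Holtsmark.E → Holtsmark.ChargedConfiguration I → Holtsmark.E,
            Holtsmark.ConvergesInLaw P
              (Holtsmark.truncatedField Φ (Holtsmark.dilates U₁)) F₁ →
            Holtsmark.ConvergesInLaw P
              (Holtsmark.truncatedField Φ (Holtsmark.dilates U₂)) F₂ →
            ∃ x, P.map (F₁ x) ≠ P.map (F₂ x))) := by
  open Holtsmark in
  obtain ⟨F₀, hm, hinv, hF₀, hfield, hconv, hneutral, hback⟩ := hΦ.exists_limitField hs hP
  refine ⟨?_, ?_, ?_, ?_⟩
  · rintro (hs2 | hq)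
    · refine ⟨F₀, hF₀, hinv, fun U hU => ?_⟩
      have hmean := hU.exhausts_dilates.hasMeanForce_of_two_lt hs2
      exact ⟨by simpa using hconv _ _ hU.exhausts_dilates hmean,
        by simpa using hmean.isLimitMeanForce A μ⟩
    · exact ⟨F₀, hF₀, hinv, fun U hU => ⟨hneutral hq _ hU.exhausts_dilates,
        isLimitMeanForce_of_meanCharge_eq_zero hq s A _⟩⟩
  · exact fun h => ⟨F₀, hF₀, hinv, fun U hU => hback h _ hU.exhausts_dilates⟩
  · rintro ⟨hs1, hs2⟩
    refine ⟨⟨F₀, hF₀, hinv, fun U hU hbal => ?_⟩, fun hq U hU hbal => ?_⟩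
    · obtain ⟨δ, hδ, hball⟩ := hU.exists_ball_subset
      have h0 := hbal.domainForce_zero hδ hU.isBounded
        ((Metric.ball_subset_ball (by linarith)).trans hball)
      -- The undisplaced domains are the case `e = 0`, whose limit force is zero by balance.
      have hmean := hasMeanForce_shiftedDilates hs1 hs2 hδ hU.isBounded hball h0 (e := 0)
        (by simpa using hδ)
      rw [displacementForce_zero h0, shiftedDilates_zero] at hmean
      exact ⟨by simpa using hconv _ _ hU.exhausts_dilates hmean,
        by simpa using hmean.isLimitMeanForce A μ⟩
    · obtain ⟨δ, hδ, hball⟩ := hU.exists_ball_subset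
      have hball' := (Metric.ball_subset_ball (by linarith : δ ≤ 2 * δ)).trans hball
      have h0 := hbal.domainForce_zero hδ hU.isBounded hball'
      refine ⟨δ, fun e _ => (-A * meanCharge μ) • displacementForce s δ U e, hδ,
        fun e he => ?_, fun ε hε => ?_⟩
      · have hmean := hasMeanForce_shiftedDilates hs1 hs2 hδ hU.isBounded hball h0 he
        exact ⟨_, hfield _, hconv _ _ (hU.exhausts_shiftedDilates hs2 hδ hball he) hmean,
          hmean.isLimitMeanForce A μ⟩
      · obtain ⟨e, he, hne⟩ := exists_displacementForce_ne_zero hs1.le hδ hU.isBounded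
          hU.isOpen.measurableSet hball' hε
        -- The mean force does not depend on `x`, so any point can be the witness.
        exact ⟨e, he, 0, smul_ne_zero (mul_ne_zero (neg_ne_zero.2 hΦ.ne_zero) hq) hne⟩
  · rintro rfl
    refine ⟨fun U hU hbal => ?_, fun hq => ?_⟩
    · obtain ⟨δ, hδ, hball⟩ := hU.exists_ball_subset
      have hball' := (Metric.ball_subset_ball (by linarith : δ ≤ 2 * δ)).trans hball
      have h0 := hbal.domainForce_zero hδ hU.isBounded hball'
      have hmean := hasMeanForce_dilates_coulomb hδ hU.isBounded hball h0
      have hM := coulombMeanForce_eq A μ hU hδ hball'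
      rw [← funext_iff] at hM
      rw [hM]
      refine ⟨_, hfield _, hconv _ _ hU.exhausts_dilates hmean, hmean.isLimitMeanForce A μ,
        fun hq hTI => ?_⟩
      obtain ⟨x, hx⟩ := DFunLike.ne_iff.1
        (domainForceDeriv_ne_zero le_rfl hδ hU.isBounded hU.isOpen.measurableSet hball')
      have hne : (-A * meanCharge μ) • domainForceDeriv 1 δ U 0 x ≠ 0 :=
        smul_ne_zero (mul_ne_zero (neg_ne_zero.2 hΦ.ne_zero) hq) hx
      -- If the field were translation invariant, its law at `x` would be its law at the origin,
      -- where the linear mean vanishes. That is the law of `F₀` at the origin and hence at `x`,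
      -- which contradicts the different means.
      refine (hfield fun x => (-A * meanCharge μ) • domainForceDeriv 1 δ U 0 x).map_ne hF₀
        (x := x) hne ?_
      rw [hTI.map_eq (hfield _).measurable x, hinv.map_eq hm x]
      simp
    · obtain ⟨U₁, U₂, hU₁, hb₁, hU₂, hb₂, hball₁, hball₂, x, hx⟩ :=
        exists_domains_domainForceDeriv_ne
      refine ⟨U₁, U₂, hU₁, hb₁, hU₂, hb₂, fun F₁ F₂ hF₁ hF₂ => ⟨x, ?_⟩⟩
      -- Limits in law have unique one-point laws, so it is enough to compare the constructed limit
      -- fields. The choice `δ = 1/2` fits because both domains contain the unit ball.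
      have key : ∀ {U : Set E}, IsC1Domain U → IsCoulombBalanced U → Metric.ball 0 1 ⊆ U →
          ConvergesInLaw P (truncatedField Φ (dilates U)) fun x ω =>
            F₀ x ω + (-A * meanCharge μ) • domainForceDeriv 1 (1 / 2) U 0 x := by
        intro U hU hbal hball
        have hmean := hasMeanForce_dilates_coulomb (δ := 1 / 2) (by norm_num) hU.isBounded
          ((Metric.ball_subset_ball (by norm_num)).trans hball)
          (hbal.domainForce_zero (by norm_num) hU.isBounded
            ((Metric.ball_subset_ball (by norm_num)).trans hball))
        exact hconv _ _ hU.exhausts_dilates hmean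
      rw [hF₁.map_eq (key hU₁ hb₁ hball₁) x, hF₂.map_eq (key hU₂ hb₂ hball₂) x]
      refine (hfield fun x => (-A * meanCharge μ) • domainForceDeriv 1 (1 / 2) U₁ 0 x).map_ne
        (hfield fun x => (-A * meanCharge μ) • domainForceDeriv 1 (1 / 2) U₂ 0 x) fun h => hx ?_
      exact smul_right_injective _ (mul_ne_zero (neg_ne_zero.2 hΦ.ne_zero) hq) h
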